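/- **Setting.** A multigraph is finite and may have parallel edges and self-loops; a self-loop at $v$ contributes two to the degree of $v$. Every edge consists of two half-edges, one at each of its endpoints (both at $v$ for a self-loop at $v$). In the $\mathsf{LOCAL}$ model on an $n$-node multigraph, each node initially knows $n$, its degree (its incident half-edges are numbered by port numbers $0,\dots,d(v)-1$, in an arbitrary way) and a unique $O(\log n)$-bit identifier, that is, an identifier in $\{0,\dots,n^k-1\}$ for an arbitrary fixed constant $k$. In each synchronous round every node sends one message of arbitrary size along each incident half-edge and receives one along each; local computation is unbounded. At the end every node labels its incident half-edges (with "outgoing"/"incoming", or with "red"/"black"). In a randomized algorithm each node also has private, independent, fair random bits, and for every constant $c$ there has to be an algorithm whose output is correct with probability at least $1-n^{-c}$. The hidden constants may depend on $k$ (and on $c$ in the randomized case). In a 5-regular multigraph, a *decomposition with half-paths of length at most* $\ell$ is a coloring of the half-edges red and black such that exactly two half-edges at each node are red, and the red half-edges form paths (never cycles), each of at most $\ell$ half-edges; here two red half-edges are consecutive if they are the two red half-edges of one node or the two halves of one edge. **Lemma.** Each of the following three problems can be solved in $O(\log n)$ rounds by deterministic algorithms and in $O(\log\log n)$ rounds by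 randomized algorithms: 1. Given any multigraph, find an orientation of its edges such that every node of degree at least $5$ has outdegree at least $2$. 2. Given a $5$-regular multigraph, find an orientation of its edges such that every node has outdegree at least $2$. 3. Given a $5$-regular multigraph, find a decomposition with half-paths of length at most $8$. -/

import Mathlib

namespace LocalModel

open Filter Asymptotics

/-- A multigraph on the node set `V`, with a port numbering. Node `v` has degree `deg v`, and its
incident half-edges are its ports `0, …, deg v - 1`. The involution `opp` sends each half-edge to
the other half of its edge, so an edge is a pair `{p, opp p}` of distinct ports. Parallel edges and
self-loops are allowed; a self-loop at `v` occupies two ports of `v` and so adds two to `deg v`. -/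
structure Network (V : Type) where
  deg : V → ℕ
  opp : (Σ v, Fin (deg v)) → Σ v, Fin (deg v)
  opp_opp : ∀ p, opp (opp p) = p
  opp_ne : ∀ p, opp p ≠ p

/-- The half-edges (ports) of a network; `p.1` is the node of the half-edge `p`. -/
abbrev Network.Port {V : Type} (N : Network V) : Type := Σ v, Fin (N.deg v)

/-- A multigraph is `d`-regular if all its nodes have degree `d`. -/
def Network.IsRegular {V : Type} (N : Network V) (d : ℕ) : Prop := ∀ v, N.deg v = d

/-- The number of half-edges at `v` that carry the label `true`. -/
def Network.count {V : Type} (N : Network V) (x : N.Port → Bool) (v : V) : ℕ :=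
  (Finset.univ.filter fun i : Fin (N.deg v) => x ⟨v, i⟩ = true).card

/-- An orientation of the edges, recorded at the half-edges: `x p = true` says that the edge of `p`
is outgoing at the half `p` (it leaves the node `p.1`), and then it is incoming at the other half.
-/
def Network.IsOrientation {V : Type} (N : Network V) (x : N.Port → Bool) : Prop :=
  ∀ p, x (N.opp p) = !(x p)

/-- The outdegree of `v` in the orientation `x`. -/
def Network.outdeg {V : Type} (N : Network V) (x : N.Port → Bool) (v : V) : ℕ := N.count x v

/-- `h 0, …, h (m - 1)` is a walk along `m` red half-edges: consecutive half-edges are alternately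
the two halves of one edge, and two different half-edges at one node
(either kind may come first). -/
def Network.IsRedWalk {V : Type} (N : Network V) (red : N.Port → Bool) (m : ℕ) (h : ℕ → N.Port) :
    Prop :=
  (∀ i, i < m → red (h i) = true) ∧
  ∃ s : ℕ, ∀ i, i + 1 < m →
    if Even (i + s) then h (i + 1) = N.opp (h i)
    else (h (i + 1)).1 = (h i).1 ∧ h (i + 1) ≠ h i

/-- A decomposition with half-paths of length `k`: exactly two half-edges at each node are red
(all others are black), and the red half-edges form paths, never cycles, of at most `k` half-edges
each. A cycle is excluded by demanding that no walk along red half-edges comes back to a half-edge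
that it has already used. -/
structure Network.IsHalfPathDecomposition {V : Type} (N : Network V) (k : ℕ)
    (red : N.Port → Bool) : Prop where
  two_red : ∀ v, N.count red v = 2
  no_cycle : ∀ m h, N.IsRedWalk red m h → Set.InjOn h (Set.Iio m)
  length_le : ∀ m h, N.IsRedWalk red m h → m ≤ k

/-- A synchronous message-passing algorithm of the LOCAL model. `S n` is the type of the private
random strings in networks with `n` nodes. A node starts with the knowledge of `n`, of its
identifier, of its degree and of its random string. In every round it sends one message through
each port, receives one through each port, and updates its state; local computation and message
size are unbounded. At the end it labels each of its half-edges. -/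
structure Algorithm (S : ℕ → Type) (Out : Type) where
  State : Type
  Msg : Type
  init : (n ident d : ℕ) → S n → State
  send : (d : ℕ) → State → Fin d → Msg
  update : (d : ℕ) → State → (Fin d → Msg) → State
  output : (d : ℕ) → State → Fin d → Out

namespace Algorithm

variable {S : ℕ → Type} {Out V : Type}

/-- One round: the message that arrives at a port is the one sent through the opposite port. -/
def round (A : Algorithm S Out) (N : Network V) (σ : V → A.State) : V → A.State :=
  fun v => A.update (N.deg v) (σ v) fun i =>
    A.send (N.deg (N.opp ⟨v, i⟩).1) (σ (N.opp ⟨v, i⟩).1) (N.opp ⟨v, i⟩).2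

/-- The states of all nodes after `t` rounds. -/
def stateAfter (A : Algorithm S Out) [Fintype V] (N : Network V) (ident : V → ℕ)
    (ω : V → S (Fintype.card V)) : ℕ → V → A.State
  | 0 => fun v => A.init (Fintype.card V) (ident v) (N.deg v) (ω v)
  | t + 1 => A.round N (A.stateAfter N ident ω t)

/-- The labels of the half-edges that the algorithm outputs after `t` rounds. -/
def run (A : Algorithm S Out) [Fintype V] (N : Network V) (ident : V → ℕ)
    (ω : V → S (Fintype.card V)) (t : ℕ) : N.Port → Out :=
  fun p => A.output (N.deg p.1) (A.stateAfter N ident ω t p.1) p.2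

end Algorithm

/-- A labelling problem: which labellings of the half-edges of a network are solutions. -/
abbrev Problem (Out : Type) : Type 1 := ∀ (V : Type) (N : Network V), (N.Port → Out) → Prop

/-- Unique identifiers of `O(log n)` bits: pairwise different numbers below `n ^ k`. -/
def IsIdentifiers {V : Type} [Fintype V] (k : ℕ) (ident : V → ℕ) : Prop :=
  Function.Injective ident ∧ ∀ v, ident v < Fintype.card V ^ k

/-- `P` is solved by deterministic LOCAL algorithms in `O(f n)` rounds, `n` the number of nodes. -/
def DetSolvable {Out : Type} (P : Problem Out) (f : ℕ → ℝ) : Prop :=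
  ∀ k : ℕ, ∃ (A : Algorithm (fun _ => Unit) Out) (T : ℕ → ℕ),
    (fun n => (T n : ℝ)) =O[atTop] f ∧
    ∀ (V : Type) [Fintype V] (N : Network V) (ident : V → ℕ), IsIdentifiers k ident →
      P V N (A.run N ident (fun _ => ()) (T (Fintype.card V)))

/-- The probability that `E` fails for a uniformly random element of a finite type. -/
noncomputable def failureProb {Ω : Type} (E : Ω → Prop) : ℝ :=
  (Nat.card {ω // ¬ E ω} : ℝ) / Nat.card Ω

/-- `P` is solved with high probability by randomized LOCAL algorithms in `O(f n)` rounds: for every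
constant `c` there is an algorithm with failure probability at most `1 / n ^ c`. Each node has
`b n` private, independent and fair random bits. -/
def RandSolvable {Out : Type} (P : Problem Out) (f : ℕ → ℝ) : Prop :=
  ∀ k c : ℕ, ∃ (b : ℕ → ℕ) (A : Algorithm (fun n => Fin (b n) → Bool) Out) (T : ℕ → ℕ),
    (fun n => (T n : ℝ)) =O[atTop] f ∧
    ∀ (V : Type) [Fintype V] (N : Network V) (ident : V → ℕ), IsIdentifiers k ident →
      failureProb (fun ω : V → Fin (b (Fintype.card V)) → Bool =>
        P V N (A.run N ident ω (T (Fintype.card V)))) ≤ 1 / (Fintype.card V : ℝ) ^ c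

/-- In any multigraph, orient the edges so that all nodes of degree at least 5 have outdegree at
least 2. -/
def outdegreeTwo : Problem Bool := fun _ N x =>
  N.IsOrientation x ∧ ∀ v, 5 ≤ N.deg v → 2 ≤ N.outdeg x v

/-- In a 5-regular multigraph, orient the edges so that all nodes have outdegree at least 2. -/
def outdegreeTwoRegular : Problem Bool := fun _ N x =>
  N.IsRegular 5 → N.IsOrientation x ∧ ∀ v, 2 ≤ N.outdeg x v

/-- In a 5-regular multigraph, find a decomposition with half-paths of length at most 8. -/
def halfPathEight : Problem Bool := fun _ N red =>
  N.IsRegular 5 → N.IsHalfPathDecomposition 8 red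

end LocalModel

/-!
All three problems reduce to solving sinkless orientation twice: in a graph whose nodes have three
half-edges each, orient the edges such that every node has an outgoing half-edge. The ruling sets
used below are found from the identifiers by Cole–Vishkin colour reduction.

*Sinkless orientation.* Tree edges of a breadth-first search ball can be redirected so that all its
nodes have an outgoing half-edge, as soon as the ball contains a loose end or a cycle. Balls without
them grow exponentially, so radius `O(log n)` suffices. In the randomized algorithm, the nodes of a
ruling set direct one edge each by a coin in advance. A ball that contains such an edge directed
outwards is satisfied as well; hence a ball of radius `O(log log n)` can only fail if `Ω(log n)`
coins have prescribed outcomes, which has probability at most `n ^ (-c)`. Different nodes may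
orient an edge by different balls, and one rule for choosing between these orientations keeps all
nodes satisfied.

*Two outgoing half-edges.* Group the first four half-edges of each node of degree at least 5 in two
pairs; these pairs form trails. A ruling set of the pairs gives triples of consecutive pairs.
Joining each pair to the other pair of its node, a sinkless orientation of the graph of the triples
chooses one pair at each node, such that every triple contains a chosen pair. When the trails are
broken at the chosen pairs, they fall into chains of constant length. Contract these chains. What
remains at each node are its chosen pair and its fifth half-edge, and a sinkless orientation of the
contracted graph gives one outgoing half-edge among these three. Orienting the chains consistently
gives another one in the pair that is not chosen.

If two outgoing half-edges at each node are red, then no edge is entirely red, and so half-paths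
consist of two half-edges.
-/

namespace LocalModel

/-! ### Reachability and separated dominating sets -/

section Reachability
variable {O ι : Type*} {st : ι → O → O}

/-- `y` can be reached from `x` by at most `n` moves along the maps `st i`. Graphs are given by such
maps, one for each direction in which a vertex can be left; where an edge is missing, the map stays
at `x`. -/
def StepReach (st : ι → O → O) : ℕ → O → O → Prop
  | 0, x, y => y = x
  | n + 1, x, y => StepReach st n x y ∨ ∃ i, StepReach st n (st i x) y

/-- The graph given by the maps `st i` is undirected: every move along an edge can be undone. -/
def StepSymm (st : ι → O → O) : Prop := ∀ i x, st i x ≠ x → ∃ j, st j (st i x) = x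

theorem StepReach.refl (n : ℕ) (x : O) : StepReach st n x x := by
  induction n with
  | zero => rfl
  | succ n ih => exact Or.inl ih

theorem StepReach.step (i : ι) (x : O) : StepReach st 1 x (st i x) := Or.inr ⟨i, rfl⟩

theorem StepReach.mono {n m : ℕ} (h : n ≤ m) {x y : O} (hxy : StepReach st n x y) :
    StepReach st m x y := by
  induction m, h using Nat.le_induction with
  | base => exact hxy
  | succ m _ ih => exact Or.inl ih

theorem StepReach.trans {n m : ℕ} {x y z : O} (hxy : StepReach st n x y)
    (hyz : StepReach st m y z) : StepReach st (n + m) x z := by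
  induction n generalizing x with
  | zero => cases hxy; rwa [Nat.zero_add]
  | succ n ih =>
    rw [Nat.succ_add]
    exact hxy.imp ih fun ⟨i, h⟩ => ⟨i, ih h⟩

theorem StepReach.symm (hst : StepSymm st) {n : ℕ} {x y : O} (h : StepReach st n x y) :
    StepReach st n y x := by
  induction n generalizing x with
  | zero => exact Eq.symm h
  | succ n ih =>
    rcases h with h | ⟨i, h⟩
    · exact Or.inl (ih h)
    · by_cases hi : st i x = x
      · exact Or.inl (ih (hi ▸ h))
      · obtain ⟨j, hj⟩ := hst i x hi
        exact (ih h).trans (m := 1) (Or.inr ⟨j, hj.symm⟩)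

/-- The map `st i` for `some i`, and no move for `none`. -/
def moveOrStay (st : ι → O → O) (o : Option ι) (x : O) : O := o.elim x fun i => st i x

/-- The vertex that is reached from `x` along the route `κ`, which consists of at most `r` moves. -/
def route (st : ι → O → O) : (r : ℕ) → (Fin r → Option ι) → O → O
  | 0, _, x => x
  | r + 1, κ, x => route st r (Fin.tail κ) (moveOrStay st (κ 0) x)

theorem stepReach_moveOrStay (o : Option ι) (x : O) : StepReach st 1 x (moveOrStay st o x) := by
  cases o with
  | none => exact .refl 1 x
  | some i => exact .step i x

theorem stepReach_route (r : ℕ) (κ : Fin r → Option ι) (x : O) :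
    StepReach st r x (route st r κ x) := by
  induction r generalizing x with
  | zero => rfl
  | succ r ih =>
    exact ((stepReach_moveOrStay (κ 0) x).trans (ih (Fin.tail κ) _)).mono (Nat.add_comm 1 r).le

theorem StepReach.exists_route {r : ℕ} {x y : O} (h : StepReach st r x y) :
    ∃ κ, route st r κ x = y := by
  induction r generalizing x with
  | zero => exact ⟨Fin.elim0, Eq.symm h⟩
  | succ r ih =>
    obtain ⟨o, ho⟩ : ∃ o, StepReach st r (moveOrStay st o x) y :=
      h.elim (fun h => ⟨none, h⟩) fun ⟨i, h⟩ => ⟨some i, h⟩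
    obtain ⟨κ, hκ⟩ := ih ho
    exact ⟨Fin.cons o κ, by simpa only [route, Fin.tail_cons, Fin.cons_zero] using hκ⟩

end Reachability

section ColeVishkin
variable {O : Type*}

/-- The lowest bit position at which two numbers differ (`0` if they are equal). -/
noncomputable def firstDiff (a b : ℕ) : ℕ := sInf {i | a.testBit i ≠ b.testBit i}

theorem testBit_firstDiff {a b : ℕ} (h : a ≠ b) :
    a.testBit (firstDiff a b) ≠ b.testBit (firstDiff a b) :=
  Nat.sInf_mem (Nat.exists_testBit_ne_of_ne h)

theorem firstDiff_lt {a b l : ℕ} (hl : 0 < l) (ha : a < 2 ^ l) (hb : b < 2 ^ l) :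
    firstDiff a b < l := by
  rcases eq_or_ne a b with rfl | hab
  · simpa [firstDiff] using hl
  · by_contra! hle
    have hpow : 2 ^ l ≤ 2 ^ firstDiff a b := Nat.pow_le_pow_right two_pos hle
    apply testBit_firstDiff hab
    rw [Nat.testBit_lt_two_pow (ha.trans_le hpow), Nat.testBit_lt_two_pow (hb.trans_le hpow)]

/-- One round of Cole–Vishkin colour reduction along the map `f`: the new colour of `x` is the first
position at which the colours of `x` and `f x` differ, together with the bit of `x` there. -/
noncomputable def coleVishkinStep (f : O → O) (c : O → ℕ) (x : O) : ℕ :=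
  2 * firstDiff (c x) (c (f x)) + ((c x).testBit (firstDiff (c x) (c (f x)))).toNat

theorem coleVishkinStep_ne {f : O → O} {c : O → ℕ} {x : O} (h : c x ≠ c (f x)) :
    coleVishkinStep f c x ≠ coleVishkinStep f c (f x) := by
  intro heq
  simp only [coleVishkinStep] at heq
  have hlt := Bool.toNat_lt ((c x).testBit (firstDiff (c x) (c (f x))))
  have hlt' := Bool.toNat_lt ((c (f x)).testBit (firstDiff (c (f x)) (c (f (f x)))))
  have hpos : firstDiff (c x) (c (f x)) = firstDiff (c (f x)) (c (f (f x))) := by omega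
  rw [← hpos] at heq
  have hinj : Function.Injective Bool.toNat := by decide
  exact testBit_firstDiff h (hinj (by omega))

theorem coleVishkinStep_lt {f : O → O} {c : O → ℕ} {l : ℕ} (hl : 0 < l) (h : ∀ x, c x < 2 ^ l)
    (x : O) : coleVishkinStep f c x < 2 * l := by
  have hpos := firstDiff_lt hl (h x) (h (f x))
  have hbit := Bool.toNat_lt ((c x).testBit (firstDiff (c x) (c (f x))))
  simp only [coleVishkinStep]
  omega

theorem four_mul_le_two_pow_pred {b : ℕ} (h : 6 ≤ b) : 4 * b ≤ 2 ^ (b - 1) := by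
  induction b, h using Nat.le_induction with
  | base => norm_num
  | succ b hb ih =>
    have hpow : 2 ^ (b + 1 - 1) = 2 * 2 ^ (b - 1) := by
      rw [← pow_succ', Nat.add_sub_cancel, Nat.sub_add_cancel (by omega)]
    omega

theorem coleVishkinStep_lt_max {f : O → O} {c : O → ℕ} {K : ℕ} (h : ∀ x, c x < max 64 K) (x : O) :
    coleVishkinStep f c x < max 64 (K / 2) := by
  have hclog : 0 < Nat.clog 2 (max 64 K) := Nat.clog_pos one_lt_two (by omega)
  have hlt : coleVishkinStep f c x < 2 * Nat.clog 2 (max 64 K) :=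
    coleVishkinStep_lt hclog (fun x => (h x).trans_le (Nat.le_pow_clog one_lt_two _)) x
  rcases le_or_gt (Nat.clog 2 (max 64 K)) 32 with hle | hgt
  · omega
  · have hfour := four_mul_le_two_pow_pred (b := Nat.clog 2 (max 64 K)) (by omega)
    have hpow : 2 ^ (Nat.clog 2 (max 64 K) - 1) < max 64 K :=
      Nat.pow_pred_clog_lt_self one_lt_two (by omega)
    omega

/-- The colours after `s` rounds of Cole–Vishkin colour reduction along `f`. -/
noncomputable def coleVishkin (f : O → O) (c : O → ℕ) : ℕ → O → ℕ
  | 0 => c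
  | s + 1 => coleVishkinStep f (coleVishkin f c s)

theorem coleVishkin_ne {f : O → O} {c : O → ℕ} {x : O} (h : c x ≠ c (f x)) (s : ℕ) :
    coleVishkin f c s x ≠ coleVishkin f c s (f x) := by
  induction s with
  | zero => exact h
  | succ s ih => exact coleVishkinStep_ne ih

theorem coleVishkin_succ_lt {f : O → O} {c : O → ℕ} {l : ℕ} (hl : 0 < l) (h : ∀ x, c x < 2 ^ l)
    (s : ℕ) (x : O) : coleVishkin f c (s + 1) x < max 64 (2 * l / 2 ^ s) := by
  induction s generalizing x with
  | zero => exact lt_max_of_lt_right (by simpa [coleVishkin] using coleVishkinStep_lt hl h x)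
  | succ s ih =>
    rw [pow_succ, ← Nat.div_div_eq_div_mul]
    exact coleVishkinStep_lt_max ih x

theorem coleVishkin_lt_64 {f : O → O} {c : O → ℕ} {n k γ : ℕ}
    (hγ : Nat.log 2 n + 1 ≤ 2 ^ γ) (h : ∀ x, c x < 2 * n ^ k) (x : O) :
    coleVishkin f c (γ + k + 5) x < 64 := by
  have hbits : ∀ x, c x < 2 ^ (k * (Nat.log 2 n + 1) + 1) := fun x => (h x).trans_le <| by
    rw [pow_succ', mul_comm k, pow_mul]
    gcongr
    exact (Nat.lt_pow_succ_log_self one_lt_two n).le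
  have hdiv : 2 * (k * (Nat.log 2 n + 1) + 1) / 2 ^ (γ + k + 4) = 0 := by
    apply Nat.div_eq_of_lt
    have hmul : k * (Nat.log 2 n + 1) ≤ 2 ^ k * 2 ^ γ := Nat.mul_le_mul Nat.lt_two_pow_self.le hγ
    have hone : 1 ≤ 2 ^ k * 2 ^ γ := Nat.one_le_iff_ne_zero.2 (by positivity)
    have hpow : 2 ^ (γ + k + 4) = 16 * (2 ^ k * 2 ^ γ) := by ring
    omega
  simpa [hdiv] using coleVishkin_succ_lt (f := f) (Nat.succ_pos _) hbits (γ + k + 4) x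

end ColeVishkin

section RulingSet
variable {O ι : Type*} {st : ι → O → O} {c : O → ℕ} {r s : ℕ}

/-- The number of colours of `routeColor`. -/
noncomputable def numColors (ι : Type*) (r : ℕ) : ℕ := Nat.card ((Fin r → Option ι) → Fin 64)

/-- A colouring that separates vertices at distance at most `r`. It is the product, over all routes
of length `r`, of the Cole–Vishkin colours along that route after `s` rounds. -/
noncomputable def routeColor [Finite ι] (st : ι → O → O) (r : ℕ) (c : O → ℕ) (s : ℕ) (x : O) : ℕ :=
  Finite.equivFin ((Fin r → Option ι) → Fin 64) fun κ =>
    Fin.ofNat 64 (coleVishkin (route st r κ) c s x)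

/-- `x` has a smaller colour than all other vertices at distance at most `r`. These vertices form a
set that is separated and dominating. -/
def IsRuling [Finite ι] (st : ι → O → O) (r : ℕ) (c : O → ℕ) (s : ℕ) (x : O) : Prop :=
  ∀ κ, route st r κ x ≠ x → routeColor st r c s x < routeColor st r c s (route st r κ x)

variable [Finite ι]

theorem routeColor_lt (x : O) : routeColor st r c s x < numColors ι r := Fin.is_lt _

theorem routeColor_ne (hlt : ∀ κ x, coleVishkin (route st r κ) c s x < 64)
    {κ : Fin r → Option ι} {x : O} (hx : c x ≠ c (route st r κ x)) :
    routeColor st r c s x ≠ routeColor st r c s (route st r κ x) := by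
  intro heq
  simp only [routeColor, Fin.val_inj, EmbeddingLike.apply_eq_iff_eq] at heq
  have hκ := congrArg Fin.val (congrFun heq κ)
  simp only [Fin.val_ofNat, Nat.mod_eq_of_lt (hlt _ _)] at hκ
  exact coleVishkin_ne hx s hκ

theorem IsRuling.eq_of_stepReach (hst : StepSymm st) {x y : O} (hx : IsRuling st r c s x)
    (hy : IsRuling st r c s y) (h : StepReach st r x y) : x = y := by
  by_contra hne
  obtain ⟨κ, rfl⟩ := h.exists_route
  obtain ⟨κ', hκ'⟩ := (h.symm hst).exists_route
  have hlt := hy κ' (by rwa [hκ'])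
  rw [hκ'] at hlt
  exact lt_asymm hlt (hx κ (Ne.symm hne))

theorem exists_isRuling (hlt : ∀ κ x, coleVishkin (route st r κ) c s x < 64)
    (hc : ∀ κ x, route st r κ x ≠ x → c x ≠ c (route st r κ x)) (x : O) :
    ∃ m, IsRuling st r c s m ∧ StepReach st (r * numColors ι r) x m := by
  suffices descent : ∀ q x, routeColor st r c s x < q →
      ∃ m, IsRuling st r c s m ∧ StepReach st (r * q) x m from descent _ x (routeColor_lt x)
  intro q
  induction q with
  | zero => exact fun x hx => absurd hx (Nat.not_lt_zero _)
  | succ q ih =>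
    intro x hx
    by_cases hruling : IsRuling st r c s x
    · exact ⟨x, hruling, .refl _ _⟩
    · simp only [IsRuling, not_forall, not_lt] at hruling
      obtain ⟨κ, hκ, hle⟩ := hruling
      have hne := routeColor_ne hlt (hc κ x hκ)
      obtain ⟨m, hm, hreach⟩ := ih (route st r κ x) (by omega)
      exact ⟨m, hm, ((stepReach_route r κ x).trans hreach).mono (by rw [Nat.mul_succ]; omega)⟩

end RulingSet

/-! ### Functions that are determined by local views -/

/-- The other half of the half-edge with port number `i` at `v`, as a pair of a node and a port
number. If `v` has no such port, it is `(v, 0)`. -/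
def Network.neighbor {V : Type} (N : Network V) (v : V) (i : ℕ) : V × ℕ :=
  if h : i < N.deg v then ((N.opp ⟨v, i, h⟩).1, (N.opp ⟨v, i, h⟩).2.val) else (v, 0)

/-- The node `u` is at distance at most `k` from `v`. -/
abbrev Network.Within {V : Type} (N : Network V) (k : ℕ) (v u : V) : Prop :=
  StepReach (fun i v => (N.neighbor v i).1) k v u

namespace Network
variable {V : Type} {N : Network V}

theorem neighbor_of_lt {v : V} {i : ℕ} (h : i < N.deg v) :
    N.neighbor v i = ((N.opp ⟨v, i, h⟩).1, (N.opp ⟨v, i, h⟩).2.val) := dif_pos h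

theorem neighbor_of_not_lt {v : V} {i : ℕ} (h : ¬ i < N.deg v) : N.neighbor v i = (v, 0) :=
  dif_neg h

theorem neighbor_snd_lt {v : V} {i : ℕ} (h : i < N.deg v) :
    (N.neighbor v i).2 < N.deg (N.neighbor v i).1 := by
  rw [neighbor_of_lt h]
  exact (N.opp ⟨v, i, h⟩).2.isLt

theorem neighbor_neighbor {v : V} {i : ℕ} (h : i < N.deg v) :
    N.neighbor (N.neighbor v i).1 (N.neighbor v i).2 = (v, i) := by
  rw [neighbor_of_lt h, neighbor_of_lt (N.opp ⟨v, i, h⟩).2.isLt]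
  exact congrArg (fun p : N.Port => ((p.1, p.2.val) : V × ℕ)) (N.opp_opp ⟨v, i, h⟩)

theorem Within.symm {k : ℕ} {v u : V} (h : N.Within k v u) : N.Within k u v := by
  refine StepReach.symm (fun i v hne => ?_) h
  by_cases hi : i < N.deg v
  · exact ⟨(N.neighbor v i).2, congrArg Prod.fst (neighbor_neighbor hi)⟩
  · exact absurd (congrArg Prod.fst (neighbor_of_not_lt hi)) hne

end Network

/-- An input of an algorithm: a network together with identifiers and random strings. -/
structure Instance (S : ℕ → Type) (k : ℕ) where
  Node : Type
  [fintype : Fintype Node]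
  net : Network Node
  ident : Node → ℕ
  isIdentifiers : IsIdentifiers k ident
  random : Node → S (Fintype.card Node)

attribute [instance] Instance.fintype

/-- What a node knows after some rounds in which all nodes send everything they know: its own data
in the beginning, and after each further round its previous view and, for each port, the number of
the opposite port and the previous view of the node there. -/
inductive View (S : ℕ → Type) : Type
  | leaf (n ident d : ℕ) (s : S n) : View S
  | node (prev : View S) (port : ℕ → ℕ) (child : ℕ → View S) : View S

/-- The initial data of the node that has the view. -/
def View.root {S : ℕ → Type} : View S → ℕ × ℕ × ℕ × (Σ n, S n)
  | leaf n i d s => (n, i, d, ⟨n, s⟩)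
  | node p _ _ => p.root

namespace Instance
variable {S : ℕ → Type} {k : ℕ}

/-- The slots of an instance. The half-edges of the network and of the auxiliary graphs that an
algorithm builds, and the vertices of the latter, are all numbered objects hosted at nodes. -/
abbrev Slot (I : Instance S k) : Type := I.Node × ℕ

/-- The number of nodes. -/
def size (I : Instance S k) : ℕ := Fintype.card I.Node

/-- The view of a node after `t` rounds. -/
def view (I : Instance S k) : ℕ → I.Node → View S
  | 0, v => View.leaf I.size (I.ident v) (I.net.deg v) (I.random v)
  | t + 1, v => View.node (I.view t v)
      (fun i => if i < I.net.deg v then (I.net.neighbor v i).2 else 0)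
      (fun i => if i < I.net.deg v then I.view t (I.net.neighbor v i).1 else I.view t v)

/-- The name by which a slot is known to other nodes. -/
def tag (I : Instance S k) (x : I.Slot) : ℕ × ℕ := (I.ident x.1, x.2)

theorem tag_injective (I : Instance S k) : Function.Injective I.tag := fun _ _ h =>
  Prod.ext (I.isIdentifiers.1 (Prod.ext_iff.1 h).1) (Prod.ext_iff.1 h).2

variable {I J : Instance S k} {t t' : ℕ} {v : I.Node} {w : J.Node}

theorem root_view :
    ∀ t : ℕ, (I.view t v).root = (I.size, I.ident v, I.net.deg v, ⟨I.size, I.random v⟩)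
  | 0 => rfl
  | t + 1 => root_view t

theorem root_eq_of_view_eq (h : I.view t v = J.view t' w) :
    I.size = J.size ∧ I.ident v = J.ident w ∧ I.net.deg v = J.net.deg w ∧
      (⟨I.size, I.random v⟩ : Σ n, S n) = ⟨J.size, J.random w⟩ := by
  simpa only [root_view, Prod.mk.injEq] using congrArg View.root h

theorem size_eq_of_view_eq (h : I.view t v = J.view t' w) : I.size = J.size :=
  (root_eq_of_view_eq h).1

theorem ident_eq_of_view_eq (h : I.view t v = J.view t' w) : I.ident v = J.ident w :=
  (root_eq_of_view_eq h).2.1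

theorem deg_eq_of_view_eq (h : I.view t v = J.view t' w) : I.net.deg v = J.net.deg w :=
  (root_eq_of_view_eq h).2.2.1

theorem random_eq_of_view_eq (h : I.view t v = J.view t' w) :
    (⟨I.size, I.random v⟩ : Σ n, S n) = ⟨J.size, J.random w⟩ :=
  (root_eq_of_view_eq h).2.2.2

theorem view_eq_of_le (ht : t ≤ t') (h : I.view t' v = J.view t' w) : I.view t v = J.view t w := by
  induction t', ht using Nat.le_induction with
  | base => exact h
  | succ t' _ ih => exact ih (View.node.inj h).1

theorem neighbor_eq_of_view_eq (h : I.view (t + 1) v = J.view (t + 1) w) (i : ℕ) :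
    I.view t (I.net.neighbor v i).1 = J.view t (J.net.neighbor w i).1 ∧
      (I.net.neighbor v i).2 = (J.net.neighbor w i).2 := by
  have hdeg := deg_eq_of_view_eq h
  obtain ⟨hprev, hport, hchild⟩ := View.node.inj h
  have hport_i := congrFun hport i
  have hchild_i := congrFun hchild i
  by_cases hi : i < I.net.deg v
  · rw [if_pos hi, if_pos (hdeg ▸ hi)] at hport_i hchild_i
    exact ⟨hchild_i, hport_i⟩
  · rw [Network.neighbor_of_not_lt hi, Network.neighbor_of_not_lt (hdeg ▸ hi)]
    exact ⟨hprev, rfl⟩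

theorem exists_within_of_view_eq {l : ℕ} (h : I.view (t + l) v = J.view (t + l) w) {u : I.Node}
    (hu : I.net.Within l v u) : ∃ u', J.net.Within l w u' ∧ I.view t u = J.view t u' := by
  induction l generalizing v w with
  | zero => cases hu; exact ⟨w, rfl, h⟩
  | succ l ih =>
    rcases hu with hu | ⟨i, hu⟩
    · obtain ⟨u', hu', heq⟩ := ih (view_eq_of_le (by omega) h) hu
      exact ⟨u', Or.inl hu', heq⟩
    · obtain ⟨u', hu', heq⟩ := ih (neighbor_eq_of_view_eq (t := t + l) h i).1 hu
      exact ⟨u', Or.inr ⟨i, hu'⟩, heq⟩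

end Instance

section Locality
variable {S : ℕ → Type} {k : ℕ} {α β γ : Type*}

/-- The value of `a` at a slot is determined by the number of the slot and the view of its node
after `T n` rounds. -/
def IsLocalWithin (T : ℕ → ℕ) (a : ∀ I : Instance S k, I.Slot → α) : Prop :=
  ∀ (I J : Instance S k) (x : I.Slot) (y : J.Slot), I.size = J.size → x.2 = y.2 →
    I.view (T I.size) x.1 = J.view (T I.size) y.1 → a I x = a J y

/-- The value of `a` at a slot is determined by the number of the slot and the view of its node
after `O(g n)` rounds. -/
def IsLocal (g : ℕ → ℕ) (a : ∀ I : Instance S k, I.Slot → α) : Prop :=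
  ∃ C, IsLocalWithin (fun n => C * g n) a

/-- A map of slots that moves every slot by a bounded distance and whose values are determined by
the views after `O(g n)` rounds. -/
structure IsLocalMap (g : ℕ → ℕ) (f : ∀ I : Instance S k, I.Slot → I.Slot) : Prop where
  exists_within : ∃ K, ∀ (I : Instance S k) x, I.net.Within K x.1 (f I x).1
  tag : IsLocal g fun I x => I.tag (f I x)

variable {g : ℕ → ℕ} {a : ∀ I : Instance S k, I.Slot → α} {b : ∀ I : Instance S k, I.Slot → β}
  {c : ∀ I : Instance S k, I.Slot → γ} {p q : ∀ I : Instance S k, I.Slot → Prop}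
  {f f' : ∀ I : Instance S k, I.Slot → I.Slot}

theorem IsLocalWithin.mono {T T' : ℕ → ℕ} (h : ∀ n, T n ≤ T' n) (ha : IsLocalWithin T a) :
    IsLocalWithin T' a :=
  fun I J x y hsize hidx hview => ha I J x y hsize hidx (Instance.view_eq_of_le (h _) hview)

namespace IsLocal

theorem of_determines (ha : IsLocal g a)
    (h : ∀ (I J : Instance S k) (x : I.Slot) (y : J.Slot), a I x = a J y → c I x = c J y) :
    IsLocal g c := by
  obtain ⟨C, hC⟩ := ha
  exact ⟨C, fun I J x y hsize hidx hview => h I J x y (hC I J x y hsize hidx hview)⟩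

theorem prodMk (ha : IsLocal g a) (hb : IsLocal g b) : IsLocal g fun I x => (a I x, b I x) := by
  obtain ⟨C, hC⟩ := ha
  obtain ⟨D, hD⟩ := hb
  have hC' := hC.mono fun n => Nat.mul_le_mul_right (g n) (le_max_left C D)
  have hD' := hD.mono fun n => Nat.mul_le_mul_right (g n) (le_max_right C D)
  exact ⟨max C D, fun I J x y hsize hidx hview =>
    Prod.ext (hC' I J x y hsize hidx hview) (hD' I J x y hsize hidx hview)⟩

theorem of_determines₂ (ha : IsLocal g a) (hb : IsLocal g b)
    (h : ∀ (I J : Instance S k) (x : I.Slot) (y : J.Slot), a I x = a J y → b I x = b J y →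
      c I x = c J y) : IsLocal g c :=
  (ha.prodMk hb).of_determines fun I J x y hab =>
    h I J x y (Prod.ext_iff.1 hab).1 (Prod.ext_iff.1 hab).2

theorem map (F : α → β) (ha : IsLocal g a) : IsLocal g fun I x => F (a I x) :=
  ha.of_determines fun _ _ _ _ => congrArg F

theorem map₂ (F : α → β → γ) (ha : IsLocal g a) (hb : IsLocal g b) :
    IsLocal g fun I x => F (a I x) (b I x) :=
  ha.of_determines₂ hb fun _ _ _ _ => congrArg₂ F

theorem const (y : α) : IsLocal g fun (_ : Instance S k) _ => y :=
  ⟨0, fun _ _ _ _ _ _ _ => rfl⟩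

theorem index : IsLocal g fun (I : Instance S k) (x : I.Slot) => x.2 :=
  ⟨0, fun _ _ _ _ _ hidx _ => hidx⟩

theorem deg : IsLocal g fun (I : Instance S k) (x : I.Slot) => I.net.deg x.1 :=
  ⟨0, fun _ _ _ _ _ _ hview => Instance.deg_eq_of_view_eq hview⟩

theorem tag : IsLocal g fun (I : Instance S k) (x : I.Slot) => I.tag x :=
  ⟨0, fun _ _ _ _ _ hidx hview => Prod.ext (Instance.ident_eq_of_view_eq hview) hidx⟩

theorem random :
    IsLocal g fun (I : Instance S k) (x : I.Slot) => (⟨I.size, I.random x.1⟩ : Σ n, S n) :=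
  ⟨0, fun _ _ _ _ _ _ hview => Instance.random_eq_of_view_eq hview⟩

theorem pi {κ : Type*} [Finite κ] {a : κ → ∀ I : Instance S k, I.Slot → α}
    (h : ∀ i, IsLocal g (a i)) : IsLocal g fun I x i => a i I x := by
  choose C hC using h
  obtain ⟨D, hD⟩ := (Set.finite_range C).bddAbove
  exact ⟨D, fun I J x y hsize hidx hview => funext fun i =>
    (hC i).mono (fun n => Nat.mul_le_mul_right (g n) (hD ⟨i, rfl⟩)) I J x y hsize hidx hview⟩

theorem forall_finite {κ : Type*} [Finite κ] {p : κ → ∀ I : Instance S k, I.Slot → Prop}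
    (h : ∀ i, IsLocal g (p i)) : IsLocal g fun I x => ∀ i, p i I x :=
  (pi h).map fun p => ∀ i, p i

theorem not (hp : IsLocal g p) : IsLocal g fun I x => ¬ p I x := hp.map Not

theorem and (hp : IsLocal g p) (hq : IsLocal g q) : IsLocal g fun I x => p I x ∧ q I x :=
  hp.map₂ And hq

theorem or (hp : IsLocal g p) (hq : IsLocal g q) : IsLocal g fun I x => p I x ∨ q I x :=
  hp.map₂ Or hq

theorem imp (hp : IsLocal g p) (hq : IsLocal g q) : IsLocal g fun I x => p I x → q I x :=
  hp.map₂ (fun p q => p → q) hq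

theorem ite {dec : ∀ I x, Decidable (p I x)} {a b : ∀ I : Instance S k, I.Slot → α}
    (hp : IsLocal g p) (ha : IsLocal g a) (hb : IsLocal g b) :
    IsLocal g fun I x => if p I x then a I x else b I x :=
  (hp.prodMk ha).of_determines₂ hb fun _ _ _ _ hpa hb => by
    obtain ⟨hp, ha⟩ := Prod.ext_iff.1 hpa
    dsimp only at hp ha
    simp only [hp, ha, hb]

end IsLocal

theorem IsLocalWithin.comp {T T' : ℕ → ℕ} {K : ℕ} (ha : IsLocalWithin T' a)
    (hK : ∀ (I : Instance S k) x, I.net.Within K x.1 (f I x).1)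
    (hf : IsLocalWithin T fun I x => I.tag (f I x)) :
    IsLocalWithin (fun n => max (T n) (T' n + K)) fun I x => a I (f I x) := by
  intro I J x y hsize hidx hview
  obtain ⟨u, -, hu⟩ := Instance.exists_within_of_view_eq (t := T' I.size)
    (Instance.view_eq_of_le (le_max_right _ _) hview) (hK I x)
  have htag := hf I J x y hsize hidx (Instance.view_eq_of_le (le_max_left _ _) hview)
  obtain rfl : u = (f J y).1 := J.isIdentifiers.1
    ((Instance.ident_eq_of_view_eq hu).symm.trans (Prod.ext_iff.1 htag).1)
  exact ha I J _ _ hsize (Prod.ext_iff.1 htag).2 hu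

theorem IsLocal.comp (ha : IsLocal g a) (hg : ∀ n, 1 ≤ g n) (hf : IsLocalMap g f) :
    IsLocal g fun I x => a I (f I x) := by
  obtain ⟨⟨K, hK⟩, C, hC⟩ := hf
  obtain ⟨D, hD⟩ := ha
  refine ⟨C + D + K, (hD.comp hK hC).mono fun n => ?_⟩
  have hKn := Nat.mul_le_mul_left K (hg n)
  simp only [add_mul]
  omega

theorem IsLocal.ball (ha : IsLocal g a) (C : ℕ) :
    IsLocal g fun I x => a I '' {y | I.net.Within (C * g I.size) x.1 y.1} := by
  obtain ⟨D, hD⟩ := ha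
  have subset : ∀ (I J : Instance S k) (x : I.Slot) (y : J.Slot), I.size = J.size →
      I.view (D * g I.size + C * g I.size) x.1 = J.view (D * g I.size + C * g I.size) y.1 →
      a I '' {x' | I.net.Within (C * g I.size) x.1 x'.1} ⊆
        a J '' {y' | J.net.Within (C * g J.size) y.1 y'.1} := by
    rintro I J x y hsize hview - ⟨⟨u, j⟩, hu, rfl⟩
    obtain ⟨u', hu', heq⟩ := Instance.exists_within_of_view_eq hview hu
    exact ⟨(u', j), hsize ▸ hu', (hD I J (u, j) (u', j) hsize rfl heq).symm⟩
  refine ⟨D + C, fun I J x y hsize _ hview => ?_⟩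
  simp only [add_mul] at hview
  exact (subset I J x y hsize hview).antisymm (subset J I y x hsize.symm (hsize ▸ hview.symm))

theorem IsLocal.iterate {c : ℕ → ∀ I : Instance S k, I.Slot → α} (hf : IsLocalMap g f)
    (hzero : IsLocal g (c 0))
    (hsucc : ∀ (s : ℕ) (I J : Instance S k) (x : I.Slot) (y : J.Slot), c s I x = c s J y →
      c s I (f I x) = c s J (f J y) → c (s + 1) I x = c (s + 1) J y)
    {σ : ℕ → ℕ} {C : ℕ} (hσ : ∀ n, σ n ≤ C * g n) : IsLocal g fun I => c (σ I.size) I := by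
  obtain ⟨⟨K, hK⟩, C₁, hC₁⟩ := hf
  obtain ⟨C₂, hC₂⟩ := hzero
  have rounds : ∀ s, IsLocalWithin (fun n => (C₁ + C₂) * g n + s * K) (c s) := by
    intro s
    induction s with
    | zero => exact hC₂.mono fun n => by rw [add_mul]; omega
    | succ s ih =>
      intro I J x y hsize hidx hview
      refine hsucc s I J x y
        (ih I J x y hsize hidx (Instance.view_eq_of_le ?_ hview))
        (ih.comp hK hC₁ I J x y hsize hidx (Instance.view_eq_of_le ?_ hview))
      · dsimp only; gcongr; omega
      · simp only [add_mul]; apply max_le <;> omega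
  refine ⟨C₁ + C₂ + C * K, fun I J x y hsize hidx hview => ?_⟩
  change c (σ I.size) I x = c (σ J.size) J y
  rw [← hsize]
  refine rounds _ I J x y hsize hidx (Instance.view_eq_of_le ?_ hview)
  calc (C₁ + C₂) * g I.size + σ I.size * K ≤ (C₁ + C₂) * g I.size + C * g I.size * K := by
        gcongr; exact hσ _
    _ = (C₁ + C₂ + C * K) * g I.size := by ring

namespace IsLocalMap

protected theorem id : IsLocalMap g fun (I : Instance S k) (x : I.Slot) => x :=
  ⟨⟨0, fun _ _ => rfl⟩, IsLocal.tag⟩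

theorem comp (hf' : IsLocalMap g f') (hg : ∀ n, 1 ≤ g n) (hf : IsLocalMap g f) :
    IsLocalMap g fun I x => f' I (f I x) := by
  refine ⟨?_, hf'.tag.comp hg hf⟩
  obtain ⟨K, hK⟩ := hf.exists_within
  obtain ⟨K', hK'⟩ := hf'.exists_within
  exact ⟨K + K', fun I x => (hK I x).trans (hK' I _)⟩

theorem ite {dec : ∀ I x, Decidable (p I x)} (hp : IsLocal g p) (hf : IsLocalMap g f)
    (hf' : IsLocalMap g f') : IsLocalMap g fun I x => if p I x then f I x else f' I x := by
  constructor
  · obtain ⟨K, hK⟩ := hf.exists_within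
    obtain ⟨K', hK'⟩ := hf'.exists_within
    refine ⟨max K K', fun I x => ?_⟩
    split_ifs
    · exact (hK I x).mono (le_max_left _ _)
    · exact (hK' I x).mono (le_max_right _ _)
  · simpa only [apply_ite] using hp.ite (dec := dec) hf.tag hf'.tag

theorem select {κ : Type*} [Finite κ] {e : ∀ I : Instance S k, I.Slot → κ} (he : IsLocal g e)
    {f : κ → ∀ I : Instance S k, I.Slot → I.Slot} (hf : ∀ i, IsLocalMap g (f i)) :
    IsLocalMap g fun I x => f (e I x) I x := by
  refine ⟨?_, he.map₂ (fun i t => t i) (IsLocal.pi fun i => (hf i).tag)⟩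
  choose K hK using fun i => (hf i).exists_within
  obtain ⟨D, hD⟩ := (Set.finite_range K).bddAbove
  exact ⟨D, fun I x => (hK _ I x).mono (hD ⟨_, rfl⟩)⟩

theorem eq (hf : IsLocalMap g f) (hf' : IsLocalMap g f') : IsLocal g fun I x => f I x = f' I x :=
  hf.tag.of_determines₂ hf'.tag fun I J x y h h' => by
    rw [← I.tag_injective.eq_iff, ← J.tag_injective.eq_iff, h, h']

theorem mapIndex {F : ∀ I : Instance S k, I.Slot → ℕ} (hF : IsLocal g F) :
    IsLocalMap g fun (I : Instance S k) (x : I.Slot) => (x.1, F I x) :=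
  ⟨⟨0, fun _ _ => rfl⟩, IsLocal.tag.map₂ (fun t i => (t.1, i)) hF⟩

theorem neighbor (hg : ∀ n, 1 ≤ g n) :
    IsLocalMap g fun (I : Instance S k) (x : I.Slot) => I.net.neighbor x.1 x.2 := by
  refine ⟨⟨1, fun I x => .step x.2 x.1⟩, 1, fun I J x y _ hidx hview => ?_⟩
  have hview' : I.view (0 + 1) x.1 = J.view (0 + 1) y.1 :=
    Instance.view_eq_of_le (by simpa using hg I.size) hview
  obtain ⟨hnode, hport⟩ := Instance.neighbor_eq_of_view_eq hview' x.2
  dsimp only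
  rw [← hidx]
  exact Prod.ext (Instance.ident_eq_of_view_eq hnode) hport

end IsLocalMap

/-- The algorithm in which all nodes send their whole views and the output is computed from the
final views by `out`. -/
def gather (out : View S → ℕ → Bool) : Algorithm S Bool where
  State := View S
  Msg := ℕ × View S
  init := View.leaf
  send := fun _ st i => (i, st)
  update := fun d st m => View.node st (fun i => if h : i < d then (m ⟨i, h⟩).1 else 0)
    (fun i => if h : i < d then (m ⟨i, h⟩).2 else st)
  output := fun _ st i => out st i

theorem stateAfter_gather (out : View S → ℕ → Bool) (I : Instance S k) (t : ℕ) :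
    (gather out).stateAfter I.net I.ident I.random t = I.view t := by
  induction t with
  | zero => rfl
  | succ t ih =>
    funext v
    simp only [Algorithm.stateAfter, Algorithm.round, ih, Instance.view]
    simp only [gather]
    congr 1 <;>
    · funext i
      by_cases h : i < I.net.deg v <;> simp [h, Network.neighbor]

theorem IsLocal.exists_algorithm {a : ∀ I : Instance S k, I.Slot → Bool} (ha : IsLocal g a) :
    ∃ (A : Algorithm S Bool) (C : ℕ), ∀ I : Instance S k,
      A.run I.net I.ident I.random (C * g I.size) = fun p => a I (p.1, p.2) := by
  classical
  obtain ⟨C, hC⟩ := ha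
  -- A node can use any instance in which some node has its view.
  refine ⟨gather fun st i =>
    if h : ∃ (J : Instance S k) (w : J.Node), J.view (C * g J.size) w = st then
      a h.choose (h.choose_spec.choose, i) else false, C, fun I => funext fun p => ?_⟩
  have hex : ∃ (J : Instance S k) (w : J.Node),
      J.view (C * g J.size) w = I.view (C * g I.size) p.1 := ⟨I, p.1, rfl⟩
  have hview := hex.choose_spec.choose_spec
  have hsize := Instance.size_eq_of_view_eq hview
  simp only [Algorithm.run, stateAfter_gather]
  refine (dif_pos hex).trans (hC _ _ _ _ hsize rfl (hview.trans ?_))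
  rw [hsize]

end Locality

section LocalRuling

/-- Initial colours. They are distinct for slots of numbers `0` and `1`, the only ones between which
moves will be made. -/
def idColor {V : Type} (ident : V → ℕ) (x : V × ℕ) : ℕ := 2 * ident x.1 + x.2 % 2

/-- All moves are made between slots of numbers `0` and `1`. -/
def MovesIndexLtTwo {V ι : Type} (st : ι → V × ℕ → V × ℕ) : Prop :=
  ∀ i x, st i x ≠ x → x.2 < 2 ∧ (st i x).2 < 2

section
variable {V ι : Type} [Fintype V] {k : ℕ} {ident : V → ℕ} {st : ι → V × ℕ → V × ℕ}

theorem idColor_lt (h : IsIdentifiers k ident) (x : V × ℕ) :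
    idColor ident x < 2 * Fintype.card V ^ k := by
  have := h.2 x.1
  rw [idColor]
  omega

theorem idColor_ne (h : IsIdentifiers k ident) {x y : V × ℕ} (hx : x.2 < 2) (hy : y.2 < 2)
    (hxy : x ≠ y) : idColor ident x ≠ idColor ident y := by
  intro heq
  simp only [idColor] at heq
  exact hxy (Prod.ext (h.1 (by omega)) (by omega))

omit [Fintype V] in
theorem MovesIndexLtTwo.index_lt_of_stepReach (hst : MovesIndexLtTwo st) {n : ℕ} {x y : V × ℕ}
    (h : StepReach st n x y) (hxy : y ≠ x) : x.2 < 2 ∧ y.2 < 2 := by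
  induction n generalizing x with
  | zero => exact absurd h hxy
  | succ n ih =>
    rcases h with h | ⟨i, h⟩
    · exact ih h hxy
    by_cases hstay : st i x = x
    · exact ih (hstay ▸ h) hxy
    have hmove := hst i x hstay
    by_cases hy : y = st i x
    · exact hy ▸ hmove
    · exact ⟨hmove.1, (ih h hy).2⟩

theorem exists_isRuling_idColor [Finite ι] {γ : ℕ} (h : IsIdentifiers k ident)
    (hγ : Nat.log 2 (Fintype.card V) + 1 ≤ 2 ^ γ) (hst : MovesIndexLtTwo st) (r : ℕ) (x : V × ℕ) :
    ∃ m, IsRuling st r (idColor ident) (γ + k + 5) m ∧ StepReach st (r * numColors ι r) x m := by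
  refine exists_isRuling (fun κ => coleVishkin_lt_64 hγ (idColor_lt h)) (fun κ x hx => ?_) x
  obtain ⟨hlt, hlt'⟩ := hst.index_lt_of_stepReach (stepReach_route r κ x) hx
  exact idColor_ne h hlt hlt' hx.symm

end

section
variable {S : ℕ → Type} {k : ℕ} {ι : Type} {g : ℕ → ℕ}
  {st : ∀ I : Instance S k, ι → I.Slot → I.Slot}

theorem IsLocalMap.route (hg : ∀ n, 1 ≤ g n) (hst : ∀ i, IsLocalMap g fun I => st I i) :
    ∀ (r : ℕ) (κ : Fin r → Option ι), IsLocalMap g fun I => route (st I) r κ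
  | 0, _ => .id
  | r + 1, κ => by
    have hmove : ∀ o, IsLocalMap g fun I => moveOrStay (st I) o := by
      rintro (_ | i)
      · exact .id
      · exact hst i
    exact (IsLocalMap.route hg hst r (Fin.tail κ)).comp hg (hmove (κ 0))

theorem IsLocal.isRuling [Finite ι] (hg : ∀ n, 1 ≤ g n) (hst : ∀ i, IsLocalMap g fun I => st I i)
    (r : ℕ) : IsLocal g fun I => IsRuling (st I) r (idColor I.ident) (g I.size + k + 5) := by
  have hcolor : ∀ κ, IsLocal g fun I =>
      coleVishkin (LocalModel.route (st I) r κ) (idColor I.ident) (g I.size + k + 5) := by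
    intro κ
    refine IsLocal.iterate (σ := fun n => g n + k + 5) (C := k + 6)
      (c := fun s I => coleVishkin (LocalModel.route (st I) r κ) (idColor I.ident) s)
      (.route hg hst r κ) (IsLocal.tag.map fun p => 2 * p.1 + p.2 % 2) ?_ fun n => ?_
    · intro s I J x y hx hfx
      simp only [coleVishkin, coleVishkinStep, hx, hfx]
    · nlinarith [hg n]
  have hroute : IsLocal g fun I => routeColor (st I) r (idColor I.ident) (g I.size + k + 5) :=
    (IsLocal.pi hcolor).of_determines fun I J x y h => by
      simp only [routeColor, congrFun h]
  refine .forall_finite fun κ => ?_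
  have hκ := IsLocalMap.route hg hst r κ
  exact (hκ.eq .id).not.imp (hroute.map₂ (· < ·) (hroute.comp hg hκ))

end
end LocalRuling

section ReachFinset
variable {O ι : Type*} [Fintype ι] {st : ι → O → O} {n : ℕ} {x y : O}

open Classical in
/-- The vertices that can be reached from `x` by at most `n` moves. -/
noncomputable def reachFinset (st : ι → O → O) (n : ℕ) (x : O) : Finset O :=
  Finset.univ.image fun κ => route st n κ x

theorem mem_reachFinset (h : StepReach st n x y) : y ∈ reachFinset st n x := by
  classical
  obtain ⟨κ, rfl⟩ := h.exists_route
  exact Finset.mem_image_of_mem _ (Finset.mem_univ κ)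

theorem card_reachFinset_le : (reachFinset st n x).card ≤ (Fintype.card ι + 1) ^ n := by
  classical
  exact Finset.card_image_le.trans_eq (by simp)

end ReachFinset

/-! ### Graphs of half-edges -/

/-- A graph given by its half-edges; nodes are also elements of `O`, so that there is only one kind
of object. Some half-edges are loose ends; an attached half-edge `h` belongs to the node `node h`.
The other half of its edge is `opp h`, and the half-edges of a node `w` are the `half i w`. -/
structure HalfEdgeGraph (O : Type*) where
  opp : O → O
  Attached : O → Prop
  node : O → O
  IsNode : O → Prop
  half : Fin 3 → O → O

/-- Every node has exactly three half-edges. -/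
structure HalfEdgeGraph.Cubic {O : Type*} (G : HalfEdgeGraph O) : Prop where
  opp_opp : ∀ h, G.opp (G.opp h) = h
  opp_ne : ∀ h, G.opp h ≠ h
  half_injective : ∀ w, G.IsNode w → Function.Injective fun i => G.half i w
  attached_half : ∀ w i, G.IsNode w → G.Attached (G.half i w)
  node_half : ∀ w i, G.IsNode w → G.node (G.half i w) = w
  isNode_node : ∀ h, G.Attached h → G.IsNode (G.node h)
  exists_half_eq : ∀ h, G.Attached h → ∃ i, G.half i (G.node h) = h

namespace HalfEdgeGraph
variable {O : Type*}

/-- `h` is the half at `u` of an edge that joins `u` and `w` and is not special. -/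
structure IsHalfEdge (G : HalfEdgeGraph O) (sp : O → Prop) (u w h : O) : Prop where
  attached : G.Attached h
  node_eq : G.node h = u
  not_special : ¬ sp h
  attached_opp : G.Attached (G.opp h)
  node_opp : G.node (G.opp h) = w

/-- A half-edge of `u` that can be directed outwards without regard to other nodes: it leads to a
loose end, or it is special and already directed outwards. -/
structure IsTerminal (G : HalfEdgeGraph O) (sp out : O → Prop) (u h : O) : Prop where
  attached : G.Attached h
  node_eq : G.node h = u
  special_or_loose : sp h ∧ out h ∨ ¬ sp h ∧ ¬ G.Attached (G.opp h)

/-- `o` chooses an outgoing half-edge for each node of `T`, respecting the directions `out` of the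
special edges, such that no edge is chosen from both ends and no edge leaves `T`. -/
def Closed (G : HalfEdgeGraph O) (sp out : O → Prop) (T : Set O) (o : O → O) : Prop :=
  ∀ u ∈ T, G.IsTerminal sp out u (o u) ∨
    ∃ w ∈ T, G.IsHalfEdge sp u w (o u) ∧ o w ≠ G.opp (o u)

/-- The ball around `c` after removal of the special edges. -/
def ball (G : HalfEdgeGraph O) (sp : O → Prop) (c : O) : ℕ → Set O
  | 0 => {c}
  | i + 1 => {w | w ∈ G.ball sp c i ∨ ∃ u ∈ G.ball sp c i, ∃ h, G.IsHalfEdge sp u w h}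

/-- The distance from `c` after removal of the special edges. -/
noncomputable def level (G : HalfEdgeGraph O) (sp : O → Prop) (c w : O) : ℕ :=
  sInf {i | w ∈ G.ball sp c i}

/-- `p` chooses, at each node of the ball other than `c`, a half-edge that leads one level closer to
`c`. These edges form a breadth-first search tree. -/
def IsParentMap (G : HalfEdgeGraph O) (sp : O → Prop) (c : O) (R : ℕ) (p : O → O) : Prop :=
  ∀ w ∈ G.ball sp c R, w ≠ c →
    ∃ u ∈ G.ball sp c R, G.IsHalfEdge sp w u (p w) ∧ G.level sp c u + 1 = G.level sp c w

/-- `h` belongs to an edge of the tree given by `p`. -/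
def IsTreeHalf (G : HalfEdgeGraph O) (sp : O → Prop) (c : O) (R : ℕ) (p : O → O) (h : O) : Prop :=
  ∃ a ∈ G.ball sp c R, a ≠ c ∧ (h = p a ∨ h = G.opp (p a))

/-- The ball admits no closed choice of outgoing half-edges. -/
def Blocked (G : HalfEdgeGraph O) (sp out : O → Prop) (c : O) (R : ℕ) : Prop :=
  ∀ o, ¬ G.Closed sp out (G.ball sp c R) o

/-- The node `w` has a special half-edge. -/
def HasSpecial (G : HalfEdgeGraph O) (sp : O → Prop) (w : O) : Prop :=
  ∃ h, G.Attached h ∧ G.node h = w ∧ sp h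

open Classical in
/-- The move from a node along its `i`-th half-edge. -/
noncomputable def step (G : HalfEdgeGraph O) (i : Fin 3) (w : O) : O :=
  if G.IsNode w ∧ G.Attached (G.opp (G.half i w)) then G.node (G.opp (G.half i w)) else w

variable {G : HalfEdgeGraph O} {sp out : O → Prop} {c : O} {R : ℕ}

theorem step_symm (hG : G.Cubic) : StepSymm G.step := by
  intro i w hmove
  obtain ⟨hw, hatt⟩ : G.IsNode w ∧ G.Attached (G.opp (G.half i w)) :=
    of_not_not fun h => hmove (if_neg h)
  obtain ⟨j, hj⟩ := hG.exists_half_eq _ hatt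
  refine ⟨j, ?_⟩
  rw [show G.step i w = _ from if_pos ⟨hw, hatt⟩, step, hj, hG.opp_opp,
    if_pos ⟨hG.isNode_node _ hatt, hG.attached_half _ _ hw⟩, hG.node_half _ _ hw]

theorem IsHalfEdge.step_eq {w t : O} {i : Fin 3} (hw : G.IsNode w)
    (h : G.IsHalfEdge sp w t (G.half i w)) : G.step i w = t := by
  rw [step, if_pos ⟨hw, h.attached_opp⟩, h.node_opp]

section Ball

theorem ball_mono {i j : ℕ} (h : i ≤ j) : G.ball sp c i ⊆ G.ball sp c j := by
  induction j, h using Nat.le_induction with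
  | base => exact subset_rfl
  | succ j _ ih => exact fun w hw => Or.inl (ih hw)

theorem center_mem_ball : c ∈ G.ball sp c R := ball_mono R.zero_le rfl

theorem isNode_of_mem_ball (hG : G.Cubic) (hc : G.IsNode c) {w : O} (h : w ∈ G.ball sp c R) :
    G.IsNode w := by
  induction R generalizing w with
  | zero => exact Eq.symm h ▸ hc
  | succ i ih =>
    rcases h with h | ⟨u, -, e, he⟩
    · exact ih h
    · exact he.node_opp ▸ hG.isNode_node _ he.attached_opp

theorem mem_ball_level {w : O} (h : w ∈ G.ball sp c R) : w ∈ G.ball sp c (G.level sp c w) :=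
  Nat.sInf_mem (s := {i | w ∈ G.ball sp c i}) ⟨R, h⟩

theorem level_le {w : O} (h : w ∈ G.ball sp c R) : G.level sp c w ≤ R := Nat.sInf_le h

theorem level_center : G.level sp c c = 0 := Nat.le_zero.1 (level_le (R := 0) rfl)

theorem eq_center_of_level_eq_zero {w : O} (h : w ∈ G.ball sp c R) (h0 : G.level sp c w = 0) :
    w = c := by
  have hmem := mem_ball_level h
  rwa [h0] at hmem

theorem IsHalfEdge.mem_ball_succ {u w h : O} (he : G.IsHalfEdge sp u w h)
    (hu : u ∈ G.ball sp c R) : w ∈ G.ball sp c (R + 1) := Or.inr ⟨u, hu, h, he⟩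

theorem IsHalfEdge.mem_ball_of_level_lt {u w h : O} (he : G.IsHalfEdge sp u w h)
    (hu : u ∈ G.ball sp c R) (hlt : G.level sp c u < R) : w ∈ G.ball sp c R :=
  ball_mono hlt (he.mem_ball_succ (mem_ball_level hu))

theorem exists_hasSpecial_or_mem_ball (hG : G.Cubic) {i D : ℕ} {w m : O}
    (hw : w ∈ G.ball sp c i) (hreach : StepReach G.step D w m) (hR : i + D ≤ R) :
    (∃ u ∈ G.ball sp c R, G.HasSpecial sp u ∧ StepReach G.step D w u) ∨
      m ∈ G.ball sp c (i + D) := by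
  induction D generalizing i w with
  | zero => exact Or.inr (Eq.symm hreach ▸ hw)
  | succ D ih =>
    have stay (h : StepReach G.step D w m) :
        (∃ u ∈ G.ball sp c R, G.HasSpecial sp u ∧ StepReach G.step (D + 1) w u) ∨
          m ∈ G.ball sp c (i + (D + 1)) :=
      (ih hw h (by omega)).imp (fun ⟨u, hu, hspu, hwu⟩ => ⟨u, hu, hspu, Or.inl hwu⟩)
        fun hm => ball_mono (by omega) hm
    rcases hreach with hreach | ⟨j, hreach⟩
    · exact stay hreach
    by_cases hstay : G.step j w = w
    · exact stay (hstay ▸ hreach)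
    obtain ⟨hnode, hatt⟩ : G.IsNode w ∧ G.Attached (G.opp (G.half j w)) :=
      of_not_not fun h => hstay (if_neg h)
    by_cases hsp : sp (G.half j w)
    · exact Or.inl ⟨w, ball_mono (by omega) hw,
        ⟨_, hG.attached_half _ _ hnode, hG.node_half _ _ hnode, hsp⟩, .refl _ _⟩
    · have he : G.IsHalfEdge sp w (G.node (G.opp (G.half j w))) (G.half j w) :=
        ⟨hG.attached_half _ _ hnode, hG.node_half _ _ hnode, hsp, hatt, rfl⟩
      have hmem := he.mem_ball_succ hw
      rw [← he.step_eq hnode] at hmem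
      rw [show i + (D + 1) = i + 1 + D by omega]
      exact (ih hmem hreach (by omega)).imp_left fun ⟨u, hu, hspu, hwu⟩ =>
        ⟨u, hu, hspu, Or.inr ⟨j, hwu⟩⟩

end Ball

section Tree
variable (hG : G.Cubic) (hsp : ∀ h, sp (G.opp h) ↔ sp h)
include hG hsp

theorem IsHalfEdge.symm {u w h : O} (he : G.IsHalfEdge sp u w h) :
    G.IsHalfEdge sp w u (G.opp h) where
  attached := he.attached_opp
  node_eq := he.node_opp
  not_special := by rw [hsp]; exact he.not_special
  attached_opp := by rw [hG.opp_opp]; exact he.attached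
  node_opp := by rw [hG.opp_opp, he.node_eq]

theorem exists_isParentMap : ∃ p, G.IsParentMap sp c R p := by
  have exists_parent : ∀ w, ∃ h, w ∈ G.ball sp c R → w ≠ c → ∃ u ∈ G.ball sp c R,
      G.IsHalfEdge sp w u h ∧ G.level sp c u + 1 = G.level sp c w := by
    intro w
    by_cases hw : w ∈ G.ball sp c R ∧ w ≠ c
    · obtain ⟨l, hl⟩ := Nat.exists_eq_succ_of_ne_zero
        fun h0 => hw.2 (eq_center_of_level_eq_zero hw.1 h0)
      have hmem := mem_ball_level hw.1
      rw [hl] at hmem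
      rcases hmem with hmem | ⟨u, hu, h, he⟩
      · have := level_le hmem
        omega
      · have hle := level_le hu
        have hle' := level_le (he.mem_ball_succ (mem_ball_level hu))
        have hR := level_le hw.1
        exact ⟨G.opp h, fun _ _ => ⟨u, ball_mono (by omega) hu, he.symm hG hsp, by omega⟩⟩
    · exact ⟨w, fun h h' => absurd ⟨h, h'⟩ hw⟩
  exact Classical.axiom_of_choice exists_parent

variable {p : O → O} (hp : G.IsParentMap sp c R p)
include hp

/-- The edges of the tree on the path from `v` to `c` are redirected towards `v`. -/
theorem exists_choice_towards {v : O} (hv : v ∈ G.ball sp c R) :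
    ∃ o : O → O, ∀ u ∈ G.ball sp c R, u ≠ v → G.IsTreeHalf sp c R p (o u) ∧
      ∃ w ∈ G.ball sp c R, G.IsHalfEdge sp u w (o u) ∧ (w ≠ v → o w ≠ G.opp (o u)) := by
  classical
  induction hl : G.level sp c v generalizing v with
  | zero =>
    obtain rfl := eq_center_of_level_eq_zero hv hl
    refine ⟨p, fun u hu huv => ?_⟩
    obtain ⟨w, hw, he, hlevel⟩ := hp u hu huv
    refine ⟨⟨u, hu, huv, Or.inl rfl⟩, w, hw, he, fun hwv heq => ?_⟩
    obtain ⟨x, -, he', hlevel'⟩ := hp w hw hwv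
    have hxu : x = u := by rw [← he'.node_opp, heq, hG.opp_opp, he.node_eq]
    rw [hxu] at hlevel'
    omega
  | succ l ih =>
    have hvc : v ≠ c := by
      rintro rfl
      rw [level_center] at hl
      omega
    obtain ⟨v', hv', hparent, hlevel⟩ := hp v hv hvc
    obtain ⟨o, ho⟩ := ih hv' (by omega)
    refine ⟨Function.update o v' (G.opp (p v)), fun u hu huv => ?_⟩
    by_cases huv' : u = v'
    · subst huv'
      rw [Function.update_self]
      exact ⟨⟨v, hv, hvc, Or.inr rfl⟩, v, hv, hparent.symm hG hsp, fun h => absurd rfl h⟩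
    · obtain ⟨htree, w, hw, he, hcollide⟩ := ho u hu huv'
      rw [Function.update_of_ne huv']
      refine ⟨htree, w, hw, he, fun _ => ?_⟩
      by_cases hwv' : w = v'
      · subst hwv'
        rw [Function.update_self]
        intro heq
        have hpv : p v = o u := by rw [← hG.opp_opp (p v), heq, hG.opp_opp]
        exact huv (by rw [← he.node_eq, ← hpv, hparent.node_eq])
      · rw [Function.update_of_ne hwv']
        exact hcollide hwv'

theorem exists_closed_of_not_isTreeHalf {v e : O} (hv : v ∈ G.ball sp c R)
    (hnot : ¬ G.IsTreeHalf sp c R p e)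
    (he : G.IsTerminal sp out v e ∨ ∃ w ∈ G.ball sp c R, G.IsHalfEdge sp v w e) :
    ∃ o, G.Closed sp out (G.ball sp c R) o := by
  classical
  have hnot_opp : ∀ h, G.IsTreeHalf sp c R p h → e ≠ G.opp h := by
    rintro _ ⟨a, ha, hac, rfl | rfl⟩ rfl
    · exact hnot ⟨a, ha, hac, Or.inr rfl⟩
    · exact hnot ⟨a, ha, hac, Or.inl (hG.opp_opp _)⟩
  obtain ⟨o, ho⟩ := exists_choice_towards hG hsp hp hv
  refine ⟨Function.update o v e, fun u hu => ?_⟩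
  by_cases huv : u = v
  · subst huv
    rw [Function.update_self]
    refine he.imp_right fun ⟨w, hw, he⟩ => ⟨w, hw, he, ?_⟩
    by_cases hwu : w = u
    · rw [hwu, Function.update_self]
      exact (hG.opp_ne e).symm
    · rw [Function.update_of_ne hwu]
      exact fun heq => hnot_opp _ (ho w hw hwu).1 (by rw [heq, hG.opp_opp])
  · obtain ⟨htree, w, hw, he, hcollide⟩ := ho u hu huv
    rw [Function.update_of_ne huv]
    refine Or.inr ⟨w, hw, he, ?_⟩
    by_cases hwv : w = v
    · rw [hwv, Function.update_self]
      exact hnot_opp _ htree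
    · rw [Function.update_of_ne hwv]
      exact hcollide hwv

variable (hblocked : G.Blocked sp out c R)
include hblocked

theorem Blocked.not_isTerminal {v e : O} (hv : v ∈ G.ball sp c R) :
    ¬ G.IsTerminal sp out v e := by
  intro hterminal
  have hnot : ¬ G.IsTreeHalf sp c R p e := by
    rintro ⟨a, ha, hac, htree⟩
    obtain ⟨u, -, hedge, -⟩ := hp a ha hac
    obtain ⟨x, y, he⟩ : ∃ x y, G.IsHalfEdge sp x y e := by
      rcases htree with rfl | rfl
      exacts [⟨_, _, hedge⟩, ⟨_, _, hedge.symm hG hsp⟩]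
    exact hterminal.special_or_loose.elim (fun h => he.not_special h.1)
      fun h => h.2 he.attached_opp
  obtain ⟨o, ho⟩ := exists_closed_of_not_isTreeHalf hG hsp hp hv hnot (Or.inl hterminal)
  exact hblocked o ho

theorem Blocked.exists_isHalfEdge {w e : O} (hw : w ∈ G.ball sp c R) (hl : G.level sp c w < R)
    (hatt : G.Attached e) (hnode : G.node e = w) (hnot : ¬ sp e) :
    ∃ t ∈ G.ball sp c R, G.IsHalfEdge sp w t e ∧
      (e = p w ∧ G.level sp c t + 1 = G.level sp c w ∨
        t ≠ c ∧ G.opp e = p t ∧ G.level sp c t = G.level sp c w + 1) := by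
  have hopp : G.Attached (G.opp e) := of_not_not fun h =>
    hblocked.not_isTerminal hG hsp hp hw ⟨hatt, hnode, Or.inr ⟨hnot, h⟩⟩
  have he : G.IsHalfEdge sp w (G.node (G.opp e)) e := ⟨hatt, hnode, hnot, hopp, rfl⟩
  have ht := he.mem_ball_of_level_lt hw hl
  refine ⟨_, ht, he, ?_⟩
  obtain ⟨a, ha, hac, rfl | rfl⟩ : G.IsTreeHalf sp c R p e := by
    by_contra hnot
    obtain ⟨o, ho⟩ := exists_closed_of_not_isTreeHalf (out := out) hG hsp hp hw hnot
      (Or.inr ⟨_, ht, he⟩)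
    exact hblocked o ho
  · obtain ⟨u, -, hedge, hlevel⟩ := hp a ha hac
    obtain rfl : a = w := hedge.node_eq.symm.trans hnode
    exact Or.inl ⟨rfl, by rwa [hedge.node_opp]⟩
  · obtain ⟨u, -, hedge, hlevel⟩ := hp a ha hac
    obtain rfl : u = w := hedge.node_opp.symm.trans hnode
    rw [hG.opp_opp, hedge.node_eq]
    exact Or.inr ⟨hac, rfl, hlevel.symm⟩

theorem Blocked.step_injective (hc : G.IsNode c) {w : O} (hw : w ∈ G.ball sp c R)
    (hl : G.level sp c w < R) (hnot : ¬ G.HasSpecial sp w) :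
    (∀ i, G.step i w ≠ w) ∧ Function.Injective fun i => G.step i w := by
  have hnode := isNode_of_mem_ball hG hc hw
  have edge (i) := hblocked.exists_isHalfEdge hG hsp hp hw hl (hG.attached_half w i hnode)
    (hG.node_half w i hnode)
    fun h => hnot ⟨_, hG.attached_half w i hnode, hG.node_half w i hnode, h⟩
  refine ⟨fun i heq => ?_, fun i j hij => hG.half_injective w hnode ?_⟩
  · obtain ⟨t, -, he, hdir⟩ := edge i
    obtain rfl : t = w := (he.step_eq hnode).symm.trans heq
    rcases hdir with ⟨-, hlevel⟩ | ⟨-, -, hlevel⟩ <;> omega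
  · obtain ⟨t, -, he, hdir⟩ := edge i
    obtain ⟨t', -, he', hdir'⟩ := edge j
    obtain rfl : t = t' := (he.step_eq hnode).symm.trans (hij.trans (he'.step_eq hnode))
    rcases hdir with ⟨hi, hlevel⟩ | ⟨-, hi, hlevel⟩ <;>
      rcases hdir' with ⟨hj, hlevel'⟩ | ⟨-, hj, hlevel'⟩
    · exact hi.trans hj.symm
    · omega
    · omega
    · change G.half i w = G.half j w
      rw [← hG.opp_opp (G.half i w), hi, ← hj, hG.opp_opp]

end Tree

section Growth

/-- Each node has at most one special half-edge. -/
def SpecialUnique (G : HalfEdgeGraph O) (sp : O → Prop) : Prop :=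
  ∀ h h', G.Attached h → G.Attached h' → G.node h = G.node h' → sp h → sp h' → h = h'

/-- Two nodes that have special half-edges are not joined by an edge that is not special. -/
def SpecialSparse (G : HalfEdgeGraph O) (sp : O → Prop) : Prop :=
  ∀ u w h, G.IsHalfEdge sp u w h → u ≠ w → G.HasSpecial sp u → ¬ G.HasSpecial sp w

/-- The other end of the edge chosen at `w` by the parent map `p`. -/
def parent (G : HalfEdgeGraph O) (p : O → O) (w : O) : O := G.node (G.opp (p w))

open Classical in
/-- The nodes at distance `i` from `c`; all nodes are assumed to be in `N`. -/
noncomputable def levelSet (G : HalfEdgeGraph O) (sp : O → Prop) (c : O) (R : ℕ) (N : Finset O)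
    (i : ℕ) : Finset O :=
  N.filter fun w => w ∈ G.ball sp c R ∧ G.level sp c w = i

open Classical in
/-- The children of `w` in the tree given by `p`. -/
noncomputable def children (G : HalfEdgeGraph O) (sp : O → Prop) (c : O) (R : ℕ) (p : O → O)
    (N : Finset O) (w : O) : Finset O :=
  N.filter fun t => t ∈ G.ball sp c R ∧ t ≠ c ∧ G.parent p t = w

variable {p : O → O} {N : Finset O}

theorem IsParentMap.exists_of_mem_children (hp : G.IsParentMap sp c R p) {w t : O}
    (ht : t ∈ G.children sp c R p N w) :
    t ∈ G.ball sp c R ∧ G.IsHalfEdge sp t w (p t) ∧ G.level sp c t = G.level sp c w + 1 := by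
  simp only [children, Finset.mem_filter] at ht
  obtain ⟨-, hmem, htc, rfl⟩ := ht
  obtain ⟨u, -, he, hlevel⟩ := hp t hmem htc
  obtain rfl : G.parent p t = u := he.node_opp
  exact ⟨hmem, he, hlevel.symm⟩

theorem IsParentMap.parent_mem_levelSet (hG : G.Cubic) (hc : G.IsNode c)
    (hp : G.IsParentMap sp c R p) (hN : ∀ w, G.IsNode w → w ∈ N) {i : ℕ} {t : O}
    (ht : t ∈ G.levelSet sp c R N (i + 1)) :
    G.parent p t ∈ G.levelSet sp c R N i := by
  classical
  obtain ⟨-, hmem, hlevel⟩ := Finset.mem_filter.1 ht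
  have htc : t ≠ c := by
    rintro rfl
    rw [level_center] at hlevel
    omega
  obtain ⟨u, hu, he, hlevel'⟩ := hp t hmem htc
  rw [parent, he.node_opp]
  exact Finset.mem_filter.2 ⟨hN u (isNode_of_mem_ball hG hc hu), hu, by omega⟩

theorem IsParentMap.mem_children_iff (hG : G.Cubic) (hc : G.IsNode c)
    (hp : G.IsParentMap sp c R p) (hN : ∀ w, G.IsNode w → w ∈ N) {i : ℕ} {w t : O}
    (hw : w ∈ G.levelSet sp c R N i) :
    t ∈ G.children sp c R p N w ↔ t ∈ G.levelSet sp c R N (i + 1) ∧ G.parent p t = w := by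
  classical
  obtain ⟨-, -, hlevel⟩ := Finset.mem_filter.1 hw
  constructor
  · intro ht
    obtain ⟨hmem, he, hlevel'⟩ := hp.exists_of_mem_children ht
    exact ⟨Finset.mem_filter.2 ⟨hN t (isNode_of_mem_ball hG hc hmem), hmem, by omega⟩, he.node_opp⟩
  · rintro ⟨ht, rfl⟩
    obtain ⟨hN', hmem, hlevel'⟩ := Finset.mem_filter.1 ht
    refine Finset.mem_filter.2 ⟨hN', hmem, ?_, rfl⟩
    rintro rfl
    rw [level_center] at hlevel'
    omega

open Classical in
theorem card_special_half_le (hG : G.Cubic) (hunique : G.SpecialUnique sp) {w : O}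
    (hw : G.IsNode w) : (Finset.univ.filter fun i => sp (G.half i w)).card ≤
      if G.HasSpecial sp w then 1 else 0 := by
  split_ifs with hspecial
  · refine Finset.card_le_one.2 fun i hi j hj => hG.half_injective w hw ?_
    simp only [Finset.mem_filter_univ] at hi hj
    exact hunique _ _ (hG.attached_half w i hw) (hG.attached_half w j hw)
      ((hG.node_half w i hw).trans (hG.node_half w j hw).symm) hi hj
  · refine (Finset.card_eq_zero.2 (Finset.filter_eq_empty_iff.2 fun i _ hi => hspecial ?_)).le
    exact ⟨_, hG.attached_half w i hw, hG.node_half w i hw, hi⟩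

variable (hG : G.Cubic) (hsp : ∀ h, sp (G.opp h) ↔ sp h) (hc : G.IsNode c)
  (hblocked : G.Blocked sp out c R) (hN : ∀ w, G.IsNode w → w ∈ N)
include hG hsp hc hblocked

theorem Blocked.exists_hasSpecial {M : O → Prop}
    (hM : ∀ m, G.IsNode m → M m →
      G.HasSpecial sp m ∨ G.step 0 m = m ∨ ∃ i, i ≠ 0 ∧ G.step i m = G.step 0 m)
    {D i : ℕ} {w m : O} (hw : w ∈ G.ball sp c i) (hm : M m) (hreach : StepReach G.step D w m)
    (hR : i + D < R) : ∃ u ∈ G.ball sp c R, G.HasSpecial sp u ∧ StepReach G.step D w u := by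
  refine (exists_hasSpecial_or_mem_ball hG hw hreach hR.le).elim id fun hmem => ?_
  have hmR := ball_mono hR.le hmem
  refine ⟨m, hmR, of_not_not fun hnot => ?_, hreach⟩
  obtain ⟨p, hp⟩ := exists_isParentMap (c := c) (R := R) hG hsp
  obtain ⟨hne, hinj⟩ :=
    hblocked.step_injective hG hsp hp hc hmR ((level_le hmem).trans_lt hR) hnot
  rcases (hM m (isNode_of_mem_ball hG hc hmem) hm).resolve_left hnot with hstay | ⟨i, hi, heq⟩
  · exact hne 0 hstay
  · exact hi (hinj heq)

section Children
variable (hp : G.IsParentMap sp c R p)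
include hp hN

open Classical in
theorem Blocked.two_le_card_children (hunique : G.SpecialUnique sp) {w : O}
    (hw : w ∈ G.ball sp c R) (hl : G.level sp c w < R) :
    2 ≤ (G.children sp c R p N w).card + if G.HasSpecial sp w then 1 else 0 := by
  have hnode := isNode_of_mem_ball hG hc hw
  set away : Finset (Fin 3) :=
    Finset.univ.filter fun i => ¬ sp (G.half i w) ∧ G.half i w ≠ p w with haway
  have edge : ∀ i ∈ away, G.node (G.opp (G.half i w)) ∈ G.children sp c R p N w ∧
      G.opp (G.half i w) = p (G.node (G.opp (G.half i w))) := by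
    intro i hi
    simp only [haway, Finset.mem_filter_univ] at hi
    obtain ⟨t, ht, he, hdir⟩ := hblocked.exists_isHalfEdge hG hsp hp hw hl
      (hG.attached_half w i hnode) (hG.node_half w i hnode) hi.1
    obtain ⟨htc, hpt, -⟩ := hdir.resolve_left fun h => hi.2 h.1
    rw [he.node_opp]
    refine ⟨Finset.mem_filter.2 ⟨hN t (isNode_of_mem_ball hG hc ht), ht, htc, ?_⟩, hpt⟩
    rw [parent, ← hpt, hG.opp_opp, he.node_eq]
  have haway_le : away.card ≤ (G.children sp c R p N w).card := by
    refine Finset.card_le_card_of_injOn _ (fun i hi => (edge i hi).1) fun i hi j hj hij => ?_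
    apply hG.half_injective w hnode
    change G.half i w = G.half j w
    rw [← hG.opp_opp (G.half i w), (edge i hi).2, hij, ← (edge j hj).2, hG.opp_opp]
  have hparent_le : (Finset.univ.filter fun i => G.half i w = p w).card ≤ 1 :=
    Finset.card_le_one.2 fun i hi j hj => hG.half_injective w hnode <| by
      simp only [Finset.mem_filter_univ] at hi hj
      exact hi.trans hj.symm
  have hcover : (Finset.univ : Finset (Fin 3)) ⊆
      away ∪ (Finset.univ.filter fun i => sp (G.half i w)) ∪
        Finset.univ.filter fun i => G.half i w = p w := by
    intro i _
    simp only [haway, Finset.mem_union, Finset.mem_filter_univ]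
    tauto
  have hthree := (Finset.card_le_card hcover).trans
    ((Finset.card_union_le _ _).trans (Nat.add_le_add_right (Finset.card_union_le _ _) _))
  rw [Finset.card_univ, Fintype.card_fin] at hthree
  have hspecial_le := card_special_half_le hG hunique hnode
  omega

open Classical in
/-- By sparsity, a node and its children are not all special. -/
theorem Blocked.two_le_card_grandchildren (hunique : G.SpecialUnique sp)
    (hsparse : G.SpecialSparse sp) {i : ℕ} (hi : i + 2 ≤ R) {w : O}
    (hw : w ∈ G.levelSet sp c R N i) :
    2 ≤ ((G.levelSet sp c R N (i + 2)).filter fun x => G.parent p (G.parent p x) = w).card := by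
  obtain ⟨-, hmem, hlevel⟩ := Finset.mem_filter.1 hw
  have hkids := hblocked.two_le_card_children hG hsp hc hN hp hunique hmem (by omega)
  have hcount : ∀ b, (∀ t ∈ G.children sp c R p N w, b ≤ (G.children sp c R p N t).card) →
      b * (G.children sp c R p N w).card ≤
        ((G.levelSet sp c R N (i + 2)).filter fun x => G.parent p (G.parent p x) = w).card := by
    intro b hb
    refine Finset.mul_card_image_le_card_of_maps_to (f := G.parent p) (fun x hx => ?_) b
      fun t ht => (hb t ht).trans (Finset.card_le_card fun x hx => ?_)
    · obtain ⟨hx, hxw⟩ := Finset.mem_filter.1 hx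
      exact (hp.mem_children_iff hG hc hN hw).2 ⟨hp.parent_mem_levelSet hG hc hN hx, hxw⟩
    · obtain ⟨htl, rfl⟩ := (hp.mem_children_iff hG hc hN hw).1 ht
      obtain ⟨hxl, rfl⟩ := (hp.mem_children_iff hG hc hN htl).1 hx
      exact Finset.mem_filter.2 ⟨Finset.mem_filter.2 ⟨hxl, rfl⟩, rfl⟩
  have hgrandkids : ∀ t ∈ G.children sp c R p N w,
      2 ≤ (G.children sp c R p N t).card + if G.HasSpecial sp t then 1 else 0 := fun t ht => by
    obtain ⟨hmem', -, hlevel'⟩ := hp.exists_of_mem_children ht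
    exact hblocked.two_le_card_children hG hsp hc hN hp hunique hmem' (by omega)
  by_cases hspecial : G.HasSpecial sp w
  · have htwo := hcount 2 fun t ht => by
      obtain ⟨-, he, hlevel'⟩ := hp.exists_of_mem_children ht
      have hnot : ¬ G.HasSpecial sp t := fun h =>
        hsparse t w _ he (fun heq => by rw [heq] at hlevel'; omega) h hspecial
      simpa only [if_neg hnot, add_zero] using hgrandkids t ht
    rw [if_pos hspecial] at hkids
    omega
  · have hone := hcount 1 fun t ht => by
      have := hgrandkids t ht
      split_ifs at this <;> omega
    rw [if_neg hspecial] at hkids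
    omega

end Children

open Classical in
include hN in
theorem Blocked.two_pow_le_card_levelSet (hunique : G.SpecialUnique sp)
    (hsparse : G.SpecialSparse sp) {j : ℕ} (hj : 2 * j ≤ R) :
    2 ^ j ≤ (G.levelSet sp c R N (2 * j)).card := by
  obtain ⟨p, hp⟩ := exists_isParentMap (c := c) (R := R) hG hsp
  induction j with
  | zero =>
    rw [pow_zero, Nat.one_le_iff_ne_zero, ← Nat.pos_iff_ne_zero, Finset.card_pos]
    exact ⟨c, Finset.mem_filter.2 ⟨hN c hc, center_mem_ball, level_center⟩⟩
  | succ j ih =>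
    rw [pow_succ']
    refine (Nat.mul_le_mul_left 2 (ih (by omega))).trans ?_
    exact Finset.mul_card_image_le_card_of_maps_to (f := fun x => G.parent p (G.parent p x))
      (fun x hx => hp.parent_mem_levelSet hG hc hN (hp.parent_mem_levelSet hG hc hN hx)) 2
      fun w hw => hblocked.two_le_card_grandchildren hG hsp hc hN hp hunique hsparse (by omega) hw

include hN in
open Classical in
theorem Blocked.two_pow_le_card_special (hunique : G.SpecialUnique sp)
    (hsparse : G.SpecialSparse sp) {M : O → Prop}
    (hM : ∀ m, G.IsNode m → M m →
      G.HasSpecial sp m ∨ G.step 0 m = m ∨ ∃ i, i ≠ 0 ∧ G.step i m = G.step 0 m)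
    {D : ℕ} (hdom : ∀ w, ∃ m, M m ∧ StepReach G.step D w m) {j : ℕ} (hj : 2 * j + D < R) :
    2 ^ j ≤ 4 ^ D * (N.filter fun u => u ∈ G.ball sp c R ∧ G.HasSpecial sp u).card := by
  refine (hblocked.two_pow_le_card_levelSet hG hsp hc hN hunique hsparse (by omega)).trans ?_
  have hcover : G.levelSet sp c R N (2 * j) ⊆
      (N.filter fun u => u ∈ G.ball sp c R ∧ G.HasSpecial sp u).biUnion (reachFinset G.step D) := by
    intro w hw
    obtain ⟨-, hwR, hlevel⟩ := Finset.mem_filter.1 hw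
    obtain ⟨m, hm, hreach⟩ := hdom w
    obtain ⟨u, hu, hspecial, hwu⟩ := hblocked.exists_hasSpecial hG hsp hc hM
      (mem_ball_level hwR) hm hreach (by omega)
    exact Finset.mem_biUnion.2 ⟨u, Finset.mem_filter.2
      ⟨hN u (isNode_of_mem_ball hG hc hu), hu, hspecial⟩, mem_reachFinset (hwu.symm (step_symm hG))⟩
  refine (Finset.card_le_card hcover).trans ?_
  rw [mul_comm]
  exact Finset.card_biUnion_le_card_mul _ _ _ fun u _ => by
    simpa using card_reachFinset_le (st := G.step) (n := D) (x := u)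

end Growth
end HalfEdgeGraph

namespace HalfEdgeGraph
variable {O : Type*}

/-- The node `m` is marked and proposes its zeroth edge to be special. This edge must neither be a
self-loop nor have a parallel edge. -/
def IsProposer (G : HalfEdgeGraph O) (M : O → Prop) (m : O) : Prop :=
  G.IsNode m ∧ M m ∧ G.step 0 m ≠ m ∧ ∀ i, i ≠ 0 → G.step i m ≠ G.step 0 m

/-- `h` is the half at the proposer of a proposed edge. -/
def Proposed (G : HalfEdgeGraph O) (M : O → Prop) (h : O) : Prop :=
  G.Attached h ∧ G.IsProposer M (G.node h) ∧ h = G.half 0 (G.node h)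

/-- The half-edges of the proposed edges. -/
def Special (G : HalfEdgeGraph O) (M : O → Prop) (h : O) : Prop :=
  G.Proposed M h ∨ G.Proposed M (G.opp h)

/-- The half-edges of the proposed edges that are directed outwards; the coin of the proposer tells
whether the edge is directed away from it. -/
def CoinOut (G : HalfEdgeGraph O) (M coin : O → Prop) (h : O) : Prop :=
  G.Proposed M h ∧ coin (G.node h) ∨ ¬ G.Proposed M h ∧ ¬ coin (G.node (G.opp h))

variable {G : HalfEdgeGraph O} {M coin : O → Prop}

theorem Proposed.attached_opp {h : O} (hh : G.Proposed M h) : G.Attached (G.opp h) := by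
  obtain ⟨-, ⟨-, -, hmove, -⟩, hhalf⟩ := hh
  rw [hhalf]
  exact of_not_not fun hn => hmove (if_neg fun h => hn h.2)

theorem Proposed.step_eq {h : O} (hh : G.Proposed M h) :
    G.step 0 (G.node h) = G.node (G.opp h) := by
  have hatt := hh.attached_opp
  obtain ⟨-, ⟨hnode, -, -, -⟩, hhalf⟩ := hh
  rw [hhalf] at hatt
  rw [step, if_pos ⟨hnode, hatt⟩, ← hhalf]

theorem Proposed.node_opp_ne {h : O} (hh : G.Proposed M h) : G.node (G.opp h) ≠ G.node h :=
  hh.step_eq ▸ hh.2.1.2.2.1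

theorem Proposed.stepReach {h : O} (hh : G.Proposed M h) :
    StepReach G.step 1 (G.node h) (G.node (G.opp h)) := hh.step_eq ▸ .step 0 _

theorem special_opp (hG : G.Cubic) (h : O) : G.Special M (G.opp h) ↔ G.Special M h := by
  rw [Special, Special, hG.opp_opp, or_comm]

theorem IsProposer.proposed (hG : G.Cubic) {m : O} (hm : G.IsProposer M m) :
    G.Proposed M (G.half 0 m) := by
  refine ⟨hG.attached_half _ _ hm.1, ?_, ?_⟩ <;> rw [hG.node_half _ _ hm.1]
  exact hm

theorem HasSpecial.exists_isProposer (hG : G.Cubic) {u : O} (h : G.HasSpecial (G.Special M) u) :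
    ∃ m, G.IsProposer M m ∧ (u = m ∨ u = G.step 0 m) := by
  obtain ⟨e, -, rfl, he | he⟩ := h
  · exact ⟨_, he.2.1, Or.inl rfl⟩
  · exact ⟨_, he.2.1, Or.inr (by rw [he.step_eq, hG.opp_opp])⟩

theorem hasSpecial_or_step_eq (hG : G.Cubic) (m : O) (hnode : G.IsNode m) (hm : M m) :
    G.HasSpecial (G.Special M) m ∨ G.step 0 m = m ∨ ∃ i, i ≠ 0 ∧ G.step i m = G.step 0 m := by
  by_cases h : G.IsProposer M m
  · exact Or.inl
      ⟨_, hG.attached_half _ _ hnode, hG.node_half _ _ hnode, Or.inl (h.proposed hG)⟩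
  · by_contra! hnot
    exact h ⟨hnode, hm, hnot.2.1, hnot.2.2⟩

theorem special_false (G : HalfEdgeGraph O) : G.Special (fun _ => False) = fun _ => False := by
  funext h
  simp [Special, Proposed, IsProposer]

section Separated
variable (hG : G.Cubic) (hsep : ∀ x y, M x → M y → StepReach G.step 3 x y → x = y)
include hsep

theorem Proposed.node_eq_of_stepReach {h h' : O} (hh : G.Proposed M h) (hh' : G.Proposed M h')
    {n : ℕ} (hn : n ≤ 3) (hreach : StepReach G.step n (G.node h) (G.node h')) :
    G.node h = G.node h' :=
  hsep _ _ hh.2.1.2.1 hh'.2.1.2.1 (hreach.mono hn)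

theorem Proposed.not_opp {h : O} (hh : G.Proposed M h) : ¬ G.Proposed M (G.opp h) := fun hopp =>
  hh.node_opp_ne (hh.node_eq_of_stepReach hsep hopp (by omega) hh.stepReach).symm

include hG

theorem coinOut_opp {h : O} (hs : G.Special M h) :
    G.CoinOut M coin (G.opp h) ↔ ¬ G.CoinOut M coin h := by
  have hopp := hG.opp_opp h
  rcases hs with hs | hs
  · have := hs.not_opp hsep
    simp [CoinOut, hs, this, hopp]
  · have := hs.not_opp hsep
    rw [hopp] at this
    simp [CoinOut, hs, this, hopp]

theorem Proposed.ne_node_of_proposed_opp {h h' : O} (hh : G.Proposed M h)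
    (hh' : G.Proposed M (G.opp h')) : G.node h ≠ G.node h' := by
  intro hnode
  have hreach := hh'.stepReach
  rw [hG.opp_opp, ← hnode] at hreach
  have heq := hh'.node_eq_of_stepReach hsep hh (by omega) hreach
  exact hh'.node_opp_ne (by rw [hG.opp_opp, ← hnode, heq])

theorem specialUnique_special : G.SpecialUnique (G.Special M) := by
  intro h h' _ _ hnode hs hs'
  rcases hs with hs | hs <;> rcases hs' with hs' | hs'
  · rw [hs.2.2, hs'.2.2, hnode]
  · exact absurd hnode (hs.ne_node_of_proposed_opp hG hsep hs')
  · exact absurd hnode.symm (hs'.ne_node_of_proposed_opp hG hsep hs)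
  · have hreach := hs.stepReach
    have hreach' := hs'.stepReach
    rw [hG.opp_opp] at hreach hreach'
    rw [← hnode] at hreach'
    have heq := hs.node_eq_of_stepReach hsep hs' (by omega)
      (hreach.trans (hreach'.symm (step_symm hG)))
    rw [← hG.opp_opp h, hs.2.2, heq, ← hs'.2.2, hG.opp_opp]

omit hsep in
theorem IsProposer.special_of_isHalfEdge {sp : O → Prop} {m h : O} (hm : G.IsProposer M m)
    (he : G.IsHalfEdge sp m (G.step 0 m) h) : G.Special M h := by
  obtain ⟨i, rfl⟩ : ∃ i, G.half i m = h := he.node_eq ▸ hG.exists_half_eq h he.attached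
  obtain rfl : i = 0 := of_not_not fun hi => hm.2.2.2 i hi (he.step_eq hm.1)
  exact Or.inl (hm.proposed hG)

theorem specialSparse_special : G.SpecialSparse (G.Special M) := by
  intro u w h he hne hu hw
  obtain ⟨m, hm, hum⟩ := hu.exists_isProposer hG
  obtain ⟨m', hm', hwm⟩ := hw.exists_isProposer hG
  have near : ∀ {m u : O}, u = m ∨ u = G.step 0 m → StepReach G.step 1 m u := by
    rintro m u (rfl | rfl)
    exacts [.refl _ _, .step _ _]
  have huw : StepReach G.step 1 u w := by
    obtain ⟨i, hi⟩ := he.node_eq ▸ hG.exists_half_eq h he.attached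
    have hnode := he.node_eq ▸ hG.isNode_node h he.attached
    exact IsHalfEdge.step_eq (i := i) hnode (hi ▸ he) ▸ .step _ _
  obtain rfl := hsep m m' hm.2.1 hm'.2.1
    (((near hum).trans huw).trans ((near hwm).symm (step_symm hG)))
  have he' := he.symm hG (special_opp hG)
  rcases hum with rfl | rfl <;> rcases hwm with rfl | rfl
  · exact hne rfl
  · exact he.not_special (hm.special_of_isHalfEdge hG he)
  · exact he'.not_special (hm.special_of_isHalfEdge hG he')
  · exact hne rfl

omit hG hsep in
open Classical in
/-- The proposers whose proposed edges touch the ball around `c`. -/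
noncomputable def touched (G : HalfEdgeGraph O) (M : O → Prop) (N : Finset O) (R : ℕ) (c : O) :
    Finset O :=
  N.filter fun m => G.IsProposer M m ∧
    (m ∈ G.ball (G.Special M) c R ∨ G.step 0 m ∈ G.ball (G.Special M) c R)

variable {c : O} {R : ℕ} {N : Finset O}
  (hblocked : G.Blocked (G.Special M) (G.CoinOut M coin) c R)
include hblocked

/-- All special edges that touch a blocked ball are directed into it, so the coins of their
proposers are determined by the ball. -/
theorem Blocked.coin_iff_of_mem_touched {m : O} (hm : m ∈ G.touched M N R c) :
    coin m ↔ m ∉ G.ball (G.Special M) c R := by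
  classical
  obtain ⟨-, hm, hball⟩ := Finset.mem_filter.1 hm
  obtain ⟨p, hp⟩ := exists_isParentMap (c := c) (R := R) hG (special_opp hG (M := M))
  have not_out : ∀ h, G.Attached h → G.node h ∈ G.ball (G.Special M) c R → G.Special M h →
      ¬ G.CoinOut M coin h := fun h hatt hmem hs hout =>
    hblocked.not_isTerminal hG (special_opp hG) hp hmem ⟨hatt, rfl, Or.inl ⟨hs, hout⟩⟩
  have hprop := hm.proposed hG
  have hnode := hG.node_half m 0 hm.1
  by_cases hmem : m ∈ G.ball (G.Special M) c R
  · refine iff_of_false (fun hcoin => ?_) (not_not_intro hmem)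
    exact not_out _ hprop.1 (by rwa [hnode]) (Or.inl hprop) (Or.inl ⟨hprop, by rwa [hnode]⟩)
  · refine iff_of_true (of_not_not fun hcoin => ?_) hmem
    have hstep := hprop.step_eq
    rw [hnode] at hstep
    exact not_out _ hprop.attached_opp (hstep ▸ hball.resolve_left hmem)
      (Or.inr (by rwa [hG.opp_opp]))
      (Or.inr ⟨hprop.not_opp hsep, by rwa [hG.opp_opp, hnode]⟩)

theorem Blocked.two_pow_le_card_touched (hN : ∀ w, G.IsNode w → w ∈ N) (hc : G.IsNode c) {D : ℕ}
    (hdom : ∀ w, ∃ m, M m ∧ StepReach G.step D w m) {j : ℕ} (hj : 2 * j + D < R) :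
    2 ^ j ≤ 4 ^ D * (2 * (G.touched M N R c).card) := by
  classical
  refine (hblocked.two_pow_le_card_special hG (special_opp hG) hc hN
    (specialUnique_special hG hsep) (specialSparse_special hG hsep) (hasSpecial_or_step_eq hG)
    hdom hj).trans (Nat.mul_le_mul_left _ ?_)
  have hcover : (N.filter fun u => u ∈ G.ball (G.Special M) c R ∧ G.HasSpecial (G.Special M) u) ⊆
      G.touched M N R c ∪ (G.touched M N R c).image (G.step 0) := by
    intro u hu
    obtain ⟨huN, hmem, hspecial⟩ := Finset.mem_filter.1 hu
    obtain ⟨m, hm, rfl | rfl⟩ := hspecial.exists_isProposer hG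
    · exact Finset.mem_union_left _ (Finset.mem_filter.2 ⟨huN, hm, Or.inl hmem⟩)
    · exact Finset.mem_union_right _ (Finset.mem_image_of_mem _
        (Finset.mem_filter.2 ⟨hN m hm.1, hm, Or.inr hmem⟩))
  have hle := (Finset.card_le_card hcover).trans (Finset.card_union_le _ _)
  have himage := Finset.card_image_le (s := G.touched M N R c) (f := G.step 0)
  omega

end Separated

theorem not_blocked_of_card_lt (hG : G.Cubic) {out : O → Prop} {c : O} (hc : G.IsNode c)
    {N : Finset O} (hN : ∀ w, G.IsNode w → w ∈ N) {j R : ℕ} (hj : 2 * j ≤ R)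
    (hcard : N.card < 2 ^ j) : ¬ G.Blocked (fun _ => False) out c R := by
  classical
  intro hblocked
  have hgrowth := hblocked.two_pow_le_card_levelSet hG (fun _ => Iff.rfl) hc hN
    (fun _ _ _ _ _ h => h.elim) (fun _ _ _ _ _ _ ⟨_, _, _, h⟩ => h) hj
  exact (hgrowth.trans (Finset.card_le_card (Finset.filter_subset _ _))).not_gt hcard

end HalfEdgeGraph

/-! ### Agreement on an orientation -/

/-- What a node learns about a half-edge: the tags of the half-edge, of its node, of the opposite
half-edge and of the node of the latter, and the state of the edge. -/
structure HalfEdgeRecord where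
  tag : ℕ × ℕ
  node : ℕ × ℕ
  opp : ℕ × ℕ
  oppNode : ℕ × ℕ
  attached : Prop
  attachedOpp : Prop
  special : Prop
  out : Prop

/-- A choice of an outgoing half-edge for each of some nodes, in terms of tags, that is made on
behalf of the node `center`. -/
structure Proposal where
  center : ℕ × ℕ
  nodes : Set (ℕ × ℕ)
  choice : ℕ × ℕ → ℕ × ℕ

/-- Within the proposal, the recorded half-edge may be chosen as an outgoing one. -/
def HalfEdgeRecord.IsSafe (ρ : HalfEdgeRecord) (P : Proposal) : Prop :=
  ρ.special ∧ ρ.out ∨ ¬ ρ.special ∧ ¬ ρ.attachedOpp ∨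
    ¬ ρ.special ∧ ρ.oppNode ∈ P.nodes ∧ P.choice ρ.oppNode ≠ ρ.opp

namespace Proposal

/-- The counterpart of `HalfEdgeGraph.Closed` in terms of records. -/
def IsClosed (P : Proposal) (D : Set HalfEdgeRecord) : Prop :=
  ∀ t ∈ P.nodes, ∃ ρ ∈ D, ρ.attached ∧ ρ.node = t ∧ ρ.tag = P.choice t ∧ ρ.IsSafe P

open Classical in
/-- A closed proposal for `t` on its own behalf if there is one, and otherwise an empty one. -/
noncomputable def pick (D : Set HalfEdgeRecord) (t : ℕ × ℕ) : Proposal :=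
  if h : ∃ P : Proposal, P.center = t ∧ t ∈ P.nodes ∧ P.IsClosed D then h.choose
  else ⟨t, ∅, fun _ => 0⟩

variable {D : Set HalfEdgeRecord} {t : ℕ × ℕ}

theorem center_pick : (pick D t).center = t := by
  rw [pick]
  split_ifs with h
  exacts [h.choose_spec.1, rfl]

theorem isClosed_pick : (pick D t).IsClosed D := by
  rw [pick]
  split_ifs with h
  exacts [h.choose_spec.2.2, fun _ => False.elim]

theorem IsClosed.mem_nodes_pick {P : Proposal} (hP : P.IsClosed D) (hcenter : P.center = t)
    (ht : t ∈ P.nodes) : t ∈ (pick D t).nodes := by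
  have h : ∃ P : Proposal, P.center = t ∧ t ∈ P.nodes ∧ P.IsClosed D := ⟨P, hcenter, ht, hP⟩
  rw [pick, dif_pos h]
  exact h.choose_spec.2.1

end Proposal

/-- A code for tags by which they are compared. -/
def tagKey (t : ℕ × ℕ) : ℕ := Nat.pair t.1 t.2

theorem tagKey_injective : Function.Injective tagKey := fun _ _ h =>
  Prod.ext_iff.2 (Nat.pair_eq_pair.1 h)

/-- Among the proposals in `A` for the node `t`, the proposal `P` has the smallest centre. -/
def Proposal.IsBest (P : Proposal) (A : Set Proposal) (t : ℕ × ℕ) : Prop :=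
  P ∈ A ∧ t ∈ P.nodes ∧ ∀ Q ∈ A, t ∈ Q.nodes → tagKey P.center ≤ tagKey Q.center

theorem Proposal.exists_isBest {A : Set Proposal} {t : ℕ × ℕ} {P : Proposal} (hP : P ∈ A)
    (ht : t ∈ P.nodes) : ∃ Q : Proposal, Q.IsBest A t := by
  obtain ⟨Q, hQ, hmin⟩ := (measure fun Q : Proposal => tagKey Q.center).wf.has_min
    {Q | Q ∈ A ∧ t ∈ Q.nodes} ⟨P, hP, ht⟩
  exact ⟨Q, hQ.1, hQ.2, fun Q' hA hmem => not_lt.1 (hmin Q' ⟨hA, hmem⟩)⟩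

namespace HalfEdgeGraph
variable {S : ℕ → Type} {k : ℕ}

section Proposals
variable (I : Instance S k) (G : HalfEdgeGraph I.Slot) (sp out : I.Slot → Prop) (r r' : ℕ)

/-- The record of the half-edge `h`. -/
def record (h : I.Slot) : HalfEdgeRecord where
  tag := I.tag h
  node := I.tag (G.node h)
  opp := I.tag (G.opp h)
  oppNode := I.tag (G.node (G.opp h))
  attached := G.Attached h
  attachedOpp := G.Attached (G.opp h)
  special := sp h
  out := out h

/-- The proposal made by `c` on the basis of the half-edges within distance `r`. -/
noncomputable def proposal (c : I.Slot) : Proposal :=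
  .pick (G.record I sp out '' {h | I.net.Within r c.1 h.1}) (I.tag c)

/-- The proposals that `w` learns within distance `r'`. -/
noncomputable def proposals (w : I.Slot) : Set Proposal :=
  G.proposal I sp out r '' {c | I.net.Within r' w.1 c.1}

/-- The best proposal for the node of `h` chooses `h`. -/
def Chosen (h : I.Slot) : Prop :=
  G.Attached h ∧ ∃ P : Proposal,
    P.IsBest (G.proposals I sp out r r' (G.node h)) (I.tag (G.node h)) ∧
      P.choice (I.tag (G.node h)) = I.tag h

/-- The half-edges that are directed outwards when the chosen ones are, and the remaining edges are
directed by comparing tags. -/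
def orientation (h : I.Slot) : Prop :=
  G.Chosen I sp out r r' h ∨ ¬ G.Chosen I sp out r r' (G.opp h) ∧
    tagKey (I.tag h) < tagKey (I.tag (G.opp h))

end Proposals

section Orientation
variable {I : Instance S k} {G : HalfEdgeGraph I.Slot} {sp out : I.Slot → Prop} {r r' K : ℕ}

theorem proposal_mem_proposals (hnode : ∀ h, I.net.Within K h.1 (G.node h).1) (hr : r + K ≤ r')
    {c w : I.Slot} (hmem : I.tag w ∈ (G.proposal I sp out r c).nodes) :
    G.proposal I sp out r c ∈ G.proposals I sp out r r' w := by
  obtain ⟨-, ⟨h, hwithin, rfl⟩, -, htag, -⟩ := Proposal.isClosed_pick _ hmem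
  obtain rfl : G.node h = w := I.tag_injective htag
  exact ⟨c, (Network.Within.symm (hwithin.trans (hnode h))).mono hr, rfl⟩

theorem exists_chosen_half {c : I.Slot} {t : ℕ × ℕ}
    (hmem : t ∈ (G.proposal I sp out r c).nodes) :
    ∃ h, G.Attached h ∧ I.tag (G.node h) = t ∧ I.tag h = (G.proposal I sp out r c).choice t ∧
      (G.record I sp out h).IsSafe (G.proposal I sp out r c) := by
  obtain ⟨-, ⟨h, -, rfl⟩, hatt, htag, hchoice, hsafe⟩ := Proposal.isClosed_pick _ hmem
  exact ⟨h, hatt, htag, hchoice, hsafe⟩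

theorem Chosen.exists_isBest {h : I.Slot} (hh : G.Chosen I sp out r r' h) :
    ∃ c, (G.proposal I sp out r c).IsBest (G.proposals I sp out r r' (G.node h))
        (I.tag (G.node h)) ∧
      (G.proposal I sp out r c).choice (I.tag (G.node h)) = I.tag h ∧
      (G.record I sp out h).IsSafe (G.proposal I sp out r c) := by
  obtain ⟨-, P, hbest, hchoice⟩ := hh
  obtain ⟨c, -, rfl⟩ := hbest.1
  obtain ⟨h', -, -, htag, hsafe⟩ := exists_chosen_half hbest.2.1
  obtain rfl : h' = h := I.tag_injective (htag.trans hchoice)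
  exact ⟨c, hbest, hchoice, hsafe⟩

/-- If both halves of an edge were chosen, then both proposals would concern both ends of the edge,
so they would have the same centre. -/
theorem Chosen.not_opp (hG : G.Cubic) (hnode : ∀ h, I.net.Within K h.1 (G.node h).1)
    (hr : r + K ≤ r') (hsp : ∀ h, sp (G.opp h) ↔ sp h)
    (hout : ∀ h, sp h → (out (G.opp h) ↔ ¬ out h)) {h : I.Slot}
    (hh : G.Chosen I sp out r r' h) : ¬ G.Chosen I sp out r r' (G.opp h) := by
  intro hh'
  obtain ⟨c, hbest, -, hsafe⟩ := hh.exists_isBest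
  obtain ⟨c', hbest', hchoice', hsafe'⟩ := hh'.exists_isBest
  simp only [HalfEdgeRecord.IsSafe, record, hG.opp_opp, hsp] at hsafe hsafe'
  rcases hsafe with ⟨hs, ho⟩ | ⟨-, hloose⟩ | ⟨hs, hmem, hne⟩
  · rcases hsafe' with ⟨-, ho'⟩ | ⟨hs', -⟩ | ⟨hs', -⟩
    exacts [(hout h hs).1 ho' ho, hs' hs, hs' hs]
  · exact hloose hh'.1
  · rcases hsafe' with ⟨hs', -⟩ | ⟨-, hloose'⟩ | ⟨-, hmem', -⟩
    · exact hs hs'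
    · exact hloose' hh.1
    · have hle := hbest.2.2 _ (proposal_mem_proposals hnode hr hmem') hmem'
      have hle' := hbest'.2.2 _ (proposal_mem_proposals hnode hr hmem) hmem
      have hcenter := tagKey_injective (hle.antisymm hle')
      simp only [proposal, Proposal.center_pick] at hcenter
      obtain rfl := I.tag_injective hcenter
      exact hne hchoice'

theorem orientation_opp (hG : G.Cubic) (hnode : ∀ h, I.net.Within K h.1 (G.node h).1)
    (hr : r + K ≤ r') (hsp : ∀ h, sp (G.opp h) ↔ sp h)
    (hout : ∀ h, sp h → (out (G.opp h) ↔ ¬ out h)) (h : I.Slot) :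
    G.orientation I sp out r r' (G.opp h) ↔ ¬ G.orientation I sp out r r' h := by
  have hne : tagKey (I.tag (G.opp h)) ≠ tagKey (I.tag h) :=
    (tagKey_injective.comp I.tag_injective).ne (hG.opp_ne h)
  have hnot := Chosen.not_opp (r' := r') hG hnode hr hsp hout (h := h)
  by_cases hh : G.Chosen I sp out r r' h
  · simp [orientation, hG.opp_opp, hh, hnot hh]
  · by_cases hh' : G.Chosen I sp out r r' (G.opp h)
    · simp [orientation, hh, hh']
    · simp only [orientation, hG.opp_opp, hh, hh', false_or, not_false_iff, true_and]
      omega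

theorem exists_orientation_half (hG : G.Cubic) {w : I.Slot} {T : Set I.Slot}
    {o : I.Slot → I.Slot} (hT : G.Closed sp out T o) (hw : w ∈ T)
    (hwithin : ∀ u ∈ T, I.net.Within r w.1 (o u).1) :
    ∃ i, G.orientation I sp out r r' (G.half i w) := by
  have hclosed : Proposal.IsClosed
      ⟨I.tag w, I.tag '' T, Function.extend I.tag (fun u => I.tag (o u)) fun _ => 0⟩
      (G.record I sp out '' {h | I.net.Within r w.1 h.1}) := by
    rintro - ⟨u, hu, rfl⟩
    refine ⟨_, ⟨o u, hwithin u hu, rfl⟩, ?_⟩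
    simp only [HalfEdgeRecord.IsSafe, record, I.tag_injective.extend_apply]
    rcases hT u hu with hu | ⟨v, hv, hu, hne⟩
    · exact ⟨hu.attached, by rw [hu.node_eq], trivial, hu.special_or_loose.imp id Or.inl⟩
    · rw [hu.node_eq, hu.node_opp]
      exact ⟨hu.attached, rfl, trivial,
        Or.inr (Or.inr ⟨hu.not_special, ⟨v, hv, rfl⟩, I.tag_injective.ne hne⟩)⟩
  obtain ⟨P, hbest⟩ := Proposal.exists_isBest (A := G.proposals I sp out r r' w)
    ⟨w, .refl _ _, rfl⟩ (hclosed.mem_nodes_pick rfl ⟨w, hw, rfl⟩)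
  obtain ⟨c, -, rfl⟩ := hbest.1
  obtain ⟨h, hatt, htag, hchoice, -⟩ := exists_chosen_half hbest.2.1
  obtain rfl : G.node h = w := I.tag_injective htag
  obtain ⟨i, hi⟩ := hG.exists_half_eq h hatt
  exact ⟨i, Or.inl (hi.symm ▸ ⟨hatt, _, hbest, hchoice.symm⟩)⟩

theorem within_of_mem_ball (hnode : ∀ h, I.net.Within K h.1 (G.node h).1)
    (hopp : ∀ h, I.net.Within K h.1 (G.opp h).1) {c w : I.Slot} {i : ℕ}
    (hw : w ∈ G.ball sp c i) : I.net.Within (3 * K * i) c.1 w.1 := by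
  induction i generalizing w with
  | zero => exact hw ▸ .refl _ _
  | succ i ih =>
    rcases hw with hw | ⟨u, hu, h, he⟩
    · exact (ih hw).mono (Nat.mul_le_mul_left _ i.le_succ)
    · have hback := he.node_eq ▸ (hnode h).symm
      have hforth := he.node_opp ▸ hnode (G.opp h)
      refine ((((ih hu).trans hback).trans (hopp h)).trans hforth).mono ?_
      rw [Nat.mul_succ]
      omega

end Orientation

/-- All parts of a family of graphs on the slots of the instances are determined locally. -/
structure IsLocalGraph (g : ℕ → ℕ) (G : ∀ I : Instance S k, HalfEdgeGraph I.Slot) : Prop where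
  opp : IsLocalMap g fun I => (G I).opp
  attached : IsLocal g fun I => (G I).Attached
  node : IsLocalMap g fun I => (G I).node
  isNode : IsLocal g fun I => (G I).IsNode
  half : ∀ i, IsLocalMap g fun I => (G I).half i

namespace IsLocalGraph
variable {g : ℕ → ℕ} {G : ∀ I : Instance S k, HalfEdgeGraph I.Slot}
  {sp out M coin : ∀ I : Instance S k, I.Slot → Prop}

theorem step (hG : IsLocalGraph g G) (hg : ∀ n, 1 ≤ g n) (i : Fin 3) :
    IsLocalMap g fun I => (G I).step i :=
  have hopp : IsLocalMap g fun I w => (G I).opp ((G I).half i w) := hG.opp.comp hg (hG.half i)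
  IsLocalMap.ite (hG.isNode.and (hG.attached.comp hg hopp)) (hG.node.comp hg hopp) .id

theorem isProposer (hG : IsLocalGraph g G) (hg : ∀ n, 1 ≤ g n) (hM : IsLocal g M) :
    IsLocal g fun I => (G I).IsProposer (M I) :=
  have hstep := hG.step hg
  hG.isNode.and <| hM.and <| ((hstep 0).eq .id).not.and <|
    .forall_finite fun i => (IsLocal.const (i ≠ 0)).imp ((hstep i).eq (hstep 0)).not

theorem proposed (hG : IsLocalGraph g G) (hg : ∀ n, 1 ≤ g n) (hM : IsLocal g M) :
    IsLocal g fun I => (G I).Proposed (M I) :=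
  hG.attached.and <| ((hG.isProposer hg hM).comp hg hG.node).and <|
    IsLocalMap.id.eq ((hG.half 0).comp hg hG.node)

theorem special (hG : IsLocalGraph g G) (hg : ∀ n, 1 ≤ g n) (hM : IsLocal g M) :
    IsLocal g fun I => (G I).Special (M I) :=
  (hG.proposed hg hM).or ((hG.proposed hg hM).comp hg hG.opp)

theorem coinOut (hG : IsLocalGraph g G) (hg : ∀ n, 1 ≤ g n) (hM : IsLocal g M)
    (hcoin : IsLocal g coin) : IsLocal g fun I => (G I).CoinOut (M I) (coin I) :=
  ((hG.proposed hg hM).and (hcoin.comp hg hG.node)).or <|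
    (hG.proposed hg hM).not.and (hcoin.comp hg (hG.node.comp hg hG.opp)).not

theorem orientation (hG : IsLocalGraph g G) (hg : ∀ n, 1 ≤ g n) (hsp : IsLocal g sp)
    (hout : IsLocal g out) (C C' : ℕ) :
    IsLocal g fun I => (G I).orientation I (sp I) (out I) (C * g I.size) (C' * g I.size) := by
  have hrecord : IsLocal g fun I => (G I).record I (sp I) (out I) :=
    (IsLocal.tag.prodMk <| hG.node.tag.prodMk <| hG.opp.tag.prodMk <|
      (hG.node.comp hg hG.opp).tag.prodMk <| hG.attached.prodMk <|
      (hG.attached.comp hg hG.opp).prodMk <| hsp.prodMk hout).map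
      fun (tag, node, opp, oppNode, attached, attachedOpp, special, out) =>
        (⟨tag, node, opp, oppNode, attached, attachedOpp, special, out⟩ : HalfEdgeRecord)
  have hproposals : IsLocal g fun I =>
      (G I).proposals I (sp I) (out I) (C * g I.size) (C' * g I.size) :=
    ((hrecord.ball C).map₂ Proposal.pick IsLocal.tag).ball C'
  have hchosen : IsLocal g fun I =>
      (G I).Chosen I (sp I) (out I) (C * g I.size) (C' * g I.size) :=
    (hG.attached.prodMk <| (hproposals.comp hg hG.node).prodMk <|
      hG.node.tag.prodMk IsLocal.tag).map
      fun (attached, A, node, tag) =>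
        attached ∧ ∃ P : Proposal, P.IsBest A node ∧ P.choice node = tag
  exact hchosen.or ((hchosen.comp hg hG.opp).not.and
    (IsLocal.tag.map₂ (fun s t => tagKey s < tagKey t) hG.opp.tag))

end IsLocalGraph

end HalfEdgeGraph

/-! ### Contraction of chains -/

open Classical in
/-- Follow `f` for at most `n` steps, as long as `p` holds. -/
noncomputable def walk {O : Type*} (f : O → O) (p : O → Prop) : ℕ → O → O
  | 0, y => y
  | n + 1, y => if p y then walk f p n (f y) else y

section Walk
variable {O : Type*} {f : O → O} {p : O → Prop}

theorem walk_of_not {y : O} (h : ¬ p y) (n : ℕ) : walk f p n y = y := by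
  cases n with
  | zero => rfl
  | succ n => rw [walk, if_neg h]

theorem exists_walk_eq_iterate (n : ℕ) (y : O) : ∃ m ≤ n, walk f p n y = f^[m] y ∧
    (∀ i < m, p (f^[i] y)) ∧ (p (walk f p n y) → m = n) := by
  induction n generalizing y with
  | zero => exact ⟨0, le_rfl, rfl, by simp, fun _ => rfl⟩
  | succ n ih =>
    by_cases h : p y
    · obtain ⟨m, hm, heq, hlt, hlast⟩ := ih (f y)
      rw [walk, if_pos h]
      refine ⟨m + 1, by omega, heq, ?_, fun hp => congrArg (· + 1) (hlast hp)⟩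
      rintro (_ | i) hi
      exacts [h, hlt i (by omega)]
    · rw [walk, if_neg h]
      exact ⟨0, by omega, rfl, by simp, fun hp => absurd hp h⟩

theorem walk_eq_iterate {n m : ℕ} {y : O} (hend : ¬ p (walk f p n y))
    (hlt : ∀ i < m, p (f^[i] y)) (hm : ¬ p (f^[m] y)) : walk f p n y = f^[m] y := by
  obtain ⟨l, -, heq, hlt', -⟩ := exists_walk_eq_iterate (f := f) (p := p) n y
  rcases lt_trichotomy l m with hlm | rfl | hlm
  · exact absurd (hlt l hlm) (heq ▸ hend)
  · exact heq
  · exact absurd (hlt' m hlm) hm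

end Walk

/-- The half-edges of a graph whose nodes of degree two are to be contracted: `mate z` is the other
half of the edge of `z`, and if `z` is at a node of degree two (`Inner z`), then `twin z` is the
other half-edge at this node. -/
structure Pairing (O : Type*) where
  mate : O → O
  twin : O → O
  Inner : O → Prop
  mate_mate : ∀ z, mate (mate z) = z
  mate_ne : ∀ z, mate z ≠ z
  twin_twin : ∀ z, twin (twin z) = z
  twin_ne : ∀ z, twin z ≠ z
  inner_twin : ∀ z, Inner (twin z) ↔ Inner z

namespace Pairing
variable {O : Type*} (A : Pairing O)

/-- One step along a chain. -/
def next (z : O) : O := A.mate (A.twin z)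

/-- The half-edge `z` belongs to a cycle that consists of two nodes of degree two. -/
def InTwoCycle (z : O) : Prop :=
  A.Inner z ∧ A.Inner (A.mate z) ∧ A.mate (A.twin z) = A.twin (A.mate z)

/-- The end of the chain that starts with `mate z`. Chains longer than `L` are cut off. -/
noncomputable def chainEnd (L : ℕ) (z : O) : O := walk A.next A.Inner (L + 1) (A.mate z)

open Classical in
/-- The other half of the edge that arises from the chain of `z` by contraction. On inner half-edges
this is the arbitrary choice `twin`, which makes it an involution on all half-edges. -/
noncomputable def contractedOpp (L : ℕ) (z : O) : O :=
  if A.Inner z then A.twin z else A.chainEnd L z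

/-- Chains of more than `L` inner half-edges belong to cycles of two nodes. -/
def HasShortChains (L : ℕ) : Prop :=
  ∀ y, (∀ i ≤ L, A.Inner (A.next^[i] y)) → ∃ i ≤ L, A.InTwoCycle (A.next^[i] y)

variable {A} {L : ℕ}

theorem InTwoCycle.twin {z : O} (h : A.InTwoCycle z) : A.InTwoCycle (A.twin z) := by
  obtain ⟨hz, hmate, hcomm⟩ := h
  exact ⟨(A.inner_twin z).2 hz, by rwa [hcomm, A.inner_twin],
    by rw [A.twin_twin, hcomm, A.twin_twin]⟩

theorem InTwoCycle.mate {z : O} (h : A.InTwoCycle z) : A.InTwoCycle (A.mate z) := by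
  obtain ⟨hz, hmate, hcomm⟩ := h
  exact ⟨hmate, by rwa [A.mate_mate], by rw [A.mate_mate, ← hcomm, A.mate_mate]⟩

theorem inTwoCycle_twin {z : O} : A.InTwoCycle (A.twin z) ↔ A.InTwoCycle z :=
  ⟨fun h => by simpa only [A.twin_twin] using h.twin, InTwoCycle.twin⟩

theorem inTwoCycle_mate {z : O} : A.InTwoCycle (A.mate z) ↔ A.InTwoCycle z :=
  ⟨fun h => by simpa only [A.mate_mate] using h.mate, InTwoCycle.mate⟩

theorem inTwoCycle_next_iterate {z : O} (n : ℕ) :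
    A.InTwoCycle (A.next^[n] z) ↔ A.InTwoCycle z := by
  induction n with
  | zero => rfl
  | succ n ih => rw [Function.iterate_succ_apply', next, inTwoCycle_mate, inTwoCycle_twin, ih]

theorem twin_mate_next (z : O) : A.twin (A.mate (A.next z)) = z := by
  rw [next, A.mate_mate, A.twin_twin]

theorem next_iterate_mate_next_iterate (n : ℕ) (z : O) :
    A.next^[n] (A.mate (A.next^[n] (A.mate z))) = z := by
  induction n generalizing z with
  | zero => exact A.mate_mate z
  | succ n ih =>
    rw [Function.iterate_succ_apply' _ _ (A.mate z), Function.iterate_succ_apply, next,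
      twin_mate_next]
    exact ih z

theorem inner_next_iterate_mate {n i : ℕ} {z : O} (h : ∀ i < n, A.Inner (A.next^[i] (A.mate z)))
    (hi : i < n) : A.Inner (A.next^[i] (A.mate (A.next^[n] (A.mate z)))) := by
  obtain ⟨l, rfl⟩ := Nat.exists_eq_add_of_lt hi
  have hreverse := next_iterate_mate_next_iterate (A := A) i (A.mate (A.next^[l + 1] (A.mate z)))
  rw [A.mate_mate, ← Function.iterate_add_apply] at hreverse
  rw [add_assoc, hreverse, Function.iterate_succ_apply', next, A.mate_mate, A.inner_twin]
  exact h l (by omega)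

theorem next_iterate_mate_ne (n : ℕ) (z : O) : A.next^[n] (A.mate z) ≠ z := by
  induction n using Nat.twoStepInduction generalizing z with
  | zero => exact A.mate_ne z
  | one =>
    intro h
    change A.mate (A.twin (A.mate z)) = z at h
    exact A.twin_ne (A.mate z) (by rw [← A.mate_mate (A.twin (A.mate z)), h])
  | more n ih _ =>
    intro h
    apply ih (A.twin (A.mate z))
    rw [Function.iterate_succ_apply', Function.iterate_succ_apply] at h
    conv_rhs => rw [← h]
    rw [twin_mate_next]
    rfl

theorem not_inner_chainEnd (hA : A.HasShortChains L) {z : O} (hz : ¬ A.InTwoCycle z) :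
    ¬ A.Inner (A.chainEnd L z) := by
  intro hend
  obtain ⟨m, -, -, hlt, hlast⟩ := exists_walk_eq_iterate (f := A.next) (p := A.Inner) (L + 1)
    (A.mate z)
  obtain rfl := hlast hend
  obtain ⟨i, -, hi⟩ := hA (A.mate z) fun i hi => hlt i (by omega)
  exact hz (inTwoCycle_mate.1 ((inTwoCycle_next_iterate i).1 hi))

theorem exists_chainEnd_eq (hA : A.HasShortChains L) {z : O} (hz : ¬ A.InTwoCycle z) :
    ∃ m, A.chainEnd L z = A.next^[m] (A.mate z) ∧ (∀ i < m, A.Inner (A.next^[i] (A.mate z))) ∧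
      ¬ A.Inner (A.next^[m] (A.mate z)) := by
  obtain ⟨m, -, heq, hlt, -⟩ := exists_walk_eq_iterate (f := A.next) (p := A.Inner) (L + 1)
    (A.mate z)
  exact ⟨m, heq, hlt, heq ▸ not_inner_chainEnd hA hz⟩

theorem not_inTwoCycle_of_not_inner {z : O} (hz : ¬ A.Inner z) : ¬ A.InTwoCycle z :=
  fun h => hz h.1

theorem chainEnd_mate {z : O} (hz : ¬ A.Inner z) : A.chainEnd L (A.mate z) = z := by
  rw [chainEnd, A.mate_mate, walk_of_not hz]

/-- Walking back from the end of the chain of `z`, one passes `z` and continues to the end of the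
chain in the other direction. -/
theorem chainEnd_chainEnd (hA : A.HasShortChains L) {z : O} (hz : ¬ A.InTwoCycle z) :
    A.chainEnd L (A.chainEnd L z) = A.chainEnd L (A.mate z) := by
  obtain ⟨n, hn, hn_lt, -⟩ := exists_chainEnd_eq hA hz
  obtain ⟨m, hm, hm_lt, hm_end⟩ := exists_chainEnd_eq hA (inTwoCycle_mate.not.2 hz)
  rw [A.mate_mate] at hm hm_lt hm_end
  have hback : ∀ i, A.next^[n + i] (A.mate (A.chainEnd L z)) = A.next^[i] z := fun i => by
    rw [add_comm, Function.iterate_add_apply, hn, next_iterate_mate_next_iterate]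
  rw [hm, ← hback]
  refine walk_eq_iterate
    (not_inner_chainEnd hA (not_inTwoCycle_of_not_inner (not_inner_chainEnd hA hz)))
    (fun i hi => ?_) (by rwa [hback])
  rcases lt_or_ge i n with hin | hin
  · rw [hn]
    exact inner_next_iterate_mate hn_lt hin
  · obtain ⟨l, rfl⟩ := Nat.exists_eq_add_of_le hin
    rw [hback]
    exact hm_lt l (by omega)

theorem chainEnd_chainEnd_of_not_inner (hA : A.HasShortChains L) {z : O} (hz : ¬ A.Inner z) :
    A.chainEnd L (A.chainEnd L z) = z := by
  rw [chainEnd_chainEnd hA (not_inTwoCycle_of_not_inner hz), chainEnd_mate hz]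

theorem chainEnd_twin (hA : A.HasShortChains L) {z : O} (hz : A.Inner z) (hcyc : ¬ A.InTwoCycle z) :
    A.chainEnd L (A.twin z) = A.chainEnd L (A.mate z) := by
  obtain ⟨m, hm, hm_lt, hm_end⟩ := exists_chainEnd_eq hA (inTwoCycle_twin.not.2 hcyc)
  have hend := not_inner_chainEnd hA (inTwoCycle_mate.not.2 hcyc)
  rw [chainEnd, A.mate_mate] at hend
  rw [hm, chainEnd, A.mate_mate]
  refine (walk_eq_iterate (m := m + 1) hend ?_ hm_end).symm
  rintro (_ | i) hi
  exacts [hz, hm_lt i (by omega)]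

theorem chainEnd_ne (hA : A.HasShortChains L) {z : O} (hz : ¬ A.Inner z) : A.chainEnd L z ≠ z := by
  obtain ⟨n, hn, -⟩ := exists_chainEnd_eq hA (not_inTwoCycle_of_not_inner hz)
  exact hn ▸ next_iterate_mate_ne n z

theorem contractedOpp_of_not_inner {z : O} (hz : ¬ A.Inner z) :
    A.contractedOpp L z = A.chainEnd L z := if_neg hz

theorem contractedOpp_contractedOpp (hA : A.HasShortChains L) (z : O) :
    A.contractedOpp L (A.contractedOpp L z) = z := by
  by_cases h : A.Inner z
  · simp [contractedOpp, h, A.inner_twin, A.twin_twin]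
  · simp [contractedOpp, h, not_inner_chainEnd hA (not_inTwoCycle_of_not_inner h),
      chainEnd_chainEnd_of_not_inner hA h]

theorem contractedOpp_ne (hA : A.HasShortChains L) (z : O) : A.contractedOpp L z ≠ z := by
  by_cases h : A.Inner z
  · simp [contractedOpp, h, A.twin_ne]
  · simpa [contractedOpp, h] using chainEnd_ne hA h

/-- Extends an orientation `x` of the contracted edges to their chains. The cycles of two nodes do
not belong to contracted edges; they are directed so that the half-edge with the smallest key and
the half-edge two steps further are outgoing. -/
def expand (A : Pairing O) (L : ℕ) (x : O → Prop) (key : O → ℕ) (z : O) : Prop :=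
  A.InTwoCycle z ∧ min (key z) (key (A.twin (A.mate z))) <
      min (key (A.twin z)) (key (A.mate z)) ∨
    ¬ A.InTwoCycle z ∧ ¬ x (A.chainEnd L z)

section Expand
variable {x : O → Prop} {key : O → ℕ}

theorem expand_of_not_inTwoCycle {z : O} (h : ¬ A.InTwoCycle z) :
    A.expand L x key z ↔ ¬ x (A.chainEnd L z) := by
  simp [expand, h]

theorem expand_of_inTwoCycle {z : O} (h : A.InTwoCycle z) : A.expand L x key z ↔
    min (key z) (key (A.twin (A.mate z))) < min (key (A.twin z)) (key (A.mate z)) := by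
  simp [expand, h]

theorem InTwoCycle.min_key_ne (hkey : Function.Injective key) {z : O} (h : A.InTwoCycle z) :
    min (key z) (key (A.twin (A.mate z))) ≠ min (key (A.twin z)) (key (A.mate z)) := by
  have htwin := hkey.ne (A.twin_ne z)
  have hmate := hkey.ne (A.mate_ne z)
  have htwin_mate := hkey.ne (A.twin_ne (A.mate z))
  have hopposite : key (A.twin (A.mate z)) ≠ key (A.twin z) := h.2.2 ▸ hkey.ne (A.mate_ne _)
  omega

theorem expand_mate (hA : A.HasShortChains L) (hx : ∀ z, x (A.contractedOpp L z) ↔ ¬ x z)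
    (hkey : Function.Injective key) (z : O) :
    A.expand L x key (A.mate z) ↔ ¬ A.expand L x key z := by
  by_cases h : A.InTwoCycle z
  · have hne := h.min_key_ne hkey
    rw [expand_of_inTwoCycle h, expand_of_inTwoCycle h.mate, A.mate_mate,
      min_comm (key (A.mate z)), min_comm (key (A.twin (A.mate z)))]
    omega
  · rw [expand_of_not_inTwoCycle h, expand_of_not_inTwoCycle (inTwoCycle_mate.not.2 h),
      ← chainEnd_chainEnd hA h, ← contractedOpp_of_not_inner (not_inner_chainEnd hA h), hx]

theorem expand_twin (hA : A.HasShortChains L) (hx : ∀ z, x (A.contractedOpp L z) ↔ ¬ x z)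
    (hkey : Function.Injective key) {z : O} (hz : A.Inner z) :
    A.expand L x key (A.twin z) ↔ ¬ A.expand L x key z := by
  by_cases h : A.InTwoCycle z
  · have hne := h.min_key_ne hkey
    rw [expand_of_inTwoCycle h, expand_of_inTwoCycle h.twin, A.twin_twin, h.2.2, A.twin_twin]
    omega
  · rw [← expand_mate hA hx hkey, expand_of_not_inTwoCycle (inTwoCycle_twin.not.2 h),
      expand_of_not_inTwoCycle (inTwoCycle_mate.not.2 h), chainEnd_twin hA hz h]

theorem expand_of_not_inner (hx : ∀ z, x (A.contractedOpp L z) ↔ ¬ x z) {z : O}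
    (hz : ¬ A.Inner z) : A.expand L x key z ↔ x z := by
  rw [expand_of_not_inTwoCycle (not_inTwoCycle_of_not_inner hz), ← contractedOpp_of_not_inner hz,
    hx, not_not]

end Expand

end Pairing

/-! ### Trails through pairs of ports -/

section TripleGraph
variable {O : Type*} {st : Fin 2 → O → O} {M : O → Prop}

/-- The element `m`, followed by its two neighbours `st 0 m` and `st 1 m`. -/
def triple (st : Fin 2 → O → O) (m : O) : Fin 3 → O := Fin.cons m fun s => st s m

/-- The element `m` is selected by `M`, and it has two different neighbours other than itself. -/
def IsCenter (st : Fin 2 → O → O) (M : O → Prop) (m : O) : Prop :=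
  M m ∧ Function.Injective (triple st m)

/-- The graph whose nodes are the triples of the centers, with the elements of a triple as its three
half-edges. The nodes are represented by their centers. -/
noncomputable def tripleGraph (opp : O → O) (st : Fin 2 → O → O) (M : O → Prop) :
    HalfEdgeGraph O where
  opp := opp
  Attached y := ∃ i, IsCenter st M (triple st y i)
  node y := triple st y (Classical.epsilon fun i => IsCenter st M (triple st y i))
  IsNode := IsCenter st M
  half i m := triple st m i

theorem stepReach_one_iff {x y : O} : StepReach st 1 x y ↔ ∃ i, triple st x i = y := by
  simp only [StepReach, triple, Fin.exists_fin_succ, Fin.cons_zero, Fin.cons_succ, eq_comm]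

theorem exists_triple_eq_symm (hst : StepSymm st) {x y : O} (h : ∃ i, triple st x i = y) :
    ∃ i, triple st y i = x :=
  stepReach_one_iff.1 ((stepReach_one_iff.2 h).symm hst)

theorem tripleGraph_cubic {opp : O → O} (hopp : ∀ y, opp (opp y) = y) (hne : ∀ y, opp y ≠ y)
    (hst : StepSymm st) (hM : ∀ x y, M x → M y → StepReach st 3 x y → x = y) :
    (tripleGraph opp st M).Cubic := by
  have attached_half (w : O) (i : Fin 3) (hw : IsCenter st M w) :
      (tripleGraph opp st M).Attached (triple st w i) :=
    let ⟨j, hj⟩ := exists_triple_eq_symm hst ⟨i, rfl⟩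
    ⟨j, hj.symm ▸ hw⟩
  have isNode_node (h : O) (hatt : (tripleGraph opp st M).Attached h) :
      IsCenter st M ((tripleGraph opp st M).node h) := Classical.epsilon_spec hatt
  refine ⟨hopp, hne, fun w hw => hw.2, attached_half, fun w i hw => ?_, isNode_node,
    fun h _ => exists_triple_eq_symm hst ⟨_, rfl⟩⟩
  have hreach : StepReach st 2 w ((tripleGraph opp st M).node (triple st w i)) :=
    (stepReach_one_iff.2 ⟨i, rfl⟩).trans (stepReach_one_iff.2 ⟨_, rfl⟩)
  exact (hM _ _ hw.1 (isNode_node _ (attached_half w i hw)).1 (hreach.mono (by decide))).symm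

end TripleGraph

/-- Exchanges `2 * j` and `2 * j + 1`. -/
def flipParity (i : ℕ) : ℕ := if i % 2 = 0 then i + 1 else i - 1

theorem flipParity_flipParity (i : ℕ) : flipParity (flipParity i) = i := by
  unfold flipParity; split_ifs <;> omega

theorem flipParity_ne (i : ℕ) : flipParity i ≠ i := by
  unfold flipParity; split_ifs <;> omega

theorem flipParity_div_two (i : ℕ) : flipParity i / 2 = i / 2 := by
  unfold flipParity; split_ifs <;> omega

theorem flipParity_mod_two_ne (i : ℕ) : flipParity i % 2 ≠ i % 2 := by
  unfold flipParity; split_ifs <;> omega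

theorem flipParity_lt_four {i : ℕ} : flipParity i < 4 ↔ i < 4 := by
  unfold flipParity; split_ifs <;> omega

theorem eq_or_eq_flipParity {i j : ℕ} (h : i / 2 = j / 2) : i = j ∨ i = flipParity j := by
  unfold flipParity; split_ifs <;> omega

namespace Network
variable {V : Type} (N : Network V)

open Classical in
/-- The other half of the edge of the half-edge `z`. To obtain an involution without fixed points,
the slots of a node that are not ports are grouped in pairs. -/
noncomputable def mate (z : V × ℕ) : V × ℕ :=
  if z.2 < N.deg z.1 then N.neighbor z.1 z.2
  else (z.1, N.deg z.1 + flipParity (z.2 - N.deg z.1))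

/-- The other half-edge in the pair of `z`. -/
def twin (z : V × ℕ) : V × ℕ := (z.1, flipParity z.2)

/-- The node requires two outgoing edges. -/
def Active (v : V) : Prop := 5 ≤ N.deg v

/-- The half-edge `z` is one of the first four of an active node; these form two pairs. -/
def OnTrail (z : V × ℕ) : Prop := N.Active z.1 ∧ z.2 < 4

/-- The pair of a half-edge: `(v, j)` stands for the half-edges `2 * j` and `2 * j + 1` of `v`. -/
def pairOf (z : V × ℕ) : V × ℕ := (z.1, z.2 / 2)

/-- The position of a half-edge in its pair. -/
def side (z : V × ℕ) : Fin 2 := ⟨z.2 % 2, Nat.mod_lt _ two_pos⟩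

/-- The half-edge at position `s` in the pair `y`. -/
def port (y : V × ℕ) (s : Fin 2) : V × ℕ := (y.1, 2 * y.2 + s)

open Classical in
/-- The step from the pair `y` along the edge of its half-edge `s`, if it leads to a pair again. -/
noncomputable def trail (s : Fin 2) (y : V × ℕ) : V × ℕ :=
  if N.OnTrail (port y s) ∧ N.OnTrail (N.mate (port y s)) then pairOf (N.mate (port y s)) else y

theorem mate_mate (z : V × ℕ) : N.mate (N.mate z) = z := by
  by_cases h : z.2 < N.deg z.1
  · have hmate : N.mate z = N.neighbor z.1 z.2 := if_pos h
    rw [hmate, mate, if_pos (neighbor_snd_lt h), neighbor_neighbor h]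
  · have hmate : N.mate z = (z.1, N.deg z.1 + flipParity (z.2 - N.deg z.1)) := if_neg h
    rw [hmate, mate, if_neg (Nat.not_lt.2 (Nat.le_add_right _ _))]
    refine Prod.ext rfl ?_
    simp only [Nat.add_sub_cancel_left, flipParity_flipParity]
    omega

theorem neighbor_ne {v : V} {i : ℕ} (h : i < N.deg v) : N.neighbor v i ≠ (v, i) := by
  rw [neighbor_of_lt h]
  intro heq
  have hne := N.opp_ne ⟨v, i, h⟩
  generalize N.opp ⟨v, i, h⟩ = q at heq hne
  obtain ⟨u, j⟩ := q
  obtain ⟨rfl, hj⟩ := Prod.mk.inj heq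
  exact hne (congrArg (Sigma.mk u) (Fin.ext hj))

theorem mate_ne (z : V × ℕ) : N.mate z ≠ z := by
  by_cases h : z.2 < N.deg z.1
  · rw [mate, if_pos h]
    exact N.neighbor_ne h
  · rw [mate, if_neg h]
    intro heq
    have hsnd : N.deg z.1 + flipParity (z.2 - N.deg z.1) = z.2 := congrArg Prod.snd heq
    exact flipParity_ne (z.2 - N.deg z.1) (by omega)

theorem twin_twin (z : V × ℕ) : twin (twin z) = z := Prod.ext rfl (flipParity_flipParity _)

theorem twin_ne (z : V × ℕ) : twin z ≠ z := fun h => flipParity_ne _ (congrArg Prod.snd h)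

theorem pairOf_twin (z : V × ℕ) : pairOf (twin z) = pairOf z :=
  Prod.ext rfl (flipParity_div_two _)

theorem side_twin_ne (z : V × ℕ) : side (twin z) ≠ side z :=
  fun h => flipParity_mod_two_ne z.2 (congrArg Fin.val h)

theorem port_pairOf (z : V × ℕ) : port (pairOf z) (side z) = z :=
  Prod.ext rfl (Nat.div_add_mod z.2 2)

theorem pairOf_port (y : V × ℕ) (s : Fin 2) : pairOf (port y s) = y :=
  Prod.ext rfl (by simp only [pairOf, port]; omega)

theorem eq_or_eq_twin_of_pairOf_eq {z z' : V × ℕ} (h : pairOf z = pairOf z') :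
    z = z' ∨ z = twin z' := by
  obtain ⟨hnode, hindex⟩ := Prod.mk.inj h
  exact (eq_or_eq_flipParity hindex).imp (Prod.ext hnode) (Prod.ext hnode)

variable {N}

theorem onTrail_twin {z : V × ℕ} : N.OnTrail (twin z) ↔ N.OnTrail z :=
  and_congr_right fun _ => flipParity_lt_four

theorem trail_pairOf {z : V × ℕ} (hz : N.OnTrail z) (hmate : N.OnTrail (N.mate z)) :
    N.trail (side z) (pairOf z) = pairOf (N.mate z) := by
  rw [trail, port_pairOf, if_pos ⟨hz, hmate⟩]

theorem onTrail_of_trail_ne {s : Fin 2} {y : V × ℕ} (h : N.trail s y ≠ y) :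
    N.OnTrail (port y s) ∧ N.OnTrail (N.mate (port y s)) :=
  by_contra fun hnot => h (if_neg hnot)

theorem trail_of_onTrail {s : Fin 2} {y : V × ℕ}
    (h : N.OnTrail (port y s) ∧ N.OnTrail (N.mate (port y s))) :
    N.trail s y = pairOf (N.mate (port y s)) := if_pos h

theorem trail_symm : StepSymm N.trail := by
  intro s y hne
  have h := onTrail_of_trail_ne hne
  refine ⟨side (N.mate (port y s)), ?_⟩
  rw [trail_of_onTrail h, trail_pairOf h.2 (by rw [N.mate_mate]; exact h.1), N.mate_mate,
    pairOf_port]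

theorem trail_movesIndexLtTwo : MovesIndexLtTwo N.trail := by
  intro s y hne
  have h := onTrail_of_trail_ne hne
  have hport : 2 * y.2 + s < 4 := h.1.2
  have hmate := h.2.2
  rw [trail_of_onTrail h]
  simp only [pairOf]
  omega

/-- The nodes of this graph are the groups of three consecutive pairs along a trail with the middle
pair in `M`. Its edges join the two pairs of a node of the network. -/
noncomputable def trailGraph (N : Network V) (M : V × ℕ → Prop) : HalfEdgeGraph (V × ℕ) :=
  tripleGraph twin N.trail M

theorem trailGraph_cubic {M : V × ℕ → Prop}
    (hM : ∀ x y, M x → M y → StepReach N.trail 3 x y → x = y) : (N.trailGraph M).Cubic :=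
  tripleGraph_cubic twin_twin twin_ne trail_symm hM

/-- The half-edges of the network, where the pairs in `X` are detached from their trails: only the
other pairs are to be contracted. -/
noncomputable def pairing (N : Network V) (X : V × ℕ → Prop) : Pairing (V × ℕ) where
  mate := N.mate
  twin := twin
  Inner z := N.OnTrail z ∧ ¬ X (pairOf z)
  mate_mate := N.mate_mate
  mate_ne := N.mate_ne
  twin_twin := twin_twin
  twin_ne := twin_ne
  inner_twin z := by rw [onTrail_twin, pairOf_twin]

section Chains
variable {X M : V × ℕ → Prop} {y z : V × ℕ}

theorem trail_pairOf_next (hz : N.OnTrail z) (hnext : N.OnTrail ((N.pairing X).next z)) :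
    N.trail (side (twin z)) (pairOf z) = pairOf ((N.pairing X).next z) := by
  rw [← pairOf_twin]
  exact trail_pairOf (onTrail_twin.2 hz) hnext

theorem trail_pairOf_prev (hz : N.OnTrail z) (hnext : N.OnTrail ((N.pairing X).next z)) :
    N.trail (side ((N.pairing X).next z)) (pairOf ((N.pairing X).next z)) = pairOf z := by
  have hmate : N.mate ((N.pairing X).next z) = twin z := N.mate_mate _
  rw [trail_pairOf hnext (by rw [hmate]; exact onTrail_twin.2 hz), hmate, pairOf_twin]

theorem triple_trail_pairOf (hz : N.OnTrail z) (hnext : N.OnTrail ((N.pairing X).next z))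
    (hnext₂ : N.OnTrail ((N.pairing X).next ((N.pairing X).next z))) :
    triple N.trail (pairOf ((N.pairing X).next z)) =
        ![pairOf ((N.pairing X).next z), pairOf z,
          pairOf ((N.pairing X).next ((N.pairing X).next z))] ∨
      triple N.trail (pairOf ((N.pairing X).next z)) =
        ![pairOf ((N.pairing X).next z), pairOf ((N.pairing X).next ((N.pairing X).next z)),
          pairOf z] := by
  have hprev := trail_pairOf_prev hz hnext
  have hsucc := trail_pairOf_next hnext hnext₂
  have hside := side_twin_ne ((N.pairing X).next z)
  generalize side ((N.pairing X).next z) = s at *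
  generalize side (twin ((N.pairing X).next z)) = s' at *
  obtain ⟨rfl, rfl⟩ | ⟨rfl, rfl⟩ : s = 0 ∧ s' = 1 ∨ s = 1 ∧ s' = 0 := by omega
  · refine .inl (funext fun i => ?_)
    fin_cases i
    exacts [rfl, hprev, hsucc]
  · refine .inr (funext fun i => ?_)
    fin_cases i
    exacts [rfl, hsucc, hprev]

theorem next_eq_of_pairOf_next_eq (h : pairOf ((N.pairing X).next z) = pairOf z) :
    (N.pairing X).next z = z :=
  (eq_or_eq_twin_of_pairOf_eq h).resolve_right (N.mate_ne _)

theorem next_next_eq_of_not_injective_triple (hz : N.OnTrail z)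
    (hnext : N.OnTrail ((N.pairing X).next z))
    (hnext₂ : N.OnTrail ((N.pairing X).next ((N.pairing X).next z)))
    (h : ¬ Function.Injective (triple N.trail (pairOf ((N.pairing X).next z)))) :
    (N.pairing X).next ((N.pairing X).next z) = z := by
  set A := N.pairing X
  have hcoincide : pairOf (A.next z) = pairOf z ∨ pairOf (A.next (A.next z)) = pairOf (A.next z) ∨
      pairOf (A.next (A.next z)) = pairOf z := by
    by_contra! hne
    have injective_vec {a b c : V × ℕ} (hab : a ≠ b) (hac : a ≠ c) (hbc : b ≠ c) :
        Function.Injective ![a, b, c] := by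
      intro i j hij
      fin_cases i <;> fin_cases j <;> simp_all
    rcases triple_trail_pairOf hz hnext hnext₂ with heq | heq <;>
      refine h (heq ▸ injective_vec ?_ ?_ ?_)
    exacts [hne.1, hne.2.1.symm, hne.2.2.symm, hne.2.1.symm, hne.1, hne.2.2]
  have hinj : Function.Injective A.next := fun a b hab => by
    rw [← A.twin_mate_next a, hab, A.twin_mate_next]
  rcases hcoincide with heq | heq | heq
  · rw [next_eq_of_pairOf_next_eq heq, next_eq_of_pairOf_next_eq heq]
  · rw [next_eq_of_pairOf_next_eq heq, hinj (next_eq_of_pairOf_next_eq heq)]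
  · refine (eq_or_eq_twin_of_pairOf_eq heq).resolve_right fun htwin => twin_ne (A.next z) ?_
    have hmate : N.mate (A.next z) = twin z := N.mate_mate _
    calc twin (A.next z) = N.mate (A.next (A.next z)) := (N.mate_mate _).symm
      _ = A.next z := by rw [htwin, ← hmate, N.mate_mate]

theorem inTwoCycle_next (hz : (N.pairing X).Inner z)
    (hnext : (N.pairing X).Inner ((N.pairing X).next z))
    (h : (N.pairing X).next ((N.pairing X).next z) = z) :
    (N.pairing X).InTwoCycle ((N.pairing X).next z) := by
  have hmate : (N.pairing X).mate ((N.pairing X).next z) = (N.pairing X).twin z := N.mate_mate _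
  refine ⟨hnext, ?_, ?_⟩
  · rw [hmate]
    exact ((N.pairing X).inner_twin z).2 hz
  · rw [(N.pairing X).twin_mate_next]
    exact h

theorem exists_pairOf_iterate_of_stepReach {n : ℕ}
    (hy : ∀ i ≤ n, N.OnTrail ((N.pairing X).next^[i] y)) {d i : ℕ} {m : V × ℕ} (hdi : d < i)
    (hin : i + d < n) (hm : StepReach N.trail d (pairOf ((N.pairing X).next^[i] y)) m) :
    ∃ l, 0 < l ∧ l < n ∧ m = pairOf ((N.pairing X).next^[l] y) := by
  induction d generalizing i with
  | zero => exact ⟨i, hdi, hin, hm⟩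
  | succ d ih =>
    rcases hm with hm | ⟨s, hm⟩
    · exact ih (by omega) (by omega) hm
    obtain ⟨i, rfl⟩ := Nat.exists_eq_add_one_of_ne_zero (show i ≠ 0 by omega)
    have hnext (j : ℕ) :
        (N.pairing X).next^[j + 1] y = (N.pairing X).next ((N.pairing X).next^[j] y) :=
      Function.iterate_succ_apply' _ _ _
    have htriple := triple_trail_pairOf (X := X) (hy i (by omega))
      (by rw [← hnext]; exact hy (i + 1) (by omega))
      (by rw [← hnext, ← hnext]; exact hy (i + 2) (by omega))
    rw [← hnext, ← hnext] at htriple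
    have hs : N.trail s (pairOf ((N.pairing X).next^[i + 1] y)) =
          pairOf ((N.pairing X).next^[i] y) ∨
        N.trail s (pairOf ((N.pairing X).next^[i + 1] y)) =
          pairOf ((N.pairing X).next^[i + 2] y) := by
      rcases htriple with heq | heq <;> have := congrFun heq s.succ <;> fin_cases s <;>
        first | exact .inl this | exact .inr this
    rcases hs with hs | hs
    · exact ih (by omega) (by omega) (hs ▸ hm)
    · exact ih (by omega) (by omega) (hs ▸ hm)

theorem hasShortChains_pairing {D : ℕ} (hdom : ∀ y, ∃ m, M m ∧ StepReach N.trail D y m)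
    (hX : ∀ m, IsCenter N.trail M m → ∃ i, X (triple N.trail m i)) :
    (N.pairing X).HasShortChains (2 * D + 2) := by
  intro y hy
  obtain ⟨m, hm, hreach⟩ := hdom (pairOf ((N.pairing X).next^[D + 1] y))
  obtain ⟨l, hpos, hlt, rfl⟩ :=
    exists_pairOf_iterate_of_stepReach (fun i hi => (hy i hi).1) (by omega) (by omega) hreach
  obtain ⟨l, rfl⟩ := Nat.exists_eq_add_one_of_ne_zero hpos.ne'
  have hprev := hy l (by omega)
  have hmid := hy (l + 1) (by omega)
  have hsucc := hy (l + 2) (by omega)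
  refine ⟨l + 1, by omega, ?_⟩
  simp only [Function.iterate_succ_apply'] at hm hmid hsucc ⊢
  refine inTwoCycle_next hprev hmid
    (next_next_eq_of_not_injective_triple hprev.1 hmid.1 hsucc.1 fun hinj => ?_)
  obtain ⟨i, hi⟩ := hX _ ⟨hm, hinj⟩
  rcases triple_trail_pairOf hprev.1 hmid.1 hsucc.1 with heq | heq <;> rw [heq] at hi <;>
    fin_cases i
  exacts [hmid.2 hi, hprev.2 hi, hsucc.2 hi, hmid.2 hi, hsucc.2 hi, hprev.2 hi]

end Chains

open Classical in
/-- The first half-edge of the pair of `v` that belongs to `X`, if there is exactly one. -/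
noncomputable def detachedPort (X : V × ℕ → Prop) (v : V) : ℕ := if X (v, 0) then 0 else 2

/-- The graph whose edges are the contracted chains. The half-edges of an active node are its port
`4` and the two ports of its detached pair; the node `v` is represented by `(v, 0)`. -/
noncomputable def chainGraph (N : Network V) (X : V × ℕ → Prop) (L : ℕ) :
    HalfEdgeGraph (V × ℕ) where
  opp := (N.pairing X).contractedOpp L
  Attached z := N.Active z.1 ∧ z.2 < 5 ∧ ¬ (N.pairing X).Inner z
  node z := (z.1, 0)
  IsNode w := N.Active w.1 ∧ w.2 = 0
  half i w := (w.1, ![4, detachedPort X w.1, detachedPort X w.1 + 1] i)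

theorem attached_chainGraph_iff {X : V × ℕ → Prop} (hX : ∀ v, X (v, 1) ↔ ¬ X (v, 0)) {L : ℕ}
    {z : V × ℕ} : (N.chainGraph X L).Attached z ↔
      N.Active z.1 ∧ ∃ i, ![4, detachedPort X z.1, detachedPort X z.1 + 1] i = z.2 := by
  obtain ⟨v, j⟩ := z
  specialize hX v
  refine and_congr_right fun hactive => ?_
  simp only [pairing, OnTrail, pairOf, Fin.exists_fin_succ, detachedPort] at hactive ⊢
  rcases lt_or_ge j 5 with hj | hj
  · interval_cases j <;> by_cases h : X (v, 0) <;> simp_all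
  · simp only [hj.not_gt, false_and, false_iff]
    split_ifs <;> simp <;> omega

theorem chainGraph_cubic {X : V × ℕ → Prop} (hX : ∀ v, X (v, 1) ↔ ¬ X (v, 0)) {L : ℕ}
    (hshort : (N.pairing X).HasShortChains L) : (N.chainGraph X L).Cubic where
  opp_opp := Pairing.contractedOpp_contractedOpp hshort
  opp_ne := Pairing.contractedOpp_ne hshort
  half_injective w _ i j hij := by
    have hindex := congrArg Prod.snd hij
    by_cases h : X (w.1, 0) <;> fin_cases i <;> fin_cases j <;>
      simp_all [chainGraph, detachedPort]
  attached_half w i hw := (attached_chainGraph_iff hX).2 ⟨hw.1, i, rfl⟩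
  node_half w i hw := Prod.ext rfl hw.2.symm
  isNode_node h hatt := ⟨hatt.1, rfl⟩
  exists_half_eq h hatt :=
    let ⟨i, hi⟩ := ((attached_chainGraph_iff hX).1 hatt).2
    ⟨i, Prod.ext rfl hi⟩

end Network

section PipelineLocality
variable {S : ℕ → Type} {k : ℕ} {g : ℕ → ℕ} {M X : ∀ I : Instance S k, I.Slot → Prop}

theorem IsLocal.active : IsLocal g fun (I : Instance S k) (x : I.Slot) => I.net.Active x.1 :=
  IsLocal.deg.map fun d => 5 ≤ d

theorem IsLocal.onTrail : IsLocal g fun (I : Instance S k) (x : I.Slot) => I.net.OnTrail x :=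
  IsLocal.active.and (IsLocal.index.map fun i => i < 4)

theorem IsLocalMap.twin : IsLocalMap g fun (I : Instance S k) => Network.twin (V := I.Node) :=
  .mapIndex (IsLocal.index.map flipParity)

theorem IsLocalMap.pairOf : IsLocalMap g fun (I : Instance S k) => Network.pairOf (V := I.Node) :=
  .mapIndex (IsLocal.index.map fun i => i / 2)

theorem IsLocalMap.mate (hg : ∀ n, 1 ≤ g n) : IsLocalMap g fun I : Instance S k => I.net.mate :=
  IsLocalMap.ite (IsLocal.index.map₂ (· < ·) IsLocal.deg) (.neighbor hg)
    (.mapIndex (IsLocal.deg.map₂ (fun d i => d + flipParity (i - d)) IsLocal.index))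

theorem IsLocalMap.trail (hg : ∀ n, 1 ≤ g n) (s : Fin 2) :
    IsLocalMap g fun I : Instance S k => I.net.trail s :=
  have hport : IsLocalMap g fun (I : Instance S k) (y : I.Slot) => Network.port y s :=
    .mapIndex (IsLocal.index.map fun i => 2 * i + s.val)
  have hmate : IsLocalMap g fun (I : Instance S k) (y : I.Slot) => I.net.mate (Network.port y s) :=
    (IsLocalMap.mate hg).comp hg hport
  IsLocalMap.ite ((IsLocal.onTrail.comp hg hport).and (IsLocal.onTrail.comp hg hmate))
    (IsLocalMap.pairOf.comp hg hmate) .id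

theorem IsLocalMap.triple {st : ∀ I : Instance S k, Fin 2 → I.Slot → I.Slot}
    (hst : ∀ s, IsLocalMap g fun I => st I s) (i : Fin 3) :
    IsLocalMap g fun I x => triple (st I) x i :=
  Fin.cases .id hst i

theorem HalfEdgeGraph.IsLocalGraph.trailGraph (hg : ∀ n, 1 ≤ g n) (hM : IsLocal g M) :
    HalfEdgeGraph.IsLocalGraph g fun I => I.net.trailGraph (M I) :=
  have htriple := IsLocalMap.triple (IsLocalMap.trail (S := S) (k := k) hg)
  have hcenter : IsLocal g fun I => IsCenter I.net.trail (M I) :=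
    hM.and <| (IsLocal.forall_finite fun i => IsLocal.forall_finite fun j =>
      ((htriple i).eq (htriple j)).imp (IsLocal.const (i = j)))
  have hcenters := IsLocal.pi fun i => hcenter.comp hg (htriple i)
  { opp := .twin
    attached := hcenters.map fun c : Fin 3 → Prop => ∃ i, c i
    node := .select (hcenters.map Classical.epsilon) htriple
    isNode := hcenter
    half := htriple }

theorem IsLocal.inner (hg : ∀ n, 1 ≤ g n) (hX : IsLocal g X) :
    IsLocal g fun I => (I.net.pairing (X I)).Inner :=
  IsLocal.onTrail.and (hX.comp hg .pairOf).not

theorem IsLocalMap.chainEnd (hg : ∀ n, 1 ≤ g n) (hX : IsLocal g X) (L : ℕ) :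
    IsLocalMap g fun I => (I.net.pairing (X I)).chainEnd L := by
  have hnext : IsLocalMap g fun I => (I.net.pairing (X I)).next :=
    (IsLocalMap.mate hg).comp hg .twin
  have hwalk (n : ℕ) :
      IsLocalMap g fun I => walk (I.net.pairing (X I)).next (I.net.pairing (X I)).Inner n := by
    induction n with
    | zero => exact .id
    | succ n ih => exact IsLocalMap.ite (IsLocal.inner hg hX) (ih.comp hg hnext) .id
  exact (hwalk (L + 1)).comp hg (.mate hg)

theorem IsLocal.expand (hg : ∀ n, 1 ≤ g n) (hX : IsLocal g X)
    {Y : ∀ I : Instance S k, I.Slot → Prop} (hY : IsLocal g Y) (L : ℕ) :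
    IsLocal g fun I => (I.net.pairing (X I)).expand L (Y I) fun z => tagKey (I.tag z) :=
  have hinner := IsLocal.inner hg hX
  have hmate := IsLocalMap.mate (S := S) (k := k) hg
  have htwin := IsLocalMap.twin (S := S) (k := k) (g := g)
  have hcycle : IsLocal g fun I => (I.net.pairing (X I)).InTwoCycle :=
    hinner.and ((hinner.comp hg hmate).and ((hmate.comp hg htwin).eq (htwin.comp hg hmate)))
  have hkey : IsLocal g fun (I : Instance S k) x => tagKey (I.tag x) := IsLocal.tag.map tagKey
  (hcycle.and (IsLocal.map₂ (· < ·) (hkey.map₂ min (hkey.comp hg (htwin.comp hg hmate)))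
    ((hkey.comp hg htwin).map₂ min (hkey.comp hg hmate)))).or
    (hcycle.not.and (hY.comp hg (.chainEnd hg hX L)).not)

theorem HalfEdgeGraph.IsLocalGraph.chainGraph (hg : ∀ n, 1 ≤ g n) (hX : IsLocal g X) (L : ℕ) :
    HalfEdgeGraph.IsLocalGraph g fun I => I.net.chainGraph (X I) L :=
  have hinner := IsLocal.inner hg hX
  have hport : IsLocal g fun I x => Network.detachedPort (X I) x.1 :=
    (hX.comp hg (.mapIndex (IsLocal.const 0))).ite (IsLocal.const 0) (IsLocal.const 2)
  { opp := IsLocalMap.ite hinner .twin (.chainEnd hg hX L)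
    attached := IsLocal.active.and ((IsLocal.index.map fun i => i < 5).and hinner.not)
    node := .mapIndex (IsLocal.const 0)
    isNode := IsLocal.active.and (IsLocal.index.map fun i => i = 0)
    half := fun i => .mapIndex (hport.map fun p => ![4, p, p + 1] i) }

end PipelineLocality

/-! ### Sinkless orientations from coins -/

namespace HalfEdgeGraph

/-- A sinkless orientation of a graph of half-edges, `x h` saying that `h` is outgoing. -/
def IsSinkless {O : Type*} (G : HalfEdgeGraph O) (x : O → Prop) : Prop :=
  (∀ h, x (G.opp h) ↔ ¬ x h) ∧ ∀ w, G.IsNode w → ∃ i, x (G.half i w)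

theorem Closed.node_eq {O : Type*} {G : HalfEdgeGraph O} {sp out : O → Prop} {T : Set O}
    {o : O → O} (hT : G.Closed sp out T o) {u : O} (hu : u ∈ T) : G.node (o u) = u := by
  obtain h | ⟨w, -, h, -⟩ := hT u hu
  exacts [h.node_eq, h.node_eq]

section CoinOrientation
variable {S : ℕ → Type} {k : ℕ} {g : ℕ → ℕ} {b : Prop}

/-- The nodes of a graph on the slots of an instance that propose special edges: those of a ruling
set if `b` is true, and none otherwise. -/
def Selected {I : Instance S k} (G : HalfEdgeGraph I.Slot) (g : ℕ → ℕ) (b : Prop) (x : I.Slot) :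
    Prop :=
  b ∧ IsRuling G.step 3 (idColor I.ident) (g I.size + k + 5) x

/-- The orientation that is agreed upon after the special edges have been oriented by the coins of
the nodes that proposed them. The radii within which proposals are made and collected are the
multiples of `g n` by `C` and `C'`. -/
noncomputable def coinOrientation {I : Instance S k} (G : HalfEdgeGraph I.Slot) (g : ℕ → ℕ)
    (b : Prop) (C C' : ℕ) (coin : I.Slot → Prop) : I.Slot → Prop :=
  G.orientation I (G.Special (G.Selected g b)) (G.CoinOut (G.Selected g b) coin) (C * g I.size)
    (C' * g I.size)

/-- The event that a node cannot be satisfied within its ball of radius `B * g n`. -/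
def Fails {I : Instance S k} (G : HalfEdgeGraph I.Slot) (g : ℕ → ℕ) (b : Prop) (B : ℕ)
    (coin : I.Slot → Prop) (c : I.Slot) : Prop :=
  G.IsNode c ∧
    G.Blocked (G.Special (G.Selected g b)) (G.CoinOut (G.Selected g b) coin) c (B * g I.size)

section Instance
variable {I : Instance S k} {G : HalfEdgeGraph I.Slot} {coin : I.Slot → Prop}

theorem Cubic.eq_of_selected (hG : G.Cubic) (x y : I.Slot) (hx : G.Selected g b x)
    (hy : G.Selected g b y) (h : StepReach G.step 3 x y) : x = y :=
  hx.2.eq_of_stepReach (step_symm hG) hy.2 h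

theorem coinOrientation_opp (hG : G.Cubic) {K C C' : ℕ}
    (hnode : ∀ h, I.net.Within K h.1 (G.node h).1) (hC : C * g I.size + K ≤ C' * g I.size)
    (h : I.Slot) :
    G.coinOrientation g b C C' coin (G.opp h) ↔ ¬ G.coinOrientation g b C C' coin h :=
  orientation_opp hG hnode hC (special_opp hG)
    (fun _ => coinOut_opp hG hG.eq_of_selected) h

theorem exists_coinOrientation_half (hG : G.Cubic) {K B C C' : ℕ}
    (hopp : ∀ h, I.net.Within K h.1 (G.opp h).1) (hnode : ∀ h, I.net.Within K h.1 (G.node h).1)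
    (hC : 3 * K * (B * g I.size) + K ≤ C * g I.size) {w : I.Slot} (hw : G.IsNode w)
    (hfails : ¬ G.Fails g b B coin w) : ∃ i, G.coinOrientation g b C C' coin (G.half i w) := by
  obtain ⟨o, hclosed⟩ : ∃ o, G.Closed (G.Special (G.Selected g b))
      (G.CoinOut (G.Selected g b) coin) (G.ball (G.Special (G.Selected g b)) w (B * g I.size)) o :=
    not_forall_not.1 fun hblocked => hfails ⟨hw, hblocked⟩
  refine exists_orientation_half hG hclosed center_mem_ball fun u hu => ?_
  have hback := (hnode (o u)).symm
  rw [hclosed.node_eq hu] at hback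
  exact ((within_of_mem_ball hnode hopp hu).trans hback).mono hC

end Instance

theorem IsLocalGraph.exists_within {G : ∀ I : Instance S k, HalfEdgeGraph I.Slot}
    (hG : IsLocalGraph g G) :
    ∃ K, ∀ (I : Instance S k) (h : I.Slot),
      I.net.Within K h.1 ((G I).opp h).1 ∧ I.net.Within K h.1 ((G I).node h).1 := by
  obtain ⟨K, hopp⟩ := hG.opp.exists_within
  obtain ⟨K', hnode⟩ := hG.node.exists_within
  exact ⟨max K K', fun I h =>
    ⟨(hopp I h).mono (le_max_left _ _), (hnode I h).mono (le_max_right _ _)⟩⟩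

theorem IsLocalGraph.selected {G : ∀ I : Instance S k, HalfEdgeGraph I.Slot}
    (hG : IsLocalGraph g G) (hg : ∀ n, 1 ≤ g n) : IsLocal g fun I => (G I).Selected g b :=
  (IsLocal.const b).and (IsLocal.isRuling hg (hG.step hg) 3)

theorem IsLocalGraph.exists_isSinkless_coinOrientation
    {G : ∀ I : Instance S k, HalfEdgeGraph I.Slot} (hG : IsLocalGraph g G) (hg : ∀ n, 1 ≤ g n)
    (b : Prop) (B : ℕ) {coin : ∀ I : Instance S k, I.Slot → Prop} (hcoin : IsLocal g coin) :
    ∃ C C', (IsLocal g fun I => (G I).coinOrientation g b C C' (coin I)) ∧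
      ∀ I : Instance S k, (G I).Cubic → (∀ c, ¬ (G I).Fails g b B (coin I) c) →
        (G I).IsSinkless ((G I).coinOrientation g b C C' (coin I)) := by
  obtain ⟨K, hK⟩ := hG.exists_within
  have hsel := hG.selected (b := b) hg
  refine ⟨3 * K * B + K, 3 * K * B + K + K,
    hG.orientation hg (hG.special hg hsel) (hG.coinOut hg hsel hcoin) _ _,
    fun I hcubic hfails => ?_⟩
  have hKg : K ≤ K * g I.size := Nat.le_mul_of_pos_right _ (hg _)
  exact ⟨coinOrientation_opp hcubic (fun h => (hK I h).2) (by rw [add_mul _ K]; lia), fun w hw =>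
    exists_coinOrientation_half hcubic (fun h => (hK I h).1) (fun h => (hK I h).2)
      (by rw [add_mul, mul_assoc _ B]; lia) hw (hfails w)⟩

end CoinOrientation

end HalfEdgeGraph

section Failures
variable {S : ℕ → Type} {k : ℕ} {g : ℕ → ℕ} {I : Instance S k} {G : HalfEdgeGraph I.Slot}
  {coin : I.Slot → Prop} {c : I.Slot}

/-- The slots that can be nodes of the auxiliary graphs. -/
def Instance.smallSlots (I : Instance S k) : Finset I.Slot := Finset.univ ×ˢ Finset.range 2

theorem Instance.mem_smallSlots {w : I.Slot} : w ∈ I.smallSlots ↔ w.2 < 2 := by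
  simp [smallSlots]

theorem Instance.card_smallSlots (I : Instance S k) : I.smallSlots.card = 2 * I.size := by
  rw [smallSlots, Finset.card_product, Finset.card_univ, Finset.card_range, mul_comm, size]

namespace HalfEdgeGraph

theorem not_fails_false (hG : G.Cubic) (hindex : ∀ w, G.IsNode w → w.2 < 2) {B : ℕ} (hB : 6 ≤ B)
    (hg : Nat.log 2 I.size + 1 ≤ g I.size) (c : I.Slot) : ¬ G.Fails g False B coin c := by
  rintro ⟨hc, hblocked⟩
  have hsel : G.Selected g False = fun _ => False := by
    funext x
    simp [Selected]
  rw [hsel, special_false] at hblocked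
  refine not_blocked_of_card_lt hG hc (fun w hw => Instance.mem_smallSlots.2 (hindex w hw))
    (j := Nat.log 2 I.size + 2) ?_ ?_ hblocked
  · have := Nat.mul_le_mul hB hg
    lia
  · have := Nat.lt_pow_succ_log_self one_lt_two I.size
    rw [I.card_smallSlots, pow_succ]
    lia

theorem step_movesIndexLtTwo (hG : G.Cubic) (hindex : ∀ w, G.IsNode w → w.2 < 2) :
    MovesIndexLtTwo G.step := by
  intro i w hw
  have hstep : G.IsNode w ∧ G.Attached (G.opp (G.half i w)) := by
    by_contra h
    exact hw (by rw [step, if_neg h])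
  refine ⟨hindex _ hstep.1, hindex _ ?_⟩
  rw [step, if_pos hstep]
  exact hG.isNode_node _ hstep.2

/-- Every slot reaches a node of the ruling set in `Selected` in this many steps. -/
noncomputable def selectedRadius : ℕ := 3 * numColors (Fin 3) 3

theorem Fails.le_card_touched {B e : ℕ} (hfails : G.Fails g True B coin c) (hG : G.Cubic)
    (hindex : ∀ w, G.IsNode w → w.2 < 2)
    (hg : Nat.log 2 (Fintype.card I.Node) + 1 ≤ 2 ^ g I.size)
    (hB : 2 * (g I.size + e + 1 + 2 * selectedRadius) + selectedRadius < B * g I.size) :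
    e * 2 ^ g I.size ≤
      (G.touched (G.Selected g True) I.smallSlots (B * g I.size) c).card := by
  have hdom : ∀ w, ∃ m, G.Selected g True m ∧ StepReach G.step selectedRadius w m := fun w => by
    obtain ⟨m, hm, hreach⟩ :=
      exists_isRuling_idColor I.isIdentifiers hg (step_movesIndexLtTwo hG hindex) 3 w
    exact ⟨m, ⟨trivial, hm⟩, hreach⟩
  have hcard := Blocked.two_pow_le_card_touched hG hG.eq_of_selected hfails.2
    (fun w hw => Instance.mem_smallSlots.2 (hindex w hw)) hfails.1 hdom hB
  have hpow : 2 ^ (g I.size + e + 1 + 2 * selectedRadius) =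
      4 ^ selectedRadius * (2 * (2 ^ e * 2 ^ g I.size)) := by
    rw [pow_add, pow_add, pow_add, pow_mul]
    norm_num
    ring
  rw [hpow] at hcard
  calc
    e * 2 ^ g I.size ≤ 2 ^ e * 2 ^ g I.size := Nat.mul_le_mul_right _ Nat.lt_two_pow_self.le
    _ ≤ _ := Nat.le_of_mul_le_mul_left (Nat.le_of_mul_le_mul_left hcard (by positivity)) two_pos

end HalfEdgeGraph

end Failures

/-! ### Two outgoing ports at every active node -/

namespace Network
variable {V : Type} {N : Network V}

/-- An orientation, given by the outgoing ports, that gives each active node two outgoing ports,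
and this even among its first five ports. -/
def IsTwoOutOrientation (N : Network V) (x : V × ℕ → Prop) : Prop :=
  (∀ z, x (N.mate z) ↔ ¬ x z) ∧
    ∀ v, N.Active v → ∃ i j, i ≠ j ∧ i < 5 ∧ j < 5 ∧ x (v, i) ∧ x (v, j)

theorem snd_lt_two_of_isCenter {M : V × ℕ → Prop} {m : V × ℕ} (hm : IsCenter N.trail M m) :
    m.2 < 2 := by
  have hne : N.trail 0 m ≠ m := fun h => absurd (@hm.2 1 0 h) (by decide)
  exact (trail_movesIndexLtTwo 0 m hne).1

variable {X Y : V × ℕ → Prop} {L : ℕ}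

theorem exists_inner_pairing (hX : ∀ v, X (v, 1) ↔ ¬ X (v, 0)) {v : V} (hv : N.Active v) :
    ∃ t, (N.pairing X).Inner (v, t) := by
  by_cases hx : X (v, 0)
  · exact ⟨2, ⟨hv, by norm_num⟩, by simpa [pairOf, hX] using hx⟩
  · exact ⟨0, ⟨hv, by norm_num⟩, by simpa [pairOf] using hx⟩

theorem isTwoOutOrientation_expand (hX : ∀ v, X (v, 1) ↔ ¬ X (v, 0))
    (hshort : (N.pairing X).HasShortChains L) (hY : (N.chainGraph X L).IsSinkless Y)
    {key : V × ℕ → ℕ} (hkey : key.Injective) :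
    N.IsTwoOutOrientation ((N.pairing X).expand L Y key) := by
  refine ⟨Pairing.expand_mate hshort hY.1 hkey, fun v hv => ?_⟩
  have hnode : (N.chainGraph X L).IsNode (v, 0) := ⟨hv, rfl⟩
  obtain ⟨s, hs⟩ := hY.2 _ hnode
  obtain ⟨-, hlt, houter⟩ := (chainGraph_cubic hX hshort).attached_half (v, 0) s hnode
  obtain ⟨t, ht⟩ := exists_inner_pairing hX hv
  obtain ⟨j, hj, hjout⟩ : ∃ j, (N.pairing X).Inner (v, j) ∧
      (N.pairing X).expand L Y key (v, j) := by
    by_cases h : (N.pairing X).expand L Y key (v, t)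
    · exact ⟨t, ht, h⟩
    · exact ⟨flipParity t, ((N.pairing X).inner_twin (v, t)).2 ht,
        (Pairing.expand_twin hshort hY.1 hkey ht).2 h⟩
  refine ⟨_, j, ?_, hlt, hj.1.2.trans (by norm_num),
    (Pairing.expand_of_not_inner hY.1 houter).2 hs, hjout⟩
  rintro rfl
  exact houter hj

end Network

section Pipeline
variable {S : ℕ → Type} {k : ℕ} {g : ℕ → ℕ}

/-- The auxiliary graph of the first stage, whose nodes are slots of a ruling set on the trails. -/
noncomputable def Instance.trailGraph (I : Instance S k) (g : ℕ → ℕ) : HalfEdgeGraph I.Slot :=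
  I.net.trailGraph (IsRuling I.net.trail 3 (idColor I.ident) (g I.size + k + 5))

/-- A bound for the length of the chains that remain after the first stage. -/
noncomputable def chainBound : ℕ := 2 * (3 * numColors (Fin 2) 3) + 2

/-- The auxiliary graph of the second stage, where the chains left by the sinkless orientation `X`
of the first one are contracted. -/
noncomputable def Instance.chainGraph (I : Instance S k) (X : I.Slot → Prop) :
    HalfEdgeGraph I.Slot :=
  I.net.chainGraph X chainBound

namespace Instance
variable (I : Instance S k) {X Y : I.Slot → Prop}

theorem trailGraph_cubic : (I.trailGraph g).Cubic :=
  Network.trailGraph_cubic fun _ _ hx hy h => hx.eq_of_stepReach Network.trail_symm hy h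

theorem snd_lt_two_of_isNode_trailGraph {w : I.Slot} (hw : (I.trailGraph g).IsNode w) : w.2 < 2 :=
  Network.snd_lt_two_of_isCenter hw

theorem snd_eq_zero_of_isNode_chainGraph {w : I.Slot} (hw : (I.chainGraph X).IsNode w) :
    w.2 = 0 :=
  hw.2

variable {I}

theorem hasShortChains_pairing (hg : Nat.log 2 (Fintype.card I.Node) + 1 ≤ 2 ^ g I.size)
    (hX : (I.trailGraph g).IsSinkless X) : (I.net.pairing X).HasShortChains chainBound :=
  Network.hasShortChains_pairing
    (exists_isRuling_idColor I.isIdentifiers hg Network.trail_movesIndexLtTwo 3) hX.2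

theorem chainGraph_cubic (hg : Nat.log 2 (Fintype.card I.Node) + 1 ≤ 2 ^ g I.size)
    (hX : (I.trailGraph g).IsSinkless X) : (I.chainGraph X).Cubic :=
  Network.chainGraph_cubic (fun v => hX.1 (v, 0)) (hasShortChains_pairing hg hX)

end Instance

theorem exists_isTwoOutOrientation_of_not_fails (hg : ∀ n, 1 ≤ g n) (b : Prop) (B : ℕ)
    {coin coin' : ∀ I : Instance S k, I.Slot → Prop} (hcoin : IsLocal g coin)
    (hcoin' : IsLocal g coin') :
    ∃ (C C' : ℕ) (x : ∀ I : Instance S k, I.Slot → Prop), IsLocal g x ∧ ∀ I : Instance S k,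
      Nat.log 2 (Fintype.card I.Node) + 1 ≤ 2 ^ g I.size →
      (∀ c, ¬ (I.trailGraph g).Fails g b B (coin I) c) →
      (I.chainGraph ((I.trailGraph g).coinOrientation g b C C' (coin I))).Cubic ∧
      ((∀ c, ¬ (I.chainGraph ((I.trailGraph g).coinOrientation g b C C' (coin I))).Fails g b B
        (coin' I) c) → I.net.IsTwoOutOrientation (x I)) := by
  have htrail : HalfEdgeGraph.IsLocalGraph g fun I : Instance S k => I.trailGraph g :=
    .trailGraph hg (IsLocal.isRuling hg (.trail hg) 3)
  obtain ⟨C, C', hX, hsinkless⟩ := htrail.exists_isSinkless_coinOrientation hg b B hcoin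
  obtain ⟨_, _, hY, hsinkless'⟩ := (HalfEdgeGraph.IsLocalGraph.chainGraph hg hX
    chainBound).exists_isSinkless_coinOrientation hg b B hcoin'
  refine ⟨C, C', _, IsLocal.expand hg hX hY chainBound, fun I hI hfails => ?_⟩
  have hs := hsinkless I I.trailGraph_cubic hfails
  have hcubic := Instance.chainGraph_cubic hI hs
  exact ⟨hcubic, fun hfails' => Network.isTwoOutOrientation_expand (fun v => hs.1 (v, 0))
    (Instance.hasShortChains_pairing hI hs) (hsinkless' I hcubic hfails')
    (tagKey_injective.comp I.tag_injective)⟩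

theorem exists_isLocal_isTwoOutOrientation (hg : ∀ n, Nat.log 2 n + 1 ≤ g n) :
    ∃ x : ∀ I : Instance S k, I.Slot → Prop, IsLocal g x ∧
      ∀ I : Instance S k, I.net.IsTwoOutOrientation (x I) := by
  obtain ⟨C, C', x, hlocal, hx⟩ := exists_isTwoOutOrientation_of_not_fails (S := S) (k := k)
    (fun n => (Nat.le_add_left _ _).trans (hg n)) False 6 (.const True) (.const True)
  refine ⟨x, hlocal, fun I => ?_⟩
  obtain ⟨hcubic, hgood⟩ := hx I ((hg I.size).trans Nat.lt_two_pow_self.le) <|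
    HalfEdgeGraph.not_fails_false I.trailGraph_cubic (fun _ => I.snd_lt_two_of_isNode_trailGraph)
      le_rfl (hg _)
  exact hgood <| HalfEdgeGraph.not_fails_false hcubic
    (fun _ hw => by simp [I.snd_eq_zero_of_isNode_chainGraph hw]) le_rfl (hg _)

end Pipeline

/-! ### Failure probabilities -/

section FailureProb
variable {Ω : Type}

theorem failureProb_eq_ncard (E : Ω → Prop) :
    failureProb E = {ω | ¬ E ω}.ncard / Nat.card Ω :=
  rfl

theorem failureProb_comp_equiv {Ω' : Type} (f : Ω ≃ Ω') (E : Ω' → Prop) :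
    failureProb (fun ω => E (f ω)) = failureProb E := by
  rw [failureProb, failureProb, Nat.card_congr f,
    Nat.card_congr (f.subtypeEquiv (q := fun ω => ¬ E ω) fun _ => Iff.rfl)]

theorem failureProb_mono [Finite Ω] {E F : Ω → Prop} (h : ∀ ω, E ω → F ω) :
    failureProb F ≤ failureProb E :=
  div_le_div_of_nonneg_right (Nat.cast_le.2 (Set.ncard_le_ncard fun ω => mt (h ω)))
    (Nat.cast_nonneg _)

theorem failureProb_and_le (E F : Ω → Prop) :
    failureProb (fun ω => E ω ∧ F ω) ≤ failureProb E + failureProb F := by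
  simp only [failureProb_eq_ncard, ← add_div, not_and_or, Set.ofPred_or]
  exact div_le_div_of_nonneg_right (mod_cast Set.ncard_union_le _ _) (Nat.cast_nonneg _)

theorem failureProb_forall_mem_le {β : Type*} (s : Finset β) (E : β → Ω → Prop) :
    failureProb (fun ω => ∀ z ∈ s, E z ω) ≤ ∑ z ∈ s, failureProb (E z) := by
  classical
  induction s using Finset.induction_on with
  | empty => simp [failureProb]
  | insert z s hz ih =>
    simp only [Finset.forall_mem_insert, Finset.sum_insert hz]
    exact (failureProb_and_le _ _).trans (add_le_add_right ih _)

end FailureProb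

section Coins
variable {α : Type} [DecidableEq α]

/-- The outcome of coins after those in `s` have been turned over. -/
def turnOver (s : Finset α) (ω : α → Bool) : α → Bool := fun a => if a ∈ s then !ω a else ω a

theorem turnOver_turnOver (s : Finset α) (ω : α → Bool) : turnOver s (turnOver s ω) = ω := by
  funext a
  by_cases h : a ∈ s <;> simp [turnOver, h]

theorem turnOver_of_notMem {s : Finset α} {ω : α → Bool} {a : α} (h : a ∉ s) :
    turnOver s ω a = ω a := if_neg h

theorem mem_iff_of_turnOver {A s : Finset α} {T : Set α} {ω : α → Bool}
    (hω : ∀ a ∈ A, (ω a = true ↔ a ∈ T)) (hs : s ⊆ A) {a : α} :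
    a ∈ s ↔ a ∈ A ∧ ¬ (turnOver s ω a = true ↔ a ∈ T) := by
  by_cases ha : a ∈ s
  · simp [ha, hs ha, turnOver, ← hω a (hs ha)]
  · simp only [ha, turnOver_of_notMem ha, false_iff, not_and, not_not]
    exact hω a

/-- Turning over subsets of the prescribed coins turns each outcome in the event into `2 ^ q`
outcomes, and all of these are different since the prescription does not change. -/
theorem failureProb_le_of_prescribed [Finite α] {E : (α → Bool) → Prop} {q : ℕ}
    (A : (α → Bool) → Finset α) (T : (α → Bool) → Set α)
    (hcongr : ∀ ω, ∀ s ⊆ A ω, A (turnOver s ω) = A ω ∧ T (turnOver s ω) = T ω)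
    (hE : ∀ ω, ¬ E ω → q ≤ (A ω).card ∧ ∀ a ∈ A ω, (ω a = true ↔ a ∈ T ω)) :
    failureProb E ≤ 1 / 2 ^ q := by
  classical
  have := Fintype.ofFinite {ω // ¬ E ω}
  have hinj : Function.Injective
      fun p : Σ ω : {ω // ¬ E ω}, (A ω).powerset => turnOver p.2 p.1.1 := by
    rintro ⟨⟨ω, hω⟩, s, hs⟩ ⟨⟨ω', hω'⟩, s', hs'⟩ (heq : turnOver s ω = turnOver s' ω')
    rw [Finset.mem_powerset] at hs hs'
    obtain ⟨hA, hT⟩ := hcongr ω s hs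
    obtain ⟨hA', hT'⟩ := hcongr ω' s' hs'
    obtain rfl : s = s' := by
      ext a
      rw [mem_iff_of_turnOver (hE ω hω).2 hs, mem_iff_of_turnOver (hE ω' hω').2 hs', ← hA, ← hT,
        ← hA', ← hT', heq]
    obtain rfl : ω = ω' := by rw [← turnOver_turnOver s ω, heq, turnOver_turnOver]
    rfl
  have hcard : Nat.card {ω // ¬ E ω} * 2 ^ q ≤ Nat.card (α → Bool) := by
    refine le_trans ?_ (Nat.card_le_card_of_injective _ hinj)
    rw [Nat.card_sigma, Nat.card_eq_fintype_card, ← Finset.card_univ, ← smul_eq_mul]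
    refine Finset.card_nsmul_le_sum _ _ _ fun ω _ => ?_
    rw [Nat.card_eq_fintype_card, Fintype.card_coe, Finset.card_powerset]
    exact Nat.pow_le_pow_right two_pos (hE ω.1 ω.2).1
  rw [failureProb, div_le_div_iff₀ (Nat.cast_pos.2 Nat.card_pos) (by positivity), one_mul]
  exact_mod_cast hcard

end Coins

section RandomOrientations
variable {S : ℕ → Type} {k : ℕ} {g : ℕ → ℕ}

theorem failureProb_not_fails_le {I : Instance S k} {α : Type} [Finite α]
    (G : (α → Bool) → HalfEdgeGraph I.Slot) (coinAt : I.Slot → α)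
    (hG : ∀ ω ω', (∀ a ∉ Set.range coinAt, ω a = ω' a) → G ω = G ω')
    (hindex : ∀ ω w, (G ω).IsNode w → w.2 < 2)
    (hcoinAt : ∀ ω, Set.InjOn coinAt {w | (G ω).IsNode w})
    (hg : Nat.log 2 (Fintype.card I.Node) + 1 ≤ 2 ^ g I.size) {B e : ℕ}
    (hB : 2 * (g I.size + e + 1 + 2 * HalfEdgeGraph.selectedRadius) +
      HalfEdgeGraph.selectedRadius < B * g I.size) (c : I.Slot) :
    failureProb (fun ω => (G ω).Cubic →
      ¬ (G ω).Fails g True B (fun m => ω (coinAt m) = true) c) ≤ 1 / 2 ^ (e * 2 ^ g I.size) := by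
  classical
  set touched : HalfEdgeGraph I.Slot → Finset I.Slot := fun H =>
    H.touched (H.Selected g True) I.smallSlots (B * g I.size) c
  set outside : HalfEdgeGraph I.Slot → Set I.Slot := fun H =>
    {m | H.IsNode m ∧ m ∉ H.ball (H.Special (H.Selected g True)) c (B * g I.size)}
  have hnode : ∀ H, ∀ m ∈ touched H, H.IsNode m := fun H m hm => (Finset.mem_filter.1 hm).2.1.1
  refine failureProb_le_of_prescribed (fun ω => (touched (G ω)).image coinAt)
    (fun ω => coinAt '' outside (G ω)) ?_ fun ω hω => ?_
  · intro ω s hs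
    rw [hG (turnOver s ω) ω fun a ha => turnOver_of_notMem fun h => ha ?_]
    · exact ⟨rfl, rfl⟩
    · obtain ⟨m, -, rfl⟩ := Finset.mem_image.1 (hs h)
      exact ⟨m, rfl⟩
  · obtain ⟨hcubic, hfails⟩ := Classical.not_imp.1 hω
    rw [not_not] at hfails
    refine ⟨?_, fun a ha => ?_⟩
    · rw [Finset.card_image_of_injOn ((hcoinAt ω).mono (hnode _))]
      exact hfails.le_card_touched hcubic (hindex ω) hg hB
    · obtain ⟨m, hm, rfl⟩ := Finset.mem_image.1 ha
      rw [hfails.2.coin_iff_of_mem_touched hcubic hcubic.eq_of_selected hm,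
        (hcoinAt ω).mem_image_iff (fun _ h => h.1) (hnode _ m hm)]
      exact ⟨fun h => ⟨hnode _ m hm, h⟩, fun h => h.2⟩

theorem four_mul_pow_le_two_pow {n γ : ℕ} (h : Nat.log 2 n + 1 ≤ 2 ^ γ) (c : ℕ) :
    4 * n ^ (c + 1) ≤ 2 ^ ((c + 3) * 2 ^ γ) := by
  have hn : n ≤ 2 ^ 2 ^ γ :=
    (Nat.lt_pow_succ_log_self one_lt_two n).le.trans (Nat.pow_le_pow_right two_pos h)
  have htwo : 2 ≤ 2 ^ 2 ^ γ := Nat.le_self_pow (by positivity) 2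
  calc
    4 * n ^ (c + 1) ≤ (2 ^ 2 ^ γ) ^ 2 * (2 ^ 2 ^ γ) ^ (c + 1) :=
      Nat.mul_le_mul (Nat.pow_le_pow_left htwo 2) (Nat.pow_le_pow_left hn _)
    _ = 2 ^ ((c + 3) * 2 ^ γ) := by rw [← pow_add, ← pow_mul]; ring_nf

theorem four_mul_div_two_pow_le {n γ : ℕ} (h : Nat.log 2 n + 1 ≤ 2 ^ γ) (c : ℕ) :
    (4 * n : ℝ) / 2 ^ ((c + 3) * 2 ^ γ) ≤ 1 / (n : ℝ) ^ c := by
  obtain rfl | hn := Nat.eq_zero_or_pos n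
  · simp
  · rw [div_le_div_iff₀ (by positivity) (by positivity), one_mul, mul_assoc, ← pow_succ']
    exact_mod_cast four_mul_pow_le_two_pow h c

/-- The instance with other random strings. -/
abbrev Instance.withRandom (I : Instance S k) (ω : I.Node → S (Fintype.card I.Node)) :
    Instance S k :=
  { I with random := ω }

/-- The random bit that is used by a node of the trail graph: the bits `0` and `1` of each network
node are reserved for these, and bit `2` for the chain graph. -/
def trailCoin {V : Type} (m : V × ℕ) : V × Fin 3 := (m.1, if m.2 = 0 then 0 else 1)

theorem injOn_trailCoin {V : Type} {s : Set (V × ℕ)} (hs : ∀ m ∈ s, m.2 < 2) :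
    Set.InjOn trailCoin s := by
  intro m hm m' hm' heq
  have := hs m hm
  have := hs m' hm'
  obtain ⟨hfst, hsnd⟩ := Prod.mk.inj heq
  refine Prod.ext hfst ?_
  split_ifs at hsnd <;> lia

theorem failureProb_le_of_smallSlots {Ω : Type} [Finite Ω] {I : Instance S k} {E : Ω → Prop}
    {E₁ E₂ : I.Slot → Ω → Prop} {p : ℝ} (h : ∀ ω, (∀ z ∈ I.smallSlots, E₁ z ω ∧ E₂ z ω) → E ω)
    (h₁ : ∀ z, failureProb (E₁ z) ≤ p) (h₂ : ∀ z, failureProb (E₂ z) ≤ p) :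
    failureProb E ≤ 4 * I.size * p :=
  calc
    failureProb E ≤ ∑ z ∈ I.smallSlots, failureProb (fun ω => E₁ z ω ∧ E₂ z ω) :=
      (failureProb_mono h).trans (failureProb_forall_mem_le I.smallSlots _)
    _ ≤ ∑ _z ∈ I.smallSlots, (p + p) := Finset.sum_le_sum fun z _ =>
      (failureProb_and_le _ _).trans (add_le_add (h₁ z) (h₂ z))
    _ = 4 * I.size * p := by
      rw [Finset.sum_const, I.card_smallSlots, nsmul_eq_mul]
      push_cast
      ring

theorem failureProb_isTwoOutOrientation_le {I : Instance (fun _ => Fin 3 → Bool) k}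
    (hg : Nat.log 2 (Fintype.card I.Node) + 1 ≤ 2 ^ g I.size) {B C C' c : ℕ}
    (hB : 2 * (g I.size + (c + 3) + 1 + 2 * HalfEdgeGraph.selectedRadius) +
      HalfEdgeGraph.selectedRadius < B * g I.size)
    {x X : (I.Node × Fin 3 → Bool) → I.Slot → Prop}
    (hX : ∀ ω, X ω =
      (I.trailGraph g).coinOrientation g True C C' fun m => ω (trailCoin m) = true)
    (hx : ∀ ω, (∀ z, ¬ (I.trailGraph g).Fails g True B (fun m => ω (trailCoin m) = true) z) →
      (I.chainGraph (X ω)).Cubic ∧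
      ((∀ z, ¬ (I.chainGraph (X ω)).Fails g True B (fun m => ω (m.1, 2) = true) z) →
        I.net.IsTwoOutOrientation (x ω))) :
    failureProb (fun ω => I.net.IsTwoOutOrientation (x ω)) ≤
      1 / (Fintype.card I.Node : ℝ) ^ c := by
  have htrail := failureProb_not_fails_le (fun _ => I.trailGraph g) trailCoin
    (fun _ _ _ => rfl) (fun _ _ => I.snd_lt_two_of_isNode_trailGraph)
    (fun _ => injOn_trailCoin fun _ => I.snd_lt_two_of_isNode_trailGraph) hg hB
  have hzero : ∀ ω w, (I.chainGraph (X ω)).IsNode w → w.2 = 0 :=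
    fun _ _ => I.snd_eq_zero_of_isNode_chainGraph
  have hchain := failureProb_not_fails_le (fun ω => I.chainGraph (X ω)) (fun m => (m.1, 2))
    (fun ω ω' h => ?_) (fun _ w hw => by simp [hzero _ w hw])
    (fun ω m hm m' hm' heq =>
      Prod.ext (Prod.mk.inj heq).1 ((hzero ω m hm).trans (hzero ω m' hm').symm)) hg hB
  · refine (failureProb_le_of_smallSlots (fun ω h => ?_) htrail hchain).trans
      ((mul_one_div _ _).trans_le (four_mul_div_two_pow_le hg c))
    obtain ⟨hcubic, hgood⟩ := hx ω fun z hz => (h z (Instance.mem_smallSlots.2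
      (I.snd_lt_two_of_isNode_trailGraph hz.1))).1 I.trailGraph_cubic hz
    exact hgood fun z hz => (h z (Instance.mem_smallSlots.2
      (by simp [hzero ω z hz.1]))).2 hcubic hz
  · have hcoin : ∀ m : I.Slot, ω (trailCoin m) = ω' (trailCoin m) := fun m => h _ <| by
      rintro ⟨m', hm'⟩
      have := congrArg Prod.snd hm'
      dsimp only [trailCoin] at this
      split_ifs at this <;> simp at this
    simp only [hX, hcoin]

theorem exists_isLocal_failureProb_isTwoOutOrientation_le (hg : ∀ n, 1 ≤ g n)
    (hlog : ∀ n, Nat.log 2 n + 1 ≤ 2 ^ g n) (c : ℕ) :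
    ∃ x : ∀ I : Instance (fun _ => Fin 3 → Bool) k, I.Slot → Prop, IsLocal g x ∧
      ∀ I : Instance (fun _ => Fin 3 → Bool) k,
        failureProb (fun ω : I.Node → Fin 3 → Bool =>
          I.net.IsTwoOutOrientation (x (I.withRandom ω))) ≤ 1 / (Fintype.card I.Node : ℝ) ^ c := by
  set r := HalfEdgeGraph.selectedRadius
  have hB : ∀ n, 2 * (g n + (c + 3) + 1 + 2 * r) + r < (2 * (c + 5 + 2 * r) + r + 1) * g n := by
    intro n
    have := Nat.mul_le_mul_left (2 * (c + 4 + 2 * r) + r + 1) (hg n)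
    linarith
  have hrandom : IsLocal g fun (I : Instance (fun _ => Fin 3 → Bool) k) m => I.random m.1 :=
    (IsLocal.random (S := fun _ => Fin 3 → Bool)).map Sigma.snd
  obtain ⟨C, C', x, hlocal, hx⟩ := exists_isTwoOutOrientation_of_not_fails
    (S := fun _ => Fin 3 → Bool) (k := k) hg True (2 * (c + 5 + 2 * r) + r + 1)
    (coin := fun I m => I.random m.1 (trailCoin m).2 = true)
    (coin' := fun I m => I.random m.1 2 = true)
    (hrandom.map₂ (fun s i => s (if i = 0 then 0 else 1) = true) .index)
    (hrandom.map fun s => s 2 = true)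
  refine ⟨x, hlocal, fun I => ?_⟩
  rw [← failureProb_comp_equiv (Equiv.curry I.Node (Fin 3) Bool)]
  exact failureProb_isTwoOutOrientation_le (hlog _) (hB _) (fun _ => rfl) fun ω hω =>
    hx (I.withRandom (Function.curry ω)) (hlog _) hω

end RandomOrientations

/-! ### Outputs and round bounds -/

section Outputs
variable {V : Type} {N : Network V}

open Classical in
/-- The labels `true` and `false` of the half-edges of a network that encode the predicate `x`. -/
noncomputable def portLabels (N : Network V) (x : V × ℕ → Prop) (p : N.Port) : Bool :=
  decide (x (p.1, p.2))

theorem portLabels_eq_true {x : V × ℕ → Prop} {p : N.Port} :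
    portLabels N x p = true ↔ x (p.1, p.2) := by
  simp [portLabels]

theorem portLabels_eq_false {x : V × ℕ → Prop} {p : N.Port} :
    portLabels N x p = false ↔ ¬ x (p.1, p.2) := by
  simp [portLabels]

namespace Network

theorem mate_port (p : N.Port) : N.mate (p.1, p.2) = ((N.opp p).1, ((N.opp p).2 : ℕ)) := by
  simp [mate, neighbor]

open Classical in
theorem count_portLabels (x : V × ℕ → Prop) (v : V) :
    N.count (portLabels N x) v = Nat.count (fun i => x (v, i)) (N.deg v) := by
  simp only [count, portLabels_eq_true, Nat.count_eq_card_filter_range, Finset.card_filter]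
  exact Fin.sum_univ_eq_sum_range (fun i => if x (v, i) then 1 else 0) (N.deg v)

theorem two_le_count {x : N.Port → Bool} {v : V} {i j : Fin (N.deg v)} (hij : i ≠ j)
    (hi : x ⟨v, i⟩ = true) (hj : x ⟨v, j⟩ = true) : 2 ≤ N.count x v :=
  Finset.one_lt_card.2 ⟨i, by simpa using hi, j, by simpa using hj, hij⟩

theorem IsRedWalk.succ_ne {red : N.Port → Bool} {m : ℕ} {h : ℕ → N.Port}
    (hwalk : N.IsRedWalk red m h) {i : ℕ} (hi : i + 1 < m) : h (i + 1) ≠ h i := by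
  obtain ⟨-, s, hs⟩ := hwalk
  have hstep := hs i hi
  split_ifs at hstep
  · exact hstep ▸ N.opp_ne _
  · exact hstep.2

theorem IsRedWalk.le_two {red : N.Port → Bool} (hred : ∀ p, red p = true → red (N.opp p) = false)
    {m : ℕ} {h : ℕ → N.Port} (hwalk : N.IsRedWalk red m h) : m ≤ 2 := by
  obtain ⟨hwalk, s, hs⟩ := hwalk
  have not_even (i : ℕ) (hi : i + 1 < m) : ¬ Even (i + s) := fun heven => by
    have hstep := hs i hi
    rw [if_pos heven] at hstep
    exact Bool.false_ne_true <|
      (hred _ (hwalk i (Nat.lt_of_succ_lt hi))).symm.trans (hstep ▸ hwalk (i + 1) hi)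
  by_contra! hm
  have h₀ := not_even 0 (by lia)
  have h₁ := not_even 1 (by lia)
  grind

theorem isHalfPathDecomposition_two {red : N.Port → Bool}
    (hred : ∀ p, red p = true → red (N.opp p) = false) (hcount : ∀ v, N.count red v = 2) :
    N.IsHalfPathDecomposition 2 red where
  two_red := hcount
  no_cycle m h hwalk := by
    have hm := hwalk.le_two hred
    have injOn (i j : ℕ) (hij : i < j) (hj : j < m) : h i ≠ h j := by
      obtain rfl : j = i + 1 := by lia
      exact (hwalk.succ_ne hj).symm
    intro i hi j hj heq
    obtain hij | hij | hij := lt_trichotomy i j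
    · exact absurd heq (injOn i j hij hj)
    · exact hij
    · exact absurd heq.symm (injOn j i hij hi)
  length_le _ _ hwalk := hwalk.le_two hred

theorem IsHalfPathDecomposition.mono {k l : ℕ} (hkl : k ≤ l) {red : N.Port → Bool}
    (h : N.IsHalfPathDecomposition k red) : N.IsHalfPathDecomposition l red :=
  ⟨h.two_red, h.no_cycle, fun m p hp => (h.length_le m p hp).trans hkl⟩

namespace IsTwoOutOrientation
variable {x : V × ℕ → Prop}

theorem apply_opp (h : N.IsTwoOutOrientation x) (p : N.Port) :
    x ((N.opp p).1, (N.opp p).2) ↔ ¬ x (p.1, p.2) := by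
  rw [← mate_port]
  exact h.1 _

theorem isOrientation (h : N.IsTwoOutOrientation x) : N.IsOrientation (portLabels N x) := by
  intro p
  rw [Bool.eq_iff_iff, Bool.not_eq_true', portLabels_eq_true, portLabels_eq_false, h.apply_opp]

theorem two_le_outdeg (h : N.IsTwoOutOrientation x) {v : V} (hv : 5 ≤ N.deg v) :
    2 ≤ N.outdeg (portLabels N x) v := by
  obtain ⟨i, j, hij, hi, hj, hxi, hxj⟩ := h.2 v hv
  exact two_le_count (i := ⟨i, hi.trans_le hv⟩) (j := ⟨j, hj.trans_le hv⟩)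
    (Fin.ne_of_val_ne hij) (portLabels_eq_true.2 hxi) (portLabels_eq_true.2 hxj)

theorem outdegreeTwo (h : N.IsTwoOutOrientation x) : outdegreeTwo V N (portLabels N x) :=
  ⟨h.isOrientation, fun _ hv => h.two_le_outdeg hv⟩

end IsTwoOutOrientation

end Network

open Classical in
/-- The first two half-edges of each node at which `x` holds. -/
def firstTwo (x : V × ℕ → Prop) (z : V × ℕ) : Prop :=
  x z ∧ Nat.count (fun i => x (z.1, i)) z.2 < 2

open Classical in
theorem count_and_count_lt (p : ℕ → Prop) (l d : ℕ) :
    Nat.count (fun i => p i ∧ Nat.count p i < l) d = min l (Nat.count p d) := by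
  induction d with
  | zero => simp
  | succ d ih =>
    rw [Nat.count_succ, Nat.count_succ, ih]
    split_ifs <;> grind

/-- In a multigraph with minimum degree at least 5, find a decomposition with half-paths of length
at most 2. -/
def halfPathTwo : Problem Bool := fun _ N red =>
  (∀ v, 5 ≤ N.deg v) → N.IsHalfPathDecomposition 2 red

/-- Only one half of each edge is outgoing, so a half-path of outgoing half-edges uses no edge
entirely. -/
theorem Network.IsTwoOutOrientation.halfPathTwo {x : V × ℕ → Prop}
    (h : N.IsTwoOutOrientation x) : halfPathTwo V N (portLabels N (firstTwo x)) := by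
  classical
  refine fun hdeg => isHalfPathDecomposition_two (fun p hp => ?_) fun v => ?_
  · rw [portLabels_eq_true] at hp
    exact portLabels_eq_false.2 fun hopp => (h.apply_opp p).1 hopp.1 hp.1
  · have hout := h.two_le_outdeg (hdeg v)
    rw [outdeg, count_portLabels] at hout
    rw [count_portLabels, ← min_eq_left hout, ← count_and_count_lt]
    congr!

theorem outdegreeTwoRegular_of_outdegreeTwo (V : Type) (N : Network V) (x : N.Port → Bool)
    (h : outdegreeTwo V N x) :
    outdegreeTwoRegular V N x :=
  fun hreg => ⟨h.1, fun v => h.2 v (hreg v).ge⟩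

theorem halfPathEight_of_halfPathTwo (V : Type) (N : Network V) (red : N.Port → Bool)
    (h : halfPathTwo V N red) :
    halfPathEight V N red :=
  fun hreg => (h fun v => (hreg v).ge).mono (by lia)

end Outputs

section Solvable
open Filter Asymptotics

variable {S : ℕ → Type} {k : ℕ} {f : ℕ → ℝ} {g : ℕ → ℕ} {P Q : Problem Bool}

theorem IsLocal.firstTwo {x : ∀ I : Instance S k, I.Slot → Prop} (hx : IsLocal g x) :
    IsLocal g fun I => firstTwo (x I) := by
  classical
  have hnode : IsLocal g fun (I : Instance S k) z i => x I (z.1, i) := by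
    obtain ⟨C, hC⟩ := hx
    exact ⟨C, fun I J z y hsize _ hview => funext fun i =>
      hC I J (z.1, i) (y.1, i) hsize rfl hview⟩
  exact hx.and (hnode.map₂ (fun p i => Nat.count p i < 2) .index)

theorem IsLocal.exists_algorithm_portLabels {x : ∀ I : Instance S k, I.Slot → Prop}
    (hx : IsLocal g x) :
    ∃ (A : Algorithm S Bool) (C : ℕ), ∀ I : Instance S k,
      A.run I.net I.ident I.random (C * g I.size) = portLabels I.net (x I) := by
  classical
  exact (hx.map fun p => decide p).exists_algorithm

theorem isBigO_const_mul_natCast (hg : (fun n => (g n : ℝ)) =O[atTop] f) (C : ℕ) :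
    (fun n => ((C * g n : ℕ) : ℝ)) =O[atTop] f := by
  simpa using hg.const_mul_left (C : ℝ)

theorem detSolvable_of_isLocal (hg : (fun n => (g n : ℝ)) =O[atTop] f)
    (h : ∀ k, ∃ x : ∀ I : Instance (fun _ => Unit) k, I.Slot → Prop, IsLocal g x ∧
      ∀ I : Instance (fun _ => Unit) k, P I.Node I.net (portLabels I.net (x I))) :
    DetSolvable P f := by
  intro k
  obtain ⟨x, hx, hP⟩ := h k
  obtain ⟨A, C, hA⟩ := hx.exists_algorithm_portLabels
  refine ⟨A, fun n => C * g n, isBigO_const_mul_natCast hg C, fun V _ N ident hident => ?_⟩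
  let I : Instance (fun _ => Unit) k := ⟨V, N, ident, hident, fun _ => ()⟩
  exact (congrArg (P V N) (hA I)).mpr (hP I)

theorem randSolvable_of_isLocal (hg : (fun n => (g n : ℝ)) =O[atTop] f)
    (h : ∀ k c, ∃ (b : ℕ → ℕ) (x : ∀ I : Instance (fun n => Fin (b n) → Bool) k, I.Slot → Prop),
      IsLocal g x ∧ ∀ I : Instance (fun n => Fin (b n) → Bool) k,
        failureProb (fun ω => P I.Node I.net (portLabels I.net (x (I.withRandom ω)))) ≤
          1 / (Fintype.card I.Node : ℝ) ^ c) :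
    RandSolvable P f := by
  intro k c
  obtain ⟨b, x, hx, hP⟩ := h k c
  obtain ⟨A, C, hA⟩ := hx.exists_algorithm_portLabels
  refine ⟨b, A, fun n => C * g n, isBigO_const_mul_natCast hg C, fun V _ N ident hident => ?_⟩
  let I : Instance (fun n => Fin (b n) → Bool) k := ⟨V, N, ident, hident, fun _ _ => false⟩
  exact (congrArg failureProb (funext fun ω => congrArg (P V N) (hA (I.withRandom ω)))).trans_le
    (hP I)

theorem DetSolvable.mono (hPQ : ∀ V N x, P V N x → Q V N x) (h : DetSolvable P f) :
    DetSolvable Q f := fun k =>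
  let ⟨A, T, hT, hA⟩ := h k
  ⟨A, T, hT, fun V _ N ident hident => hPQ V N _ (hA V N ident hident)⟩

theorem RandSolvable.mono (hPQ : ∀ V N x, P V N x → Q V N x) (h : RandSolvable P f) :
    RandSolvable Q f := fun k c =>
  let ⟨b, A, T, hT, hA⟩ := h k c
  ⟨b, A, T, hT, fun V _ N ident hident =>
    (failureProb_mono fun _ => hPQ V N _).trans (hA V N ident hident)⟩

theorem isBigO_natLog_add_one :
    (fun n : ℕ => ((Nat.log 2 n + 1 : ℕ) : ℝ)) =O[atTop] fun n : ℕ => Real.log n := by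
  have hlog : (fun n : ℕ => (Nat.log 2 n : ℝ)) =O[atTop] fun n : ℕ => Real.log n := by
    refine .of_bound (Real.log 2)⁻¹ (.of_forall fun n => ?_)
    rw [Real.norm_natCast, Real.norm_of_nonneg (Real.log_natCast_nonneg n), inv_mul_eq_div]
    exact Real.natLog_le_logb n 2
  have hone : (fun _ => (1 : ℝ)) =O[atTop] fun n : ℕ => Real.log n :=
    (Real.isLittleO_const_log_atTop.comp_tendsto tendsto_natCast_atTop_atTop).isBigO
  simpa using hlog.add hone

theorem tendsto_natLog_atTop : Tendsto (Nat.log 2) atTop atTop :=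
  Nat.log_monotone.tendsto_atTop_atTop fun b => ⟨2 ^ b, (Nat.log_pow one_lt_two b).ge⟩

theorem isBigO_log_natLog :
    (fun n : ℕ => Real.log (Nat.log 2 n)) =O[atTop] fun n : ℕ => Real.log (Real.log n) := by
  have htendsto : Tendsto (fun n : ℕ => Real.log n) atTop atTop :=
    Real.tendsto_log_atTop.comp tendsto_natCast_atTop_atTop
  refine IsBigO.trans (.of_bound 1 ?_) ((isBigO_refl _ _).sub
    (Real.isLittleO_const_log_atTop (c := Real.log (Real.log 2)) |>.comp_tendsto htendsto).isBigO)
  filter_upwards [eventually_ge_atTop 2] with n hn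
  have hpos : 0 < Nat.log 2 n := Nat.log_pos one_lt_two hn
  have hlog : 0 < Real.log n := Real.log_pos (by exact_mod_cast hn)
  rw [Real.norm_of_nonneg (Real.log_natCast_nonneg _), one_mul]
  refine le_trans ?_ (le_abs_self _)
  rw [Function.comp_apply, ← Real.log_div hlog.ne' (Real.log_pos one_lt_two).ne']
  exact Real.log_le_log (Nat.cast_pos.2 hpos) (Real.natLog_le_logb n 2)

theorem isBigO_natLog_natLog_add_one :
    (fun n : ℕ => ((Nat.log 2 (Nat.log 2 n) + 1 : ℕ) : ℝ)) =O[atTop]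
      fun n : ℕ => Real.log (Real.log n) :=
  (isBigO_natLog_add_one.comp_tendsto tendsto_natLog_atTop).trans isBigO_log_natLog

theorem detSolvable_of_isTwoOutOrientation (F : ∀ {V : Type}, (V × ℕ → Prop) → V × ℕ → Prop)
    (hF : ∀ {k : ℕ} {g : ℕ → ℕ} {x : ∀ I : Instance (fun _ => Unit) k, I.Slot → Prop},
      IsLocal g x → IsLocal g fun I => F (x I))
    (hP : ∀ (V : Type) (N : Network V) x, N.IsTwoOutOrientation x → P V N (portLabels N (F x))) :
    DetSolvable P fun n => Real.log n :=
  detSolvable_of_isLocal isBigO_natLog_add_one fun _ =>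
    let ⟨_, hlocal, hx⟩ := exists_isLocal_isTwoOutOrientation fun _ => le_rfl
    ⟨_, hF hlocal, fun I => hP _ _ _ (hx I)⟩

theorem randSolvable_of_isTwoOutOrientation (F : ∀ {V : Type}, (V × ℕ → Prop) → V × ℕ → Prop)
    (hF : ∀ {k : ℕ} {g : ℕ → ℕ} {x : ∀ I : Instance (fun _ => Fin 3 → Bool) k, I.Slot → Prop},
      IsLocal g x → IsLocal g fun I => F (x I))
    (hP : ∀ (V : Type) (N : Network V) x, N.IsTwoOutOrientation x → P V N (portLabels N (F x))) :
    RandSolvable P fun n => Real.log (Real.log n) :=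
  randSolvable_of_isLocal isBigO_natLog_natLog_add_one fun _ c =>
    let ⟨_, hlocal, hx⟩ := exists_isLocal_failureProb_isTwoOutOrientation_le
      (fun _ => Nat.le_add_left _ _) (fun _ => Nat.lt_pow_succ_log_self one_lt_two _) c
    ⟨fun _ => 3, _, hF hlocal, fun I => (failureProb_mono fun _ => hP _ _ _).trans (hx I)⟩

end Solvable

end LocalModel

theorem mainTheorem7_general :
    (LocalModel.DetSolvable LocalModel.outdegreeTwo (fun n => Real.log n) ∧
      LocalModel.RandSolvable LocalModel.outdegreeTwo (fun n => Real.log (Real.log n))) ∧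
    (LocalModel.DetSolvable LocalModel.halfPathTwo (fun n => Real.log n) ∧
      LocalModel.RandSolvable LocalModel.halfPathTwo (fun n => Real.log (Real.log n))) := by
  open LocalModel in
  have out := fun V (N : Network V) x (h : N.IsTwoOutOrientation x) => h.outdegreeTwo
  have half := fun V (N : Network V) x (h : N.IsTwoOutOrientation x) => h.halfPathTwo
  exact
    ⟨⟨detSolvable_of_isTwoOutOrientation (fun x => x) (fun h => h) out,
      randSolvable_of_isTwoOutOrientation (fun x => x) (fun h => h) out⟩,
    ⟨detSolvable_of_isTwoOutOrientation firstTwo (fun h => h.firstTwo) half,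
      randSolvable_of_isTwoOutOrientation firstTwo (fun h => h.firstTwo) half⟩⟩

theorem mainTheorem7 :
    (LocalModel.DetSolvable LocalModel.outdegreeTwo (fun n => Real.log n) ∧
      LocalModel.RandSolvable LocalModel.outdegreeTwo (fun n => Real.log (Real.log n))) ∧
    (LocalModel.DetSolvable LocalModel.outdegreeTwoRegular (fun n => Real.log n) ∧
      LocalModel.RandSolvable LocalModel.outdegreeTwoRegular (fun n => Real.log (Real.log n))) ∧
    (LocalModel.DetSolvable LocalModel.halfPathEight (fun n => Real.log n) ∧
      LocalModel.RandSolvable LocalModel.halfPathEight (fun n => Real.log (Real.log n))) := by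
  open LocalModel in
  obtain ⟨⟨hdet, hrand⟩, hdet', hrand'⟩ := mainTheorem7_general
  exact ⟨⟨hdet, hrand⟩,
    ⟨hdet.mono outdegreeTwoRegular_of_outdegreeTwo, hrand.mono outdegreeTwoRegular_of_outdegreeTwo⟩,
    ⟨hdet'.mono halfPathEight_of_halfPathTwo, hrand'.mono halfPathEight_of_halfPathTwo⟩⟩
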